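/- Let $U \subseteq M$ be open subsets of $\mathbb{R}^n$ and let $V$ be a finite-dimensional real or complex vector space. For an open set $W\subseteq\mathbb R^n$ and a finite-dimensional vector space $F$, the space $C^\infty(W,F)$ carries its Fréchet topology (uniform convergence of all derivatives on compact subsets of $W$). Let $\mathfrak{X}_U$ be the set of all smooth vector fields $X \in C^\infty(M,\mathbb{R}^n)$ for which there is a point $p \in U$ such that - $p$ is a strictly positive source of $X$, i.e. $X(p)=0$ and all eigenvalues of $\mathrm{D}X|_p$ (the complex roots of its characteristic polynomial) have strictly positive real part, and - $U$ is star-shaped around $p$ with respect to $X$, i.e. for every $q\in U$ the flow $\Phi_t(q)$ of $X$ exists for all $t\le 0$, stays in $U$, and satisfies $\lim_{t\to-\infty}\Phi_t(q)=p$. For $X\in C^\infty(M,\mathbb{R}^n)$, $A\in C^\infty(U,\mathrm{End}(V))$ and $u\in C^\infty(U,V)$ put $((\mathrm{D}_X+A)u)(y) = \mathrm{D}u|_y\,(X(y)) + A(y)u(y)$ for $y \in U$, and let $\mathscr{U}$ be the set of all $(X,A)\in \mathrm{int}(\mathfrak{X}_U)\times C^\infty(U,\mathrm{End}(V))$ for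 which the operator $\mathrm{D}_X+A$ on $C^\infty(U,V)$ has trivial kernel; here $\mathrm{int}(\mathfrak{X}_U)$ is the interior in $C^\infty(M,\mathbb{R}^n)$. **Theorem.** The set $\mathscr{U}$ is open in $C^\infty(M,\mathbb{R}^n)\times C^\infty(U,\mathrm{End}(V))$. For all $(X,A)\in\mathscr{U}$ and $v\in C^\infty(U,V)$ there is exactly one $u\in C^\infty(U,V)$ with $(\mathrm{D}_X+A)u=v$. The resulting solution operator $$\mathbf{S}:\mathscr{U}\times C^\infty(U,V)\longrightarrow C^\infty(U,V),\qquad (X,A,v)\longmapsto u,$$ is smooth as a map from an open subset of a Fréchet space to a Fréchet space: for every $k \ge 0$ the iterated directional derivatives $$\mathrm{D}^{k}\mathbf{S}(x)\{h_1,\dots,h_k\}=\lim_{t\to0}\tfrac1t\bigl(\mathrm{D}^{k-1}\mathbf{S}(x+th_k)\{h_1,\dots,h_{k-1}\}-\mathrm{D}^{k-1}\mathbf{S}(x)\{h_1,\dots,h_{k-1}\}\bigr),\qquad \mathrm{D}^0\mathbf{S}=\mathbf{S},$$ exist for all $x$ in the domain and all directions $h_1,\dots,h_k$, and are jointly continuous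 in $(x,h_1,\dots,h_k)$. -/

import Mathlib

open Set Filter Topology TopologicalSpace
open scoped ContDiff

noncomputable section

namespace SingularTransport

section Spaces

variable {E : Type*} [NormedAddCommGroup E] [NormedSpace ℝ E]
variable {F : Type*} [NormedAddCommGroup F] [NormedSpace ℝ F]

/-- The smooth functions on the open set `U` with values in `F`, each represented by its
extension by zero to the ambient space. -/
def smoothSubmodule (U : Opens E) (F : Type*) [NormedAddCommGroup F] [NormedSpace ℝ F] :
    Submodule ℝ (E → F) where
  carrier := {f | ContDiffOn ℝ ∞ f U ∧ ∀ x ∉ U, f x = 0}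
  add_mem' := fun {f g} hf hg =>
    ⟨hf.1.add hg.1, fun x hx => by simp [hf.2 x hx, hg.2 x hx]⟩
  zero_mem' := ⟨contDiffOn_const, fun _ _ => rfl⟩
  smul_mem' := fun c f hf =>
    ⟨contDiffOn_const.smul hf.1, fun x hx => by simp [hf.2 x hx]⟩

/-- The space `C^∞(U, F)`. (A type of its own, so that it carries the topology defined below
and not the topology of pointwise convergence.) -/
def SmoothMap (U : Opens E) (F : Type*) [NormedAddCommGroup F] [NormedSpace ℝ F] : Type _ :=
  ↥(smoothSubmodule U F)

namespace SmoothMap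

instance (U : Opens E) : AddCommGroup (SmoothMap U F) :=
  inferInstanceAs (AddCommGroup ↥(smoothSubmodule U F))

instance (U : Opens E) : Module ℝ (SmoothMap U F) :=
  inferInstanceAs (Module ℝ ↥(smoothSubmodule U F))

instance (U : Opens E) : CoeFun (SmoothMap U F) (fun _ => E → F) :=
  ⟨fun f => Subtype.val f⟩

theorem contDiffOn {U : Opens E} (f : SmoothMap U F) : ContDiffOn ℝ ∞ f (U : Set E) :=
  f.property.1

/-- The `m`-th derivative of `f ∈ C^∞(U, F)`, as a continuous map on `U`. -/
def derivOn {U : Opens E} (m : ℕ) (f : SmoothMap U F) : C(U, E [×m]→L[ℝ] F) where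
  toFun := fun x => iteratedFDeriv ℝ m f x
  continuous_toFun := by
    have h : ContinuousOn (iteratedFDerivWithin ℝ m f (U : Set E)) (U : Set E) :=
      f.contDiffOn.continuousOn_iteratedFDerivWithin (by exact_mod_cast le_top)
        U.isOpen.uniqueDiffOn
    exact continuousOn_iff_continuous_domRestrict.mp
      (h.congr fun x hx => (iteratedFDerivWithin_of_isOpen m U.isOpen hx).symm)

/-- The Fréchet topology of `C^∞(U, F)`: uniform convergence of every derivative on every
compact subset of `U`. (The topology on `C(U, _)` is the compact-open one, that is, uniform
convergence on compact subsets of `U`.) -/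
instance (U : Opens E) : TopologicalSpace (SmoothMap U F) :=
  ⨅ m : ℕ, TopologicalSpace.induced (derivOn m) inferInstance

end SmoothMap

end Spaces

section FrechetSmooth

variable {𝓕 𝓖 : Type*} [AddCommGroup 𝓕] [Module ℝ 𝓕] [TopologicalSpace 𝓕]
  [AddCommGroup 𝓖] [Module ℝ 𝓖] [TopologicalSpace 𝓖]

/-- Smoothness of a map `f` on an open subset `D` of a Fréchet space: the iterated directional
derivatives `D^k f(x){h₁, …, h_k}` exist for all `x ∈ D` and all directions, and
`D^k f : D × 𝓕^k → 𝓖` is jointly continuous for every `k`. -/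
def FrechetSmoothOn (f : 𝓕 → 𝓖) (D : Set 𝓕) : Prop :=
  ∃ d : (k : ℕ) → 𝓕 → (Fin k → 𝓕) → 𝓖,
    (∀ x ∈ D, ∀ h : Fin 0 → 𝓕, d 0 x h = f x) ∧
    (∀ k : ℕ, ∀ x ∈ D, ∀ (h : Fin k → 𝓕) (h' : 𝓕),
      Tendsto (fun t : ℝ => t⁻¹ • (d k (x + t • h') h - d k x h)) (𝓝[≠] 0)
        (𝓝 (d (k + 1) x (Fin.snoc (α := fun _ => 𝓕) h h')))) ∧
    ∀ k : ℕ, ContinuousOn (fun q : 𝓕 × (Fin k → 𝓕) => d k q.1 q.2) (D ×ˢ univ)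

end FrechetSmooth

section Sources

variable {E : Type*} [NormedAddCommGroup E] [NormedSpace ℝ E] [FiniteDimensional ℝ E]

/-- `p` is a strictly positive source of the vector field `X`: `X(p) = 0` and all complex roots of
the characteristic polynomial of the linearization of `X` at `p` have positive real part. -/
def IsStrictlyPositiveSource (X : E → E) (p : E) : Prop :=
  X p = 0 ∧
    ∀ z : ℂ, Polynomial.aeval z (LinearMap.charpoly (fderiv ℝ X p : E →ₗ[ℝ] E)) = 0 → 0 < z.re

/-- `U` is star-shaped around `p` with respect to `X`: it contains `p`, and the integral curve
of `X` through each point `q` of `U` exists for all `t ≤ 0`, stays in `U`, and tends to `p` as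
`t → -∞`. -/
def IsStarShaped (X : E → E) (U : Set E) (p : E) : Prop :=
  p ∈ U ∧ ∀ q ∈ U, ∃ γ : ℝ → E, γ 0 = q ∧ IsIntegralCurveOn γ (fun _ => X) (Iic 0) ∧
    (∀ t ≤ 0, γ t ∈ U) ∧ Tendsto γ atBot (𝓝 p)

/-- The set `𝔛_U` of smooth vector fields on `M` that have a strictly positive source at some
point of `U` around which `U` is star-shaped. -/
def sourceFields (M U : Opens E) : Set (SmoothMap M E) :=
  {X | ∃ p ∈ U, IsStrictlyPositiveSource X p ∧ IsStarShaped X (U : Set E) p}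

end Sources

section Operator

variable {E : Type*} [NormedAddCommGroup E] [NormedSpace ℝ E] [FiniteDimensional ℝ E]
variable {𝕜 : Type*} [RCLike 𝕜]
variable {V : Type*} [NormedAddCommGroup V] [NormedSpace ℝ V] [NormedSpace 𝕜 V]
  [IsScalarTower ℝ 𝕜 V]

/-- The operator `u ↦ (D_X + A) u` on `C^∞(U, V)`, for a vector field `X` on `M ⊇ U` and an
endomorphism field `A` on `U`. -/
def transport {M U : Opens E} (hUM : U ≤ M) (X : SmoothMap M E) (A : SmoothMap U (V →L[𝕜] V))
    (u : SmoothMap U V) : SmoothMap U V :=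
  ⟨(U : Set E).indicator fun y => fderiv ℝ u y (X y) + A y (u y), by
    refine ⟨?_, fun x hx => indicator_of_notMem (by simpa using hx) _⟩
    have h1 : ContDiffOn ℝ ∞ (fun y => fderiv ℝ u y (X y)) (U : Set E) :=
      (u.contDiffOn.fderiv_of_isOpen U.isOpen (by simp)).clm_apply (X.contDiffOn.mono hUM)
    have h2 : ContDiffOn ℝ ∞ (fun y => A y (u y)) (U : Set E) :=
      ((ContinuousLinearMap.restrictScalarsL 𝕜 V V ℝ ℝ).contDiff.comp_contDiffOn
        A.contDiffOn).clm_apply u.contDiffOn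
    exact (h1.add h2).congr fun y hy => indicator_of_mem hy _⟩

/-- The set `𝒰` of data `(X, A)` with `X` in the interior of `𝔛_U` for which `D_X + A` has trivial
kernel in `C^∞(U, V)`. -/
def regularData (𝕜 : Type*) [RCLike 𝕜] (V : Type*) [NormedAddCommGroup V] [NormedSpace ℝ V]
    [NormedSpace 𝕜 V] [IsScalarTower ℝ 𝕜 V] {M U : Opens E} (hUM : U ≤ M) :
    Set (SmoothMap M E × SmoothMap U (V →L[𝕜] V)) :=
  {c | c.1 ∈ interior (sourceFields M U) ∧
    ∀ u : SmoothMap U V, transport hUM c.1 c.2 u = 0 → u = 0}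

end Operator

end SingularTransport

end

/-! Along a backward trajectory β of X, the equation (D_X + A)u = v becomes the linear equation z' =
A(β) z - v(β) for z = u ∘ β, and β tends to the source p at some exponential rate c. In an adapted
norm the linearization satisfies ‖Λ - DX_p‖ ≤ Λ - c; suppose also ‖l - A(p)‖ ≤ l - a. If v vanishes
to order N at p, the forcing decays like exp(-cNs). As soon as a + cN > 0, exactly one solution
decays at this rate. It is found by integrating from infinity and is bounded by the forcing
(`norm_le_of_decaying_solution`, `exists_decaying_solution`). Its initial value defines u. No
spectral information on A is needed, because N can be taken large.

Differentiating the equation gives an equation of the same kind for Du. Its coefficient w ↦ A w + w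
DX has rate a + c, while its forcing vanishes to order N - 1. For N ≥ 1 the sum a + cN is therefore
unchanged, and derivatives of every order are treated by induction. This gives both the estimates
(`exists_weighted_estimate`) and the regularity (`flatOn_of_isMild`). For the latter,
`hasFDerivAt_of_isMild` identifies the solution of the lifted equation with Du, because the first
order remainder solves an equation with small forcing.

Since X(p) = 0, the operator preserves the order of vanishing at p, so it acts on the
finite-dimensional space of jets of order less than N (`jetSymbol`, `jet_transport`). On functions
with vanishing jet it is bijective. Hence its kernel is trivial exactly when the jet operator is
injective; the latter is then also surjective, which gives solvability for every v. The jet operator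
depends continuously on X, A and p, so injectivity survives small perturbations. Together with the
stability of the source, this gives openness (`isOpen_regularData`).

Trajectories of fields near X follow those of X for a finite time and are then trapped in a region
of expansion around the nearby source. All constants are therefore locally uniform, which yields
`exists_apriori_estimate` and the continuity of the solution operator (`tendsto_solution`). Because
(D_X + A)u is bilinear in (X, A) and u, each derivative of S is S applied to an expression in lower
derivatives. Smoothness thus follows from continuity alone. -/

noncomputable section

namespace SingularTransport

/-! ### Damped linear equations: the bound for decaying solutions -/

section LinearODE

variable {V : Type*} [NormedAddCommGroup V] [NormedSpace ℝ V]

/-- A continuous function that starts below a barrier and is strictly below it whenever it has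
stayed weakly below it up to the present time never reaches the barrier. -/
theorem lt_of_continuousOn_of_barrier {φ : ℝ → ℝ} {T ε : ℝ} (hφ : ContinuousOn φ (Icc 0 T))
    (h0 : φ 0 < ε)
    (hstep : ∀ s ∈ Icc 0 T, (∀ r ∈ Icc 0 s, φ r ≤ ε) → φ s < ε) :
    ∀ s ∈ Icc 0 T, φ s < ε := by
  by_contra! hcon
  obtain ⟨s₁, hs₁, hs₁'⟩ := hcon
  set B : Set ℝ := Icc 0 T ∩ φ ⁻¹' Ici ε with hB
  have hBc : IsClosed B := hφ.preimage_isClosed_of_isClosed isClosed_Icc isClosed_Ici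
  have hBne : B.Nonempty := ⟨s₁, hs₁, hs₁'⟩
  have hBb : BddBelow B := ⟨0, fun x hx => hx.1.1⟩
  have hmem : sInf B ∈ B := hBc.csInf_mem hBne hBb
  set m := sInf B with hm
  have hlt : ∀ r ∈ Ico 0 m, φ r < ε := by
    intro r hr
    by_contra! hr'
    exact absurd (csInf_le hBb ⟨⟨hr.1, hr.2.le.trans hmem.1.2⟩, hr'⟩) (not_le.2 hr.2)
  have hm0 : 0 < m := by
    rcases hmem.1.1.eq_or_lt with h | h
    · have := hmem.2
      rw [mem_preimage, mem_Ici, ← h] at this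
      exact absurd this (not_le.2 h0)
    · exact h
  have hle : φ m ≤ ε := by
    have hc : ContinuousWithinAt φ (Ico 0 m) m :=
      (hφ m hmem.1).mono fun x hx => ⟨hx.1, hx.2.le.trans hmem.1.2⟩
    have : (𝓝[Ico 0 m] m).NeBot := by
      rw [← mem_closure_iff_nhdsWithin_neBot, closure_Ico hm0.ne]
      exact ⟨hm0.le, le_rfl⟩
    exact le_of_tendsto hc (eventually_nhdsWithin_of_forall fun r hr => (hlt r hr).le)
  refine absurd (hstep m hmem.1 fun r hr => ?_) (not_lt.2 hmem.2)
  rcases hr.2.eq_or_lt with h | h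
  · exact h ▸ hle
  · exact (hlt r ⟨hr.1, h⟩).le

/-- The weight `s ↦ exp (-κ s + μ exp (-c s))` multiplied by `exp (-l s)`. -/
theorem hasDerivAt_weight (l κ μ c s : ℝ) :
    HasDerivAt (fun s => Real.exp (-l * s) * Real.exp (-κ * s + μ * Real.exp (-c * s)))
      (-((l + κ + μ * c * Real.exp (-c * s)) *
        (Real.exp (-l * s) * Real.exp (-κ * s + μ * Real.exp (-c * s))))) s := by
  have h1 : ∀ k : ℝ, HasDerivAt (fun s : ℝ => -k * s) (-k) s := fun k => by
    simpa using (hasDerivAt_id s).const_mul (-k)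
  have h3 := (h1 l).exp.mul (((h1 κ).add ((h1 c).exp.const_mul μ)).exp)
  refine h3.congr_deriv ?_
  simp only [Pi.add_apply]
  ring

/-- The first factor θ is the mean of 1 and (l - a)/(l + κ); the second is minus the logarithmic
derivative of the weight with μ = 2D/c. The constant part covers l - a because a + κ > 0. Since θ ≥
1/2, the coefficient 2 in μ covers the term D x. -/
theorem weight_coefficient_le {l a κ c D x : ℝ} (hc : 0 < c) (ha : 0 < a + κ) (hl : a ≤ l)
    (hx : 0 ≤ D * x) :
    l - a + D * x ≤
      ((l - a + (l + κ)) / (2 * (l + κ))) * (l + κ + 2 * D / c * c * x) := by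
  have hlk : 0 < l + κ := by linarith
  have h : (l - a + (l + κ)) / (2 * (l + κ)) * (l + κ + 2 * D / c * c * x) =
      (l - a + (l + κ)) / 2 + (l - a) / (l + κ) * (D * x) + D * x := by
    field_simp
    ring
  rw [h]
  have := mul_nonneg (div_nonneg (sub_nonneg.2 hl) hlk.le) hx
  linarith

/-- A priori bound for exponentially decaying solutions of a damped linear equation. -/
theorem norm_le_of_decaying_solution {Am : ℝ → V →L[ℝ] V} {z g : ℝ → V} {l a κ c D K : ℝ}
    (hc : 0 < c) (ha : 0 < a + κ) (hl : a ≤ l) (hD : 0 ≤ D)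
    (hz : ∀ s, 0 ≤ s → HasDerivWithinAt z (Am s (z s) - g s) (Ici 0) s)
    (hA : ∀ s, 0 ≤ s → ‖l • ContinuousLinearMap.id ℝ V - Am s‖ ≤ l - a + D * Real.exp (-c * s))
    (hg : ∀ s, 0 ≤ s → ‖g s‖ ≤ K * Real.exp (-κ * s))
    (hz0 : ∃ K₀, ∀ s, 0 ≤ s → ‖z s‖ ≤ K₀ * Real.exp (-κ * s)) :
    ∀ s, 0 ≤ s → ‖z s‖ ≤ 2 * K / (a + κ) * Real.exp (2 * D / c) * Real.exp (-κ * s) := by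
  have hlk : 0 < l + κ := by linarith
  -- The weight exp(-κs + μ exp(-cs)) lies between exp(-κs) and exp(μ) exp(-κs) for s ≥ 0. Its inner
  -- exponential absorbs the transient D exp(-cs), however large D is, so that each improvement step
  -- gains the fixed factor θ < 1.
  set μ : ℝ := 2 * D / c with hμ
  have hμ0 : 0 ≤ μ := by positivity
  set θ : ℝ := (l - a + (l + κ)) / (2 * (l + κ)) with hθ
  have hθ0 : 0 ≤ θ := div_nonneg (by linarith) (by linarith)
  have hθ1 : 1 - θ = (a + κ) / (2 * (l + κ)) := by rw [hθ]; field_simp; ring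
  have hθlt : θ < 1 := by
    have : 0 < 1 - θ := by rw [hθ1]; positivity
    linarith
  have hK : 0 ≤ K := by
    have := (norm_nonneg _).trans (hg 0 le_rfl)
    simpa using this
  set wt : ℝ → ℝ := fun s => Real.exp (-κ * s + μ * Real.exp (-c * s)) with hwt
  have hwt0 : ∀ s, 0 < wt s := fun s => Real.exp_pos _
  have hwtge : ∀ s, Real.exp (-κ * s) ≤ wt s := fun s => by
    apply Real.exp_le_exp.2
    have : 0 ≤ μ * Real.exp (-c * s) := by positivity
    linarith
  have hwtle : ∀ s, 0 ≤ s → wt s ≤ Real.exp μ * Real.exp (-κ * s) := fun s hs => by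
    rw [← Real.exp_add]
    apply Real.exp_le_exp.2
    have : Real.exp (-c * s) ≤ 1 := Real.exp_le_one_iff.2 (by nlinarith)
    nlinarith
  obtain ⟨K₀, hK₀⟩ := hz0
  have hK₀0 : 0 ≤ K₀ := by
    have := (norm_nonneg _).trans (hK₀ 0 le_rfl)
    simpa using this
  -- one step of the improvement
  have key : ∀ m : ℝ, (∀ s, 0 ≤ s → ‖z s‖ ≤ m * wt s) →
      ∀ s, 0 ≤ s → ‖z s‖ ≤ (θ * m + K / (l + κ)) * wt s := by
    intro m hm s hs
    have hm0 : 0 ≤ m := by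
      have := (norm_nonneg _).trans (hm 0 le_rfl)
      exact nonneg_of_mul_nonneg_left this (hwt0 0)
    set Q := θ * m + K / (l + κ) with hQ
    have hQ0 : 0 ≤ Q := by positivity
    -- As h vanishes at infinity, ‖h s‖ is at most the integral of ‖h'‖ over [s, ∞). The bound for
    -- ‖h'‖ is Q times minus the derivative of exp(-lr) times the weight, so it integrates exactly.
    set h : ℝ → V := fun r => Real.exp (-l * r) • z r with hh
    set h' : ℝ → V := fun r => Real.exp (-l * r) •
      (-((l • ContinuousLinearMap.id ℝ V - Am r) (z r)) - g r) with hh'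
    have hder : ∀ r, 0 ≤ r → HasDerivWithinAt h (h' r) (Ici 0) r := by
      intro r hr
      have h1 : HasDerivAt (fun r : ℝ => Real.exp (-l * r)) (Real.exp (-l * r) * (-l)) r := by
        have : HasDerivAt (fun s : ℝ => -l * s) (-l) r := by
          simpa using (hasDerivAt_id r).const_mul (-l)
        exact this.exp
      refine (h1.hasDerivWithinAt.smul (hz r hr)).congr_deriv ?_
      simp only [hh', _root_.sub_apply, _root_.smul_apply,
        ContinuousLinearMap.id_apply]
      module
    have hbound : ∀ r, 0 ≤ r → ‖h' r‖ ≤ Q * ((l + κ + μ * c * Real.exp (-c * r)) *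
        (Real.exp (-l * r) * wt r)) := by
      intro r hr
      have he : 0 ≤ Real.exp (-c * r) := (Real.exp_pos _).le
      have hcoef : ‖l • ContinuousLinearMap.id ℝ V - Am r‖ ≤
          θ * (l + κ + μ * c * Real.exp (-c * r)) :=
        (hA r hr).trans (weight_coefficient_le hc ha hl (by positivity))
      have hlkr : l + κ ≤ l + κ + μ * c * Real.exp (-c * r) := by
        have : 0 ≤ μ * c * Real.exp (-c * r) := by positivity
        linarith
      have e1 : ‖(l • ContinuousLinearMap.id ℝ V - Am r) (z r)‖ ≤
          θ * (l + κ + μ * c * Real.exp (-c * r)) * (m * wt r) :=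
        (ContinuousLinearMap.le_opNorm _ _).trans
          (mul_le_mul hcoef (hm r hr) (norm_nonneg _) (mul_nonneg hθ0 (hlk.le.trans hlkr)))
      have e2 : ‖g r‖ ≤ K / (l + κ) * (l + κ + μ * c * Real.exp (-c * r)) * wt r := by
        have : K ≤ K / (l + κ) * (l + κ + μ * c * Real.exp (-c * r)) := by
          calc K = K / (l + κ) * (l + κ) := by field_simp
            _ ≤ _ := by gcongr
        exact (hg r hr).trans (mul_le_mul this (hwtge r) (Real.exp_pos _).le (hK.trans this))
      rw [hh', norm_smul, Real.norm_eq_abs, abs_of_pos (Real.exp_pos _)]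
      calc Real.exp (-l * r) * ‖-((l • ContinuousLinearMap.id ℝ V - Am r) (z r)) - g r‖
          ≤ Real.exp (-l * r) * (θ * (l + κ + μ * c * Real.exp (-c * r)) * (m * wt r) +
              K / (l + κ) * (l + κ + μ * c * Real.exp (-c * r)) * wt r) := by
            gcongr
            refine (norm_sub_le _ _).trans ?_
            rw [norm_neg]
            exact add_le_add e1 e2
        _ = _ := by rw [hQ]; ring
    set B : ℝ → ℝ := fun r => Q * (Real.exp (-l * s) * wt s - Real.exp (-l * r) * wt r) with hB
    have hBder : ∀ r, HasDerivAt B (Q * ((l + κ + μ * c * Real.exp (-c * r)) *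
        (Real.exp (-l * r) * wt r))) r := by
      intro r
      have := ((hasDerivAt_weight l κ μ c r).const_sub
        (Real.exp (-l * s) * wt s)).const_mul Q
      simpa only [neg_neg] using this
    have hfin : ∀ S, s ≤ S → ‖h S - h s‖ ≤ Q * (Real.exp (-l * s) * wt s) := by
      intro S hS
      have := image_norm_le_of_norm_deriv_right_le_deriv_boundary (f := fun r => h r - h s)
        (f' := h') (a := s) (b := S) (B := B)
        (fun r hr => ((hder r (hs.trans hr.1)).continuousWithinAt.mono
          (fun y hy => hs.trans hy.1)).sub continuousWithinAt_const)
        (fun r hr => ((hder r (hs.trans hr.1)).mono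
          (fun y hy => (hs.trans hr.1).trans hy)).sub_const _)
        (by simp [hB]) hBder (fun r hr => hbound r (hs.trans hr.1)) (right_mem_Icc.2 hS)
      refine this.trans ?_
      simp only [hB]
      gcongr
      have : 0 ≤ Real.exp (-l * S) * wt S := by positivity
      linarith
    have hlim : Tendsto h atTop (𝓝 0) := by
      have h1 : Tendsto (fun S : ℝ => K₀ * Real.exp (-((l + κ) * S))) atTop (𝓝 0) := by
        have := (Real.tendsto_exp_neg_atTop_nhds_zero.comp
          (tendsto_id.const_mul_atTop hlk)).const_mul K₀
        simpa [Function.comp_def] using this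
      refine squeeze_zero_norm' ?_ h1
      filter_upwards [eventually_ge_atTop 0] with S hS
      rw [hh, norm_smul, Real.norm_eq_abs, abs_of_pos (Real.exp_pos _)]
      calc Real.exp (-l * S) * ‖z S‖ ≤ Real.exp (-l * S) * (K₀ * Real.exp (-κ * S)) := by
            gcongr; exact hK₀ S hS
        _ = K₀ * (Real.exp (-l * S) * Real.exp (-κ * S)) := by ring
        _ = _ := by rw [← Real.exp_add]; ring_nf
    have hlim2 : ‖h s‖ ≤ Q * (Real.exp (-l * s) * wt s) := by
      have : Tendsto (fun S => ‖h S - h s‖) atTop (𝓝 ‖(0 : V) - h s‖) :=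
        (hlim.sub_const _).norm
      have := le_of_tendsto this ((eventually_ge_atTop s).mono hfin)
      simpa using this
    rw [hh, norm_smul, Real.norm_eq_abs, abs_of_pos (Real.exp_pos _)] at hlim2
    have hpos := Real.exp_pos (-l * s)
    have : Real.exp (-l * s) * ‖z s‖ ≤ Real.exp (-l * s) * (Q * wt s) := by linarith
    exact le_of_mul_le_mul_left this hpos
  -- The fixed point of m ↦ θ m + K/(l + κ). Iterating the improvement removes the unknown constant
  -- K₀.
  set q := K / (l + κ) / (1 - θ) with hq
  have hqfix : θ * q + K / (l + κ) = q := by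
    have : (1 - θ) ≠ 0 := by linarith
    have h2 : q * (1 - θ) = K / (l + κ) := by rw [hq]; field_simp
    linarith
  have hiter : ∀ n : ℕ, ∀ s, 0 ≤ s → ‖z s‖ ≤ (θ ^ n * K₀ + q) * wt s := by
    intro n
    induction n with
    | zero =>
      intro s hs
      have hq0 : 0 ≤ q := div_nonneg (by positivity) (by linarith)
      calc ‖z s‖ ≤ K₀ * Real.exp (-κ * s) := hK₀ s hs
        _ ≤ (θ ^ 0 * K₀ + q) * wt s := by
          rw [pow_zero, one_mul]
          exact mul_le_mul (by linarith) (hwtge s) (Real.exp_pos _).le (by linarith)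
    | succ n ih =>
      intro s hs
      have := key _ ih s hs
      have e : θ * (θ ^ n * K₀ + q) + K / (l + κ) = θ ^ (n + 1) * K₀ + q := by
        rw [pow_succ]; linarith
      rwa [e] at this
  intro s hs
  have hlim : Tendsto (fun n : ℕ => (θ ^ n * K₀ + q) * wt s) atTop (𝓝 ((0 * K₀ + q) * wt s)) :=
    (((tendsto_pow_atTop_nhds_zero_of_lt_one hθ0 hθlt).mul_const K₀).add_const q).mul_const _
  have h1 := ge_of_tendsto' hlim fun n => hiter n s hs
  have hq2 : q = 2 * K / (a + κ) := by
    rw [hq, hθ1]; field_simp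
  rw [zero_mul, zero_add, hq2] at h1
  calc ‖z s‖ ≤ 2 * K / (a + κ) * wt s := h1
    _ ≤ 2 * K / (a + κ) * (Real.exp μ * Real.exp (-κ * s)) := by
      gcongr
      exact hwtle s hs
    _ = _ := by ring

end LinearODE

/-! ### Damped linear equations: existence of decaying solutions -/

section LinearODE

variable {V : Type*} [NormedAddCommGroup V] [NormedSpace ℝ V]

theorem hasDerivAt_integral_Ioi [CompleteSpace V] {h : ℝ → V} (hc : Continuous h)
    (hi : ∀ s, MeasureTheory.IntegrableOn h (Ioi s)) (s : ℝ) :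
    HasDerivAt (fun s => ∫ x in Ioi s, h x) (-h s) s := by
  have h1 : (fun r => ∫ x in Ioi r, h x) =
      fun r => (∫ x in Ioi (0 : ℝ), h x) - ∫ x in (0 : ℝ)..r, h x := by
    funext r
    rw [← intervalIntegral.integral_Ioi_sub_Ioi' (hi 0) (hi r)]
    abel
  rw [h1]
  exact (hc.integral_hasStrictDerivAt 0 s).hasDerivAt.const_sub _

/-- A linear equation on the line whose coefficient is dominated by the logarithmic derivative of
a weight that decays at infinity has a solution bounded by the weight. -/
theorem exists_solution_le_weight [CompleteSpace V] {P : ℝ → V →L[ℝ] V} {g : ℝ → V}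
    {ψ χ : ℝ → ℝ} {θ K : ℝ} (hP : Continuous P) (hg : Continuous g) (hψ : ∀ s, 0 < ψ s)
    (hψ' : ∀ s, HasDerivAt ψ (-χ s) s) (hχ : ∀ s, 0 ≤ χ s)
    (hlim : Tendsto ψ atTop (𝓝 0)) (hθ0 : 0 ≤ θ) (hθ : θ < 1)
    (hPb : ∀ s, ‖P s‖ * ψ s ≤ θ * χ s) (hgb : ∀ s, ‖g s‖ ≤ K * χ s) :
    ∃ y : ℝ → V, (∀ s, HasDerivAt y (-(P s (y s) + g s)) s) ∧ ∃ K₀, ∀ s, ‖y s‖ ≤ K₀ * ψ s := by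
  have hψc : Continuous ψ := continuous_iff_continuousAt.2 fun s => (hψ' s).continuousAt
  have hχi : ∀ s, MeasureTheory.IntegrableOn χ (Ioi s) := fun s => by
    have := MeasureTheory.integrableOn_Ioi_deriv_of_nonpos' (a := s) (fun x _ => hψ' x)
      (fun x _ => neg_nonpos.2 (hχ x)) hlim
    simpa using this.neg
  have hχint : ∀ s, ∫ x in Ioi s, χ x = ψ s := fun s => by
    have := MeasureTheory.integral_Ioi_of_hasDerivAt_of_nonpos' (a := s) (fun x _ => hψ' x)
      (fun x _ => neg_nonpos.2 (hχ x)) hlim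
    rw [MeasureTheory.integral_neg] at this
    linarith
  -- The solution is sought as y = ψ z with z bounded, so that h z is -y' and y is its integral over
  -- [s, ∞). Dividing by ψ gives a fixed point problem for z, contracting with factor θ because χ
  -- integrates to ψ.
  let h : BoundedContinuousFunction ℝ V → ℝ → V := fun z s => P s (ψ s • z s) + g s
  have hhc : ∀ z, Continuous (h z) := fun z =>
    (hP.clm_apply (hψc.smul z.continuous)).add hg
  have hhb : ∀ z s, ‖h z s‖ ≤ (θ * ‖z‖ + K) * χ s := by
    intro z s
    calc ‖h z s‖ ≤ ‖P s (ψ s • z s)‖ + ‖g s‖ := norm_add_le _ _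
      _ ≤ ‖P s‖ * (ψ s * ‖z‖) + K * χ s := by
        refine add_le_add ((ContinuousLinearMap.le_opNorm _ _).trans ?_) (hgb s)
        rw [norm_smul, Real.norm_eq_abs, abs_of_pos (hψ s)]
        have := (hψ s).le
        gcongr
        exact z.norm_coe_le_norm s
      _ = (‖P s‖ * ψ s) * ‖z‖ + K * χ s := by ring
      _ ≤ (θ * χ s) * ‖z‖ + K * χ s := by
        exact add_le_add (mul_le_mul_of_nonneg_right (hPb s) (norm_nonneg _)) le_rfl
      _ = _ := by ring
  have hhi : ∀ z s, MeasureTheory.IntegrableOn (h z) (Ioi s) := fun z s =>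
    MeasureTheory.Integrable.mono' ((hχi s).const_mul (θ * ‖z‖ + K))
      (hhc z).aestronglyMeasurable (Eventually.of_forall (hhb z))
  have hdiff : ∀ z y s, ‖h z s - h y s‖ ≤ θ * dist z y * χ s := by
    intro z y s
    have e : h z s - h y s = P s (ψ s • (z - y) s) := by
      simp only [h, BoundedContinuousFunction.coe_sub, Pi.sub_apply, smul_sub, map_sub]
      abel
    rw [e]
    calc ‖P s (ψ s • (z - y) s)‖ ≤ ‖P s‖ * (ψ s * ‖z - y‖) := by
          refine (ContinuousLinearMap.le_opNorm _ _).trans ?_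
          rw [norm_smul, Real.norm_eq_abs, abs_of_pos (hψ s)]
          have := (hψ s).le
          gcongr
          exact (z - y).norm_coe_le_norm s
      _ = (‖P s‖ * ψ s) * dist z y := by rw [dist_eq_norm]; ring
      _ ≤ (θ * χ s) * dist z y := mul_le_mul_of_nonneg_right (hPb s) dist_nonneg
      _ = _ := by ring
  have hFc : ∀ z, Continuous fun s => (ψ s)⁻¹ • ∫ x in Ioi s, h z x := fun z =>
    (hψc.inv₀ fun s => (hψ s).ne').smul
      (continuous_iff_continuousAt.2 fun s =>
        (hasDerivAt_integral_Ioi (hhc z) (hhi z) s).continuousAt)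
  have hnorm : ∀ (f : ℝ → V) (Q s : ℝ), (∀ x, ‖f x‖ ≤ Q * χ x) →
      ‖(ψ s)⁻¹ • ∫ x in Ioi s, f x‖ ≤ Q := by
    intro f Q s hf
    rw [norm_smul, norm_inv, Real.norm_eq_abs, abs_of_pos (hψ s)]
    have := MeasureTheory.norm_integral_le_of_norm_le ((hχi s).const_mul Q)
      (Eventually.of_forall hf)
    rw [MeasureTheory.integral_const_mul, hχint s] at this
    rw [inv_mul_le_iff₀ (hψ s)]
    linarith
  let F : BoundedContinuousFunction ℝ V → BoundedContinuousFunction ℝ V := fun z =>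
    BoundedContinuousFunction.ofNormedAddCommGroup (fun s => (ψ s)⁻¹ • ∫ x in Ioi s, h z x)
      (hFc z) (θ * ‖z‖ + K) fun s => hnorm _ _ s (hhb z)
  have hF : ContractingWith (Real.toNNReal θ) F := by
    refine ⟨by simpa using hθ, LipschitzWith.of_dist_le_mul fun z y => ?_⟩
    rw [Real.coe_toNNReal θ hθ0]
    refine (BoundedContinuousFunction.dist_le (by positivity)).2 fun s => ?_
    change dist ((ψ s)⁻¹ • ∫ x in Ioi s, h z x) ((ψ s)⁻¹ • ∫ x in Ioi s, h y x) ≤ _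
    rw [dist_eq_norm, ← smul_sub, ← MeasureTheory.integral_sub (hhi z s) (hhi y s)]
    exact hnorm _ _ s (hdiff z y)
  set z := hF.fixedPoint with hz
  have hzF : ∀ s, ψ s • z s = ∫ x in Ioi s, h z x := by
    intro s
    have : F z = z := hF.fixedPoint_isFixedPt
    have h2 : z s = (ψ s)⁻¹ • ∫ x in Ioi s, h z x := by
      conv_lhs => rw [← this]
      rfl
    rw [h2, smul_inv_smul₀ (hψ s).ne']
  refine ⟨fun s => ψ s • z s, fun s => ?_, ‖z‖, fun s => ?_⟩
  · have := hasDerivAt_integral_Ioi (hhc z) (hhi z) s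
    simp only [← hzF] at this
    exact this
  · rw [norm_smul, Real.norm_eq_abs, abs_of_pos (hψ s), mul_comm]
    have := (hψ s).le
    gcongr
    exact z.norm_coe_le_norm s

/-- A damped linear equation with exponentially decaying right-hand side has an exponentially
decaying solution. -/
theorem exists_decaying_solution [CompleteSpace V] {Am : ℝ → V →L[ℝ] V} {g : ℝ → V}
    {l a κ c D K : ℝ} (hc : 0 < c) (ha : 0 < a + κ) (hl : a ≤ l) (hD : 0 ≤ D) (hκ : 0 ≤ κ)
    (hAc : ContinuousOn Am (Ici 0)) (hgc : ContinuousOn g (Ici 0))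
    (hA : ∀ s, 0 ≤ s → ‖l • ContinuousLinearMap.id ℝ V - Am s‖ ≤ l - a + D * Real.exp (-c * s))
    (hg : ∀ s, 0 ≤ s → ‖g s‖ ≤ K * Real.exp (-κ * s)) :
    ∃ z : ℝ → V, (∀ s, 0 ≤ s → HasDerivWithinAt z (Am s (z s) - g s) (Ici 0) s) ∧
      ∃ K₀, ∀ s, 0 ≤ s → ‖z s‖ ≤ K₀ * Real.exp (-κ * s) := by
  have hlk : 0 < l + κ := by linarith
  set μ : ℝ := 2 * D / c with hμ
  have hμ0 : 0 ≤ μ := by positivity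
  set θ : ℝ := (l - a + (l + κ)) / (2 * (l + κ)) with hθ
  have hθ0 : 0 ≤ θ := div_nonneg (by linarith) (by linarith)
  have hθlt : θ < 1 := by
    have : 0 < 1 - θ := by
      rw [show 1 - θ = (a + κ) / (2 * (l + κ)) by rw [hθ]; field_simp; ring]; positivity
    linarith
  have hK : 0 ≤ K := by simpa using (norm_nonneg _).trans (hg 0 le_rfl)
  -- The data are extended to negative times by their values at 0. The bounds persist there because
  -- c and κ are nonnegative.
  have hcm : Continuous fun s : ℝ => max s 0 := continuous_id.max continuous_const
  have hAc' : Continuous fun s => Am (max s 0) :=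
    hAc.comp_continuous hcm fun s => mem_Ici.2 (le_max_right _ _)
  have hgc' : Continuous fun s => g (max s 0) :=
    hgc.comp_continuous hcm fun s => mem_Ici.2 (le_max_right _ _)
  have hexpc : Continuous fun s : ℝ => Real.exp (-l * s) := by fun_prop
  set wt : ℝ → ℝ := fun s => Real.exp (-κ * s + μ * Real.exp (-c * s)) with hwt
  have hwtge : ∀ s, Real.exp (-κ * s) ≤ wt s := fun s => by
    apply Real.exp_le_exp.2
    have : 0 ≤ μ * Real.exp (-c * s) := by positivity
    linarith
  have hle : ∀ k s : ℝ, 0 ≤ k → Real.exp (-k * max s 0) ≤ Real.exp (-k * s) := fun k s hk => by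
    apply Real.exp_le_exp.2
    have := le_max_left s 0
    nlinarith
  have hχ1 : ∀ s, l + κ ≤ l + κ + μ * c * Real.exp (-c * s) := fun s => by
    have : 0 ≤ μ * c * Real.exp (-c * s) := by positivity
    linarith
  -- The substitution y = exp(-ls) z turns the equation into y' = -((l - A) y + exp(-ls) g).
  obtain ⟨y, hy, K₀, hK₀⟩ := exists_solution_le_weight
    (P := fun s => l • ContinuousLinearMap.id ℝ V - Am (max s 0))
    (g := fun s => Real.exp (-l * s) • g (max s 0))
    (ψ := fun s => Real.exp (-l * s) * wt s)
    (χ := fun s => (l + κ + μ * c * Real.exp (-c * s)) * (Real.exp (-l * s) * wt s))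
    (θ := θ) (K := K / (l + κ))
    (continuous_const.sub hAc') (hexpc.smul hgc') (fun s => by positivity)
    (fun s => hasDerivAt_weight l κ μ c s)
    (fun s => mul_nonneg (hlk.le.trans (hχ1 s)) (by positivity))
    (by
      have h1 : Tendsto (fun s : ℝ => Real.exp μ * Real.exp (-((l + κ) * s))) atTop (𝓝 0) := by
        have := (Real.tendsto_exp_neg_atTop_nhds_zero.comp
          (tendsto_id.const_mul_atTop hlk)).const_mul (Real.exp μ)
        simpa [Function.comp_def] using this
      refine squeeze_zero' (Eventually.of_forall fun s => by positivity) ?_ h1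
      filter_upwards [eventually_ge_atTop 0] with s hs
      rw [hwt, ← Real.exp_add, ← Real.exp_add]
      apply Real.exp_le_exp.2
      have : Real.exp (-c * s) ≤ 1 := Real.exp_le_one_iff.2 (by nlinarith)
      nlinarith)
    hθ0 hθlt
    (fun s => by
      have h1 : ‖l • ContinuousLinearMap.id ℝ V - Am (max s 0)‖ ≤
          θ * (l + κ + μ * c * Real.exp (-c * s)) := by
        refine (hA _ (le_max_right _ _)).trans (le_trans ?_
          (weight_coefficient_le (D := D) hc ha hl (by positivity)))
        have := hle c s hc.le
        gcongr
      calc _ ≤ θ * (l + κ + μ * c * Real.exp (-c * s)) * (Real.exp (-l * s) * wt s) := by gcongr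
        _ = _ := by ring)
    (fun s => by
      rw [norm_smul, Real.norm_eq_abs, abs_of_pos (Real.exp_pos _)]
      calc Real.exp (-l * s) * ‖g (max s 0)‖ ≤ Real.exp (-l * s) * (K * wt s) := by
            gcongr
            exact (hg _ (le_max_right _ _)).trans (by
              have := (hle κ s hκ).trans (hwtge s)
              gcongr)
        _ = K / (l + κ) * ((l + κ) * (Real.exp (-l * s) * wt s)) := by field_simp
        _ ≤ _ := mul_le_mul_of_nonneg_left
          (mul_le_mul_of_nonneg_right (hχ1 s) (by positivity)) (by positivity))
  have he : ∀ s : ℝ, HasDerivAt (fun s : ℝ => Real.exp (l * s)) (Real.exp (l * s) * l) s := by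
    intro s
    have : HasDerivAt (fun s : ℝ => l * s) l s := by
      simpa using (hasDerivAt_id s).const_mul l
    exact this.exp
  have hee : ∀ s : ℝ, Real.exp (l * s) * Real.exp (-l * s) = 1 := fun s => by
    rw [← Real.exp_add]; simp
  refine ⟨fun s => Real.exp (l * s) • y s, fun s hs => ?_, K₀ * Real.exp μ, fun s hs => ?_⟩
  · refine (((he s).smul (hy s)).congr_deriv ?_).hasDerivWithinAt
    rw [max_eq_left hs]
    simp only [_root_.sub_apply, _root_.smul_apply, ContinuousLinearMap.id_apply, map_smul]
    have : Real.exp (l * s) • Real.exp (-l * s) • g s = g s := by rw [smul_smul, hee, one_smul]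
    rw [smul_neg, smul_add, this, smul_sub, smul_smul]
    abel
  · have hK₀0 : 0 ≤ K₀ := nonneg_of_mul_nonneg_left ((norm_nonneg _).trans (hK₀ 0)) (by positivity)
    rw [norm_smul, Real.norm_eq_abs, abs_of_pos (Real.exp_pos _)]
    calc Real.exp (l * s) * ‖y s‖ ≤ Real.exp (l * s) * (K₀ * (Real.exp (-l * s) * wt s)) := by
          gcongr; exact hK₀ s
      _ = K₀ * ((Real.exp (l * s) * Real.exp (-l * s)) * wt s) := by ring
      _ = K₀ * wt s := by rw [hee, one_mul]
      _ ≤ K₀ * (Real.exp μ * Real.exp (-κ * s)) := by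
        gcongr
        rw [hwt, ← Real.exp_add]
        apply Real.exp_le_exp.2
        have : Real.exp (-c * s) ≤ 1 := Real.exp_le_one_iff.2 (by nlinarith)
        nlinarith
      _ = _ := by ring

end LinearODE

/-! ### A norm adapted to a linear map with eigenvalues in the right half plane -/

section AdaptedNorm

variable {E : Type*} [NormedAddCommGroup E] [NormedSpace ℝ E] [FiniteDimensional ℝ E]

/-- |1 - εz|² = 1 - 2ε Re z + ε²|z|², which is below 1 as soon as ε|z|² < Re z. -/
theorem exists_pos_norm_one_sub_mul_lt (s : Finset ℂ) (hs : ∀ z ∈ s, 0 < z.re) :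
    ∃ ε : ℝ, 0 < ε ∧ ∀ z ∈ s, ‖1 - (ε : ℂ) * z‖ < 1 := by
  have h : ∀ᶠ ε : ℝ in 𝓝[>] 0, ∀ z ∈ s, ‖1 - (ε : ℂ) * z‖ < 1 := by
    rw [Filter.eventually_all_finset]
    intro z hz
    have hlim : Tendsto (fun ε : ℝ => ε * Complex.normSq z) (𝓝[>] 0) (𝓝 0) := by
      have : Continuous fun ε : ℝ => ε * Complex.normSq z := by fun_prop
      exact (this.tendsto' 0 0 (by simp)).mono_left nhdsWithin_le_nhds
    filter_upwards [hlim.eventually (gt_mem_nhds (hs z hz)), self_mem_nhdsWithin] with ε h1 h2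
    have h2 : 0 < ε := h2
    have h3 : ‖1 - (ε : ℂ) * z‖ ^ 2 < 1 := by
      rw [← Complex.normSq_eq_norm_sq, Complex.normSq_apply]
      simp only [Complex.sub_re, Complex.one_re, Complex.mul_re, Complex.ofReal_re,
        Complex.ofReal_im, zero_mul, sub_zero, Complex.sub_im, Complex.one_im, Complex.mul_im,
        add_zero, zero_sub]
      rw [Complex.normSq_apply] at h1
      have := hs z hz
      nlinarith [mul_pos h2 (sub_pos.2 h1), mul_pos h2 this]
    nlinarith [norm_nonneg (1 - (ε : ℂ) * z)]
  obtain ⟨ε, h1, h2⟩ := (h.and self_mem_nhdsWithin).exists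
  exact ⟨ε, h2, h1⟩

-- Gelfand's formula: the k-th root of ‖Q^k‖ tends to the spectral radius, hence is eventually below
-- some ρ < 1.
attribute [local instance] Matrix.linftyOpNormedRing Matrix.linftyOpNormedAlgebra in
theorem tendsto_matrix_pow_zero {n : ℕ} (Q : Matrix (Fin n) (Fin n) ℂ)
    (hQ : ∀ z ∈ spectrum ℂ Q, ‖z‖ < 1) : Tendsto (fun k : ℕ => Q ^ k) atTop (𝓝 0) := by
  rcases subsingleton_or_nontrivial (Matrix (Fin n) (Fin n) ℂ) with h | h
  · exact tendsto_const_nhds.congr fun k => Subsingleton.elim _ _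
  have h1 : spectralRadius ℂ Q < (1 : NNReal) :=
    spectrum.spectralRadius_lt_of_forall_lt Q fun z hz => by
      have := hQ z hz
      rwa [← NNReal.coe_lt_coe]
  obtain ⟨ρ, hρ1, hρ2⟩ := ENNReal.lt_iff_exists_nnreal_btwn.1 h1
  have hρ : ρ < 1 := by exact_mod_cast hρ2
  have h2 := (spectrum.pow_nnnorm_pow_one_div_tendsto_nhds_spectralRadius Q).eventually
    (gt_mem_nhds hρ1)
  have h3 : Tendsto (fun k : ℕ => (ρ : ℝ) ^ k) atTop (𝓝 0) :=
    tendsto_pow_atTop_nhds_zero_of_lt_one ρ.coe_nonneg (by exact_mod_cast hρ)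
  refine squeeze_zero_norm' ?_ h3
  filter_upwards [h2, eventually_gt_atTop 0] with k hk hk0
  have hk0' : (0 : ℝ) < k := by exact_mod_cast hk0
  have h4 : ((‖Q ^ k‖₊ : ENNReal) ^ (1 / k : ℝ)) ^ (k : ℝ) ≤ (ρ : ENNReal) ^ (k : ℝ) :=
    ENNReal.rpow_le_rpow hk.le hk0'.le
  rw [← ENNReal.rpow_mul, one_div_mul_cancel hk0'.ne', ENNReal.rpow_one, ENNReal.rpow_natCast] at h4
  exact_mod_cast h4

/-- The complexified matrix of 1 - εL has eigenvalues 1 - εz, with z a root of the characteristic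
polynomial, and all of them lie in the open unit disc for small ε. Its powers tend to zero, and the
real powers inherit this entry by entry. -/
theorem exists_norm_pow_le_half (L : E →L[ℝ] E)
    (hL : ∀ z : ℂ, Polynomial.aeval z (LinearMap.charpoly (L : E →ₗ[ℝ] E)) = 0 → 0 < z.re) :
    ∃ ε : ℝ, 0 < ε ∧ ∃ m : ℕ, 0 < m ∧
      ‖(ContinuousLinearMap.id ℝ E - ε • L) ^ m‖ ≤ 1 / 2 := by
  classical
  set b := Module.finBasis ℝ E
  set n := Module.finrank ℝ E
  set Lm : Matrix (Fin n) (Fin n) ℝ := LinearMap.toMatrix b b (L : E →ₗ[ℝ] E) with hLm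
  set Lc : Matrix (Fin n) (Fin n) ℂ := Lm.map (algebraMap ℝ ℂ) with hLc
  have hroot : ∀ z, Lc.charpoly.IsRoot z → 0 < z.re := by
    intro z hz
    apply hL
    rw [← LinearMap.charpoly_toMatrix (L : E →ₗ[ℝ] E) b, Polynomial.aeval_def,
      ← Polynomial.eval_map, ← Matrix.charpoly_map]
    exact hz
  have hne : Lc.charpoly ≠ 0 := (Matrix.charpoly_monic _).ne_zero
  obtain ⟨ε, hε, hε'⟩ := exists_pos_norm_one_sub_mul_lt Lc.charpoly.roots.toFinset fun z hz =>
    hroot z ((Polynomial.mem_roots hne).1 (Multiset.mem_toFinset.1 hz))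
  have hεc : (ε : ℂ) ≠ 0 := by exact_mod_cast hε.ne'
  refine ⟨ε, hε, ?_⟩
  set Qc : Matrix (Fin n) (Fin n) ℂ := 1 - (ε : ℂ) • Lc with hQc
  have hspec : ∀ z ∈ spectrum ℂ Qc, ‖z‖ < 1 := by
    intro z hz
    have e : Qc = algebraMap ℂ _ 1 - (Units.mk0 (ε : ℂ) hεc) • Lc := by
      rw [hQc, map_one]; rfl
    rw [e, ← spectrum.singleton_sub_eq, spectrum.unit_smul_eq_smul] at hz
    obtain ⟨w, hw, hzw⟩ := Set.mem_sub.1 hz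
    obtain ⟨y, hy, h1⟩ := hzw
    obtain ⟨x, hx, rfl⟩ := hy
    rw [Set.mem_singleton_iff.1 hw] at h1
    have h2 : z = 1 - (ε : ℂ) * x := h1.symm
    rw [h2]
    exact hε' x (by
      rw [Multiset.mem_toFinset, Polynomial.mem_roots hne]
      exact Matrix.mem_spectrum_iff_isRoot_charpoly.1 hx)
  have hlimc := tendsto_matrix_pow_zero Qc hspec
  set Q : E →L[ℝ] E := ContinuousLinearMap.id ℝ E - ε • L with hQ
  have hmat : ∀ k : ℕ, (LinearMap.toMatrix b b ((Q ^ k : E →L[ℝ] E) : E →ₗ[ℝ] E)).map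
      (algebraMap ℝ ℂ) = Qc ^ k := by
    intro k
    have h1 : ((Q ^ k : E →L[ℝ] E) : E →ₗ[ℝ] E) = (Q : E →ₗ[ℝ] E) ^ k := by
      ext x; simp
    have h2 : LinearMap.toMatrix b b (Q : E →ₗ[ℝ] E) = 1 - ε • Lm := by
      have : (Q : E →ₗ[ℝ] E) = LinearMap.id - ε • (L : E →ₗ[ℝ] E) := rfl
      rw [this, map_sub, map_smul, LinearMap.toMatrix_id]
    have h3 : ((algebraMap ℝ ℂ).mapMatrix (1 - ε • Lm)) = Qc := by
      rw [map_sub, map_one, hQc]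
      congr 1
      ext i j
      simp [hLc]
    rw [h1, ← LinearMap.toMatrix_pow, h2, ← RingHom.mapMatrix_apply, map_pow, h3]
  have hlimr : Tendsto (fun k : ℕ => LinearMap.toMatrix b b ((Q ^ k : E →L[ℝ] E) : E →ₗ[ℝ] E))
      atTop (𝓝 0) := by
    refine tendsto_pi_nhds.2 fun i => tendsto_pi_nhds.2 fun j => ?_
    have h1 : Tendsto (fun k : ℕ => ((Qc ^ k) i j).re) atTop (𝓝 0) := by
      have := ((tendsto_pi_nhds.1 ((tendsto_pi_nhds.1 hlimc) i)) j)
      simpa [Function.comp_def] using (Complex.continuous_re.tendsto _).comp this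
    refine h1.congr fun k => ?_
    rw [← hmat k]
    simp
  have hlimQ : Tendsto (fun k : ℕ => Q ^ k) atTop (𝓝 0) := by
    let Ψ : Matrix (Fin n) (Fin n) ℝ →ₗ[ℝ] E →L[ℝ] E :=
      (LinearMap.toContinuousLinearMap : (E →ₗ[ℝ] E) ≃ₗ[ℝ] E →L[ℝ] E).toLinearMap.comp
        (LinearMap.toMatrix b b).symm.toLinearMap
    have hΨ : Continuous Ψ := LinearMap.continuous_of_finiteDimensional Ψ
    have h1 := (hΨ.tendsto 0).comp hlimr
    rw [map_zero] at h1
    refine h1.congr fun k => ?_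
    change LinearMap.toContinuousLinearMap ((LinearMap.toMatrix b b).symm
      (LinearMap.toMatrix b b ((Q ^ k : E →L[ℝ] E) : E →ₗ[ℝ] E))) = _
    rw [LinearEquiv.symm_apply_apply]
    rfl
  have h1 := (tendsto_zero_iff_norm_tendsto_zero.1 hlimQ).eventually
    (gt_mem_nhds (show (0 : ℝ) < 1 / 2 by norm_num))
  obtain ⟨m, hm, hm0⟩ := (h1.and (eventually_gt_atTop 0)).exists
  exact ⟨m, hm0, hm.le⟩

/-- If all eigenvalues of `L` have positive real part, then in suitable linear coordinates
`Λ - L` has norm less than `Λ` for some `Λ > 0`. -/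
theorem exists_adapted_equiv (L : E →L[ℝ] E)
    (hL : ∀ z : ℂ, Polynomial.aeval z (LinearMap.charpoly (L : E →ₗ[ℝ] E)) = 0 → 0 < z.re) :
    ∃ (m : ℕ) (E' : Submodule ℝ (Fin m → E)) (e : E ≃L[ℝ] E') (Λ c : ℝ), 0 < c ∧
      ‖Λ • ContinuousLinearMap.id ℝ E' -
        ((e : E →L[ℝ] E').comp L).comp (e.symm : E' →L[ℝ] E)‖ ≤ Λ - c := by
  obtain ⟨ε, hε, m, hm, hQm⟩ := exists_norm_pow_le_half L hL
  set Q : E →L[ℝ] E := ContinuousLinearMap.id ℝ E - ε • L with hQ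
  have hm' : (1 : ℝ) ≤ m := by exact_mod_cast hm
  -- By Bernoulli's inequality ρ^m ≥ 1/2 ≥ ‖Q^m‖.
  set ρ : ℝ := 1 - 1 / (2 * m) with hρ
  have hρ0 : 0 < ρ := by
    have : 1 / (2 * (m : ℝ)) ≤ 1 / 2 := by gcongr; linarith
    linarith
  have hρ1 : ρ < 1 := by
    have : 0 < 1 / (2 * (m : ℝ)) := by positivity
    linarith
  have hρm : 1 / 2 ≤ ρ ^ m := by
    have := one_add_mul_le_pow (a := -(1 / (2 * (m : ℝ)))) (by
      have : 1 / (2 * (m : ℝ)) ≤ 1 / 2 := by gcongr; linarith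
      linarith) m
    have e : 1 + (m : ℝ) * -(1 / (2 * (m : ℝ))) = 1 / 2 := by field_simp; ring
    rw [e] at this
    rwa [hρ, sub_eq_add_neg]
  -- The adapted norm is the maximum over k < m of ρ^{-k} ‖Q^k x‖, realized as the sup norm on the
  -- range of J. Applying Q shifts the index by one. At the last index, ‖Q^m‖ ≤ ρ^m leads back to
  -- index 0, so Q contracts by ρ.
  let J : E →ₗ[ℝ] (Fin m → E) := LinearMap.pi fun k => (ρ⁻¹ ^ (k : ℕ)) • ((Q ^ (k : ℕ) : E →L[ℝ] E) : E →ₗ[ℝ] E)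
  have hJ : ∀ x k, J x k = ρ⁻¹ ^ (k : ℕ) • (Q ^ (k : ℕ)) x := fun x k => rfl
  have hJinj : Function.Injective J := by
    intro x y hxy
    have := congrFun hxy ⟨0, hm⟩
    simpa [hJ] using this
  let e : E ≃L[ℝ] LinearMap.range J := (LinearEquiv.ofInjective J hJinj).toContinuousLinearEquiv
  have he : ∀ x, ‖e x‖ = ‖J x‖ := fun x => rfl
  have hkey : ∀ x, ‖J (Q x)‖ ≤ ρ * ‖J x‖ := by
    intro x
    rw [pi_norm_le_iff_of_nonneg (by positivity)]
    intro k
    have hk1 : ∀ j : Fin m, ‖(Q ^ (j : ℕ)) x‖ ≤ ρ ^ (j : ℕ) * ‖J x‖ := by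
      intro j
      have h1 := norm_le_pi_norm (J x) j
      rw [hJ, norm_smul, norm_pow, norm_inv, Real.norm_eq_abs, abs_of_pos hρ0, inv_pow,
        inv_mul_le_iff₀ (by positivity)] at h1
      exact h1
    have hk2 : ‖(Q ^ ((k : ℕ) + 1)) x‖ ≤ ρ ^ ((k : ℕ) + 1) * ‖J x‖ := by
      rcases Nat.lt_or_ge ((k : ℕ) + 1) m with h | h
      · exact hk1 ⟨_, h⟩
      · have hkm : (k : ℕ) + 1 = m := le_antisymm k.2 h
        rw [hkm]
        calc ‖(Q ^ m) x‖ ≤ ‖Q ^ m‖ * ‖x‖ := ContinuousLinearMap.le_opNorm _ _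
          _ ≤ ρ ^ m * ‖J x‖ := by
            have := hk1 ⟨0, hm⟩
            simp only [pow_zero, one_mul, one_apply_eq_self] at this
            exact mul_le_mul (hQm.trans hρm) this (norm_nonneg _) (by positivity)
    rw [hJ, norm_smul, norm_pow, norm_inv, Real.norm_eq_abs, abs_of_pos hρ0, inv_pow,
      inv_mul_le_iff₀ (by positivity)]
    have h3 : (Q ^ (k : ℕ)) (Q x) = (Q ^ ((k : ℕ) + 1)) x := by
      rw [pow_succ]; rfl
    rw [h3]
    calc _ ≤ _ := hk2
      _ = _ := by rw [pow_succ]; ring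
  -- With Λ = 1/ε one has Λ - L = Q/ε, of adapted norm at most ρ/ε = Λ - c.
  refine ⟨m, LinearMap.range J, e, ε⁻¹, ε⁻¹ * (1 - ρ), by
    have := sub_pos.2 hρ1
    positivity, ?_⟩
  have : ε⁻¹ - ε⁻¹ * (1 - ρ) = ε⁻¹ * ρ := by ring
  rw [this]
  refine ContinuousLinearMap.opNorm_le_bound _ (by positivity) fun y => ?_
  obtain ⟨x, rfl⟩ := e.surjective y
  have h4 : (ε⁻¹ • ContinuousLinearMap.id ℝ (LinearMap.range J) -
      ((e : E →L[ℝ] LinearMap.range J).comp L).comp (e.symm : LinearMap.range J →L[ℝ] E)) (e x) =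
      ε⁻¹ • e (Q x) := by
    simp [hQ, smul_sub, smul_smul, hε.ne']
  rw [h4, norm_smul, norm_inv, Real.norm_eq_abs, abs_of_pos hε, he, he, mul_assoc]
  exact mul_le_mul_of_nonneg_left (hkey x) (by positivity)

end AdaptedNorm

/-! ### The Fréchet topology of smooth functions: seminorms, derivative and products -/

namespace SmoothMap

variable {E : Type*} [NormedAddCommGroup E] [NormedSpace ℝ E]
variable {F : Type*} [NormedAddCommGroup F] [NormedSpace ℝ F]
variable {G : Type*} [NormedAddCommGroup G] [NormedSpace ℝ G]
variable {H : Type*} [NormedAddCommGroup H] [NormedSpace ℝ H]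
variable {U M : Opens E}

theorem add_apply (f g : SmoothMap U F) (x : E) : (f + g) x = f x + g x := rfl

theorem smul_apply (r : ℝ) (f : SmoothMap U F) (x : E) : (r • f) x = r • f x := rfl

theorem eq_zero_of_notMem (f : SmoothMap U F) {x : E} (hx : x ∉ U) : f x = 0 := f.property.2 x hx

theorem ext_on {f g : SmoothMap U F} (h : ∀ x ∈ U, f x = g x) : f = g := by
  apply Subtype.ext
  funext x
  by_cases hx : x ∈ U
  · exact h x hx
  · exact (f.eq_zero_of_notMem hx).trans (g.eq_zero_of_notMem hx).symm

theorem contDiffAt (f : SmoothMap U F) {x : E} (hx : x ∈ U) {n : ℕ∞} : ContDiffAt ℝ n f x :=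
  (f.contDiffOn.contDiffAt (U.isOpen.mem_nhds hx)).of_le (by exact_mod_cast le_top)

theorem differentiableAt (f : SmoothMap U F) {x : E} (hx : x ∈ U) : DifferentiableAt ℝ f x :=
  (f.contDiffAt hx (n := 1)).differentiableAt (by simp)

/-- The element of `C^∞(U, F)` given by a function that is smooth on `U`. -/
def ofContDiffOn (U : Opens E) (f : E → F) (hf : ContDiffOn ℝ ∞ f (U : Set E)) : SmoothMap U F :=
  ⟨(U : Set E).indicator f, hf.congr fun _ hx => indicator_of_mem hx _,
    fun _ hx => indicator_of_notMem (by simpa using hx) _⟩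

theorem ofContDiffOn_apply {f : E → F} (hf : ContDiffOn ℝ ∞ f (U : Set E)) {x : E} (hx : x ∈ U) :
    ofContDiffOn U f hf x = f x := indicator_of_mem (s := (U : Set E)) hx f

theorem ofContDiffOn_eventuallyEq {f : E → F} (hf : ContDiffOn ℝ ∞ f (U : Set E)) {x : E}
    (hx : x ∈ U) : (ofContDiffOn U f hf : E → F) =ᶠ[𝓝 x] f :=
  eventually_of_mem (U.isOpen.mem_nhds hx) fun _ hy => ofContDiffOn_apply hf hy

theorem iteratedFDeriv_ofContDiffOn {f : E → F} (hf : ContDiffOn ℝ ∞ f (U : Set E)) {x : E}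
    (hx : x ∈ U) (m : ℕ) : iteratedFDeriv ℝ m (ofContDiffOn U f hf) x = iteratedFDeriv ℝ m f x :=
  (ofContDiffOn_eventuallyEq hf hx).iteratedFDeriv ℝ m |>.eq_of_nhds

theorem derivOn_apply (m : ℕ) (f : SmoothMap U F) (x : U) :
    derivOn m f x = iteratedFDeriv ℝ m f x := rfl

/-- Taking the `m`-th derivative, as a linear map. -/
def derivOnₗ (U : Opens E) (F : Type*) [NormedAddCommGroup F] [NormedSpace ℝ F] (m : ℕ) :
    SmoothMap U F →ₗ[ℝ] C(U, E [×m]→L[ℝ] F) where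
  toFun := derivOn m
  map_add' f g := by
    ext1 x
    exact iteratedFDeriv_add_apply (f.contDiffAt x.2) (g.contDiffAt x.2)
  map_smul' r f := by
    ext1 x
    exact iteratedFDeriv_const_smul_apply (f.contDiffAt x.2)

instance : IsTopologicalAddGroup (SmoothMap U F) :=
  topologicalAddGroup_iInf fun m => topologicalAddGroup_induced (derivOnₗ U F m)

instance : ContinuousSMul ℝ (SmoothMap U F) :=
  continuousSMul_iInf fun m => continuousSMul_induced (derivOnₗ U F m)

theorem continuous_derivOn (m : ℕ) : Continuous (derivOn m : SmoothMap U F → _) :=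
  continuous_iInf_dom continuous_induced_dom

theorem continuous_iff {T : Type*} [TopologicalSpace T] {f : T → SmoothMap U F} :
    Continuous f ↔ ∀ m, Continuous fun t => derivOn m (f t) := by
  rw [continuous_iInf_rng]
  exact forall_congr' fun m => continuous_induced_rng

theorem tendsto_iff {ι : Type*} {l : Filter ι} {f : ι → SmoothMap U F} {g : SmoothMap U F} :
    Tendsto f l (𝓝 g) ↔ ∀ m, Tendsto (fun i => derivOn m (f i)) l (𝓝 (derivOn m g)) := by
  rw [nhds_iInf, tendsto_iInf]
  refine forall_congr' fun m => ?_
  rw [nhds_induced, tendsto_comap_iff]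
  rfl

/-- Convergence to zero in `C^∞(U, F)`. -/
theorem tendsto_zero {ι : Type*} {l : Filter ι} {f : ι → SmoothMap U F}
    (h : ∀ (m : ℕ) (K : Set E), IsCompact K → K ⊆ U → ∀ ε > 0,
      ∀ᶠ i in l, ∀ x ∈ K, ‖iteratedFDeriv ℝ m (f i) x‖ < ε) : Tendsto f l (𝓝 0) := by
  rw [tendsto_iff]
  intro m
  rw [show derivOn m (0 : SmoothMap U F) = 0 from (derivOnₗ U F m).map_zero,
    ContinuousMap.tendsto_iff_forall_isCompact_tendstoUniformlyOn]
  intro K hK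
  rw [Metric.tendstoUniformlyOn_iff]
  intro ε hε
  filter_upwards [h m (Subtype.val '' K) (hK.image continuous_subtype_val)
    (by rintro _ ⟨x, _, rfl⟩; exact x.2) ε hε] with i hi x hx
  rw [ContinuousMap.zero_apply, dist_zero_left]
  exact hi x ⟨x, hx, rfl⟩

/-- Elements near `g` are close to it with all derivatives, uniformly on compact subsets. -/
theorem eventually_norm_sub_lt (g : SmoothMap U F) (m : ℕ) {K : Set E} (hK : IsCompact K)
    (hKU : K ⊆ U) {ε : ℝ} (hε : 0 < ε) :
    ∀ᶠ f : SmoothMap U F in 𝓝 g, ∀ x ∈ K,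
      ‖iteratedFDeriv ℝ m f x - iteratedFDeriv ℝ m g x‖ < ε := by
  have h := (continuous_derivOn (U := U) (F := F) m).tendsto g
  rw [ContinuousMap.tendsto_iff_forall_isCompact_tendstoUniformlyOn] at h
  have hK' : IsCompact (Subtype.val ⁻¹' K : Set U) :=
    Topology.IsInducing.subtypeVal.isCompact_preimage' hK (by simpa using hKU)
  filter_upwards [Metric.tendstoUniformlyOn_iff.1 (h _ hK') ε hε] with f hf x hx
  have := hf ⟨x, hKU hx⟩ hx
  rw [dist_eq_norm, norm_sub_rev] at this
  exact this

theorem eventually_norm_apply_sub_lt (g : SmoothMap U F) {K : Set E} (hK : IsCompact K)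
    (hKU : K ⊆ U) {ε : ℝ} (hε : 0 < ε) :
    ∀ᶠ f : SmoothMap U F in 𝓝 g, ∀ x ∈ K, ‖f x - g x‖ < ε := by
  filter_upwards [g.eventually_norm_sub_lt 0 hK hKU hε] with f hf x hx
  have := hf x hx
  rw [iteratedFDeriv_zero_eq_comp, iteratedFDeriv_zero_eq_comp, Function.comp_apply,
    Function.comp_apply, ← map_sub, LinearIsometryEquiv.norm_map] at this
  exact this

theorem isCompact_bddAbove (g : SmoothMap U F) (m : ℕ) {K : Set E} (hK : IsCompact K)
    (hKU : K ⊆ U) : ∃ C, ∀ x ∈ K, ‖iteratedFDeriv ℝ m g x‖ ≤ C := by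
  have hK' : IsCompact (Subtype.val ⁻¹' K : Set U) :=
    Topology.IsInducing.subtypeVal.isCompact_preimage' hK (by simpa using hKU)
  obtain ⟨C, hC⟩ := hK'.exists_bound_of_continuousOn (derivOn m g).continuous.continuousOn
  exact ⟨C, fun x hx => hC ⟨x, hKU hx⟩ hx⟩

/-- All derivatives up to a given order are uniformly bounded on a compact set near `g`. -/
theorem eventually_norm_le (g : SmoothMap U F) (k : ℕ) {K : Set E} (hK : IsCompact K)
    (hKU : K ⊆ U) :
    ∃ C, ∀ᶠ f : SmoothMap U F in 𝓝 g, ∀ m ≤ k, ∀ x ∈ K, ‖iteratedFDeriv ℝ m f x‖ ≤ C := by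
  choose C hC using fun m => g.isCompact_bddAbove m hK hKU
  refine ⟨∑ m ∈ Finset.range (k + 1), |C m| + 1, ?_⟩
  have : ∀ᶠ f : SmoothMap U F in 𝓝 g, ∀ m ∈ Finset.range (k + 1), ∀ x ∈ K,
      ‖iteratedFDeriv ℝ m f x - iteratedFDeriv ℝ m g x‖ < 1 :=
    (Filter.eventually_all_finset _).2 fun m _ => g.eventually_norm_sub_lt m hK hKU one_pos
  filter_upwards [this] with f hf m hm x hx
  have hm' : m ∈ Finset.range (k + 1) := Finset.mem_range.2 (Nat.lt_succ_of_le hm)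
  have h1 := hf m hm' x hx
  have h2 := Finset.single_le_sum (f := fun m => |C m|) (fun _ _ => abs_nonneg _) hm'
  have h3 := (hC m x hx).trans (le_abs_self _)
  have h4 := norm_le_norm_add_norm_sub' (iteratedFDeriv ℝ m f x) (iteratedFDeriv ℝ m g x)
  change |C m| ≤ _ at h2
  linarith

/-- The derivative of a smooth map, as a smooth map. -/
def fderivMap (f : SmoothMap U F) : SmoothMap U (E →L[ℝ] F) :=
  ofContDiffOn U (fderiv ℝ f) (f.contDiffOn.fderiv_of_isOpen U.isOpen (by simp))

theorem fderivMap_apply (f : SmoothMap U F) {x : E} (hx : x ∈ U) :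
    fderivMap f x = fderiv ℝ f x := ofContDiffOn_apply _ hx

theorem derivOn_succ (m : ℕ) (f : SmoothMap U F) (x : U) :
    derivOn (m + 1) f x =
      (continuousMultilinearCurryRightEquiv' ℝ m E F).symm (derivOn m (fderivMap f) x) := by
  rw [derivOn_apply, derivOn_apply, iteratedFDeriv_succ_eq_comp_right, Function.comp_apply,
    fderivMap, iteratedFDeriv_ofContDiffOn _ x.2]

/-- Trades one order of differentiation for a change of the target space, which makes inductions on
the order possible. -/
theorem continuous_derivOn_succ_iff {T : Type*} [TopologicalSpace T] {f : T → SmoothMap U F}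
    {m : ℕ} : Continuous (fun t => derivOn (m + 1) (f t)) ↔
      Continuous fun t => derivOn m (fderivMap (f t)) := by
  let e := continuousMultilinearCurryRightEquiv' ℝ m E F
  have h1 : ∀ t, derivOn (m + 1) (f t) =
      (⟨e.symm, e.symm.continuous⟩ : C(_, _)).comp (derivOn m (fderivMap (f t))) := fun t => by
    ext1 x; exact derivOn_succ m (f t) x
  have h2 : ∀ t, derivOn m (fderivMap (f t)) =
      (⟨e, e.continuous⟩ : C(_, _)).comp (derivOn (m + 1) (f t)) := fun t => by
    ext1 x; rw [ContinuousMap.comp_apply, derivOn_succ]; exact (e.apply_symm_apply _).symm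
  constructor
  · intro h
    simp_rw [h2]
    exact (ContinuousMap.continuous_postcomp _).comp h
  · intro h
    simp_rw [h1]
    exact (ContinuousMap.continuous_postcomp _).comp h

theorem continuous_fderivMap : Continuous (fderivMap : SmoothMap U F → _) :=
  continuous_iff.2 fun m => continuous_derivOn_succ_iff.1 (continuous_derivOn (m + 1))

/-- The pointwise pairing of smooth maps by a continuous bilinear map. -/
def bilin (B : F →L[ℝ] G →L[ℝ] H) (f : SmoothMap U F) (g : SmoothMap U G) : SmoothMap U H :=
  ofContDiffOn U (fun x => B (f x) (g x))
    ((B.contDiff.comp_contDiffOn f.contDiffOn).clm_apply g.contDiffOn)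

theorem bilin_apply (B : F →L[ℝ] G →L[ℝ] H) (f : SmoothMap U F) (g : SmoothMap U G) {x : E}
    (hx : x ∈ U) : bilin B f g x = B (f x) (g x) := ofContDiffOn_apply _ hx

theorem fderivMap_bilin (B : F →L[ℝ] G →L[ℝ] H) (f : SmoothMap U F) (g : SmoothMap U G) :
    fderivMap (bilin B f g) =
      bilin (B.precompR E) f (fderivMap g) + bilin (B.precompL E) (fderivMap f) g := by
  apply ext_on
  intro x hx
  rw [fderivMap_apply _ hx, add_apply, bilin_apply _ _ _ hx, bilin_apply _ _ _ hx,
    fderivMap_apply _ hx, fderivMap_apply _ hx, bilin,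
    (ofContDiffOn_eventuallyEq _ hx).fderiv_eq]
  exact (B.hasFDerivAt_of_bilinear (f.differentiableAt hx).hasFDerivAt
    (g.differentiableAt hx).hasFDerivAt).fderiv

end SmoothMap

/-! ### Joint continuity of pointwise bilinear products -/

section Bilinear

universe v₁ v₂ v₃

variable {E : Type} [NormedAddCommGroup E] [NormedSpace ℝ E] [FiniteDimensional ℝ E] {U : Opens E}

namespace SmoothMap

/-- Evaluation is jointly continuous for the compact-open topology because U is locally compact. -/
theorem continuous_eval_derivOn {F : Type v₁} [NormedAddCommGroup F] [NormedSpace ℝ F] {m : ℕ} :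
    Continuous fun r : SmoothMap U F × U => derivOn m r.1 r.2 := by
  have : ProperSpace E := FiniteDimensional.proper ℝ E
  have : LocallyCompactSpace U := U.isOpen.locallyCompactSpace
  exact ContinuousEval.continuous_eval.comp (f := fun r : SmoothMap U F × U => (derivOn m r.1, r.2))
    (((continuous_derivOn m).comp continuous_fst).prodMk continuous_snd)

/-- Induction by the Leibniz rule. The spaces and the pairing are quantified inside because
differentiating replaces them by spaces of linear maps. -/
theorem continuous_derivOn_bilin (m : ℕ) : ∀ {F : Type v₁} {G : Type v₂}
    {H : Type v₃} [NormedAddCommGroup F] [NormedSpace ℝ F] [NormedAddCommGroup G]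
    [NormedSpace ℝ G] [NormedAddCommGroup H] [NormedSpace ℝ H] (B : F →L[ℝ] G →L[ℝ] H),
    Continuous fun q : SmoothMap U F × SmoothMap U G => derivOn m (bilin B q.1 q.2) := by
  induction m with
  | zero =>
    intro F G H _ _ _ _ _ _ B
    let eF := continuousMultilinearCurryFin0 ℝ E F
    let eG := continuousMultilinearCurryFin0 ℝ E G
    let eH := continuousMultilinearCurryFin0 ℝ E H
    have h : ∀ (q : SmoothMap U F × SmoothMap U G) (x : U), derivOn 0 (bilin B q.1 q.2) x =
        eH.symm (B (eF (derivOn 0 q.1 x)) (eG (derivOn 0 q.2 x))) := by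
      intro q x
      rw [derivOn_apply, iteratedFDeriv_zero_eq_comp, Function.comp_apply, bilin_apply _ _ _ x.2]
      simp [eF, eG, eH, derivOn_apply, iteratedFDeriv_zero_eq_comp]
    refine ContinuousMap.continuous_of_continuous_uncurry _ ?_
    have h2 : (Function.uncurry fun (q : SmoothMap U F × SmoothMap U G) (x : U) =>
        derivOn 0 (bilin B q.1 q.2) x) =
        fun r => eH.symm (B (eF (derivOn 0 r.1.1 r.2)) (eG (derivOn 0 r.1.2 r.2))) := by
      funext r
      exact h r.1 r.2
    rw [h2]
    have hF : Continuous fun r : (SmoothMap U F × SmoothMap U G) × U => derivOn 0 r.1.1 r.2 :=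
      continuous_eval_derivOn.comp (f := fun r : (SmoothMap U F × SmoothMap U G) × U =>
        (r.1.1, r.2)) (by fun_prop)
    have hG : Continuous fun r : (SmoothMap U F × SmoothMap U G) × U => derivOn 0 r.1.2 r.2 :=
      continuous_eval_derivOn.comp (f := fun r : (SmoothMap U F × SmoothMap U G) × U =>
        (r.1.2, r.2)) (by fun_prop)
    exact eH.symm.continuous.comp
      ((B.continuous.comp (eF.continuous.comp hF)).clm_apply (eG.continuous.comp hG))
  | succ m ih =>
    intro F G H _ _ _ _ _ _ B
    rw [continuous_derivOn_succ_iff]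
    have h : ∀ q : SmoothMap U F × SmoothMap U G, derivOn m (fderivMap (bilin B q.1 q.2)) =
        derivOn m (bilin (B.precompR E) q.1 (fderivMap q.2)) +
          derivOn m (bilin (B.precompL E) (fderivMap q.1) q.2) := by
      intro q
      rw [fderivMap_bilin]
      exact (derivOnₗ U (E →L[ℝ] H) m).map_add _ _
    simp_rw [h]
    have h1 : Continuous fun q : SmoothMap U F × SmoothMap U G => (q.1, fderivMap q.2) :=
      continuous_fst.prodMk (continuous_fderivMap.comp continuous_snd)
    have h2 : Continuous fun q : SmoothMap U F × SmoothMap U G => (fderivMap q.1, q.2) :=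
      (continuous_fderivMap.comp continuous_fst).prodMk continuous_snd
    have h3 := ih (F := F) (G := E →L[ℝ] G) (H := E →L[ℝ] H) (B.precompR E)
    have h4 := ih (F := E →L[ℝ] F) (G := G) (H := E →L[ℝ] H) (B.precompL E)
    refine Continuous.add ?_ ?_
    · exact h3.comp h1
    · have h5 := h4.comp h2
      simp only [Function.comp_def] at h5
      exact h5

theorem continuous_bilin {F : Type v₁} {G : Type v₂}
    {H : Type v₃} [NormedAddCommGroup F] [NormedSpace ℝ F] [NormedAddCommGroup G]
    [NormedSpace ℝ G] [NormedAddCommGroup H] [NormedSpace ℝ H] (B : F →L[ℝ] G →L[ℝ] H) :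
    Continuous fun q : SmoothMap U F × SmoothMap U G => bilin B q.1 q.2 :=
  continuous_iff.2 fun m => continuous_derivOn_bilin m B

end SmoothMap

end Bilinear

/-! ### Continuity and bilinearity of the transport operator -/

section TransportContinuity

variable {E : Type} [NormedAddCommGroup E] [NormedSpace ℝ E]
variable {F : Type*} [NormedAddCommGroup F] [NormedSpace ℝ F]
variable {M U : Opens E}

namespace SmoothMap

/-- Restriction of smooth maps to a smaller open set. -/
def restrict (hUM : U ≤ M) (f : SmoothMap M F) : SmoothMap U F :=
  ofContDiffOn U f (f.contDiffOn.mono hUM)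

theorem restrict_apply (hUM : U ≤ M) (f : SmoothMap M F) {x : E} (hx : x ∈ U) :
    restrict hUM f x = f x := ofContDiffOn_apply _ hx

theorem continuous_restrict (hUM : U ≤ M) :
    Continuous (restrict hUM : SmoothMap M F → SmoothMap U F) := by
  refine continuous_iff.2 fun m => ?_
  have h : ∀ f : SmoothMap M F, derivOn m (restrict hUM f) =
      (derivOn m f).comp ⟨Set.inclusion hUM, continuous_inclusion hUM⟩ := fun f => by
    ext1 x
    exact iteratedFDeriv_ofContDiffOn _ x.2 m
  simp_rw [h]
  exact (ContinuousMap.continuous_precomp _).comp (continuous_derivOn m)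

/-- The restriction to `U` of the translate `x ↦ f (x - p)` of a smooth function `f`. -/
def translate (U : Opens E) (p : E) (f : SmoothMap (⊤ : Opens E) F) : SmoothMap U F :=
  ofContDiffOn U (fun x => f (x - p)) <| by
    have hf : ContDiff ℝ ∞ (f : E → F) := contDiffOn_univ.1 f.contDiffOn
    exact (hf.comp (contDiff_id.sub contDiff_const)).contDiffOn

theorem iteratedFDeriv_translate (p : E) (f : SmoothMap (⊤ : Opens E) F) (m : ℕ) {x : E}
    (hx : x ∈ U) :
    iteratedFDeriv ℝ m (translate U p f) x = iteratedFDeriv ℝ m f (x - p) := by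
  rw [translate, iteratedFDeriv_ofContDiffOn _ hx, iteratedFDeriv_comp_sub]

theorem translate_add (p : E) (f g : SmoothMap (⊤ : Opens E) F) :
    translate U p (f + g) = translate U p f + translate U p g :=
  ext_on fun x hx => by
    rw [add_apply, translate, translate, translate, ofContDiffOn_apply _ hx,
      ofContDiffOn_apply _ hx, ofContDiffOn_apply _ hx, add_apply]

theorem translate_smul (p : E) (r : ℝ) (f : SmoothMap (⊤ : Opens E) F) :
    translate U p (r • f) = r • translate U p f :=
  ext_on fun x hx => by
    rw [smul_apply, translate, translate, ofContDiffOn_apply _ hx,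
      ofContDiffOn_apply _ hx, smul_apply]

/-- Used to move the base point of jets along with the source when the vector field varies. -/
theorem continuous_translate (f : SmoothMap (⊤ : Opens E) F) :
    Continuous fun p => translate U p f := by
  refine continuous_iff.2 fun m => ?_
  refine ContinuousMap.continuous_of_continuous_uncurry _ ?_
  have h : (Function.uncurry fun (p : E) (x : U) => derivOn m (translate U p f) x) =
      fun r : E × U => derivOn m f ⟨(r.2 : E) - r.1, trivial⟩ := by
    funext r
    exact iteratedFDeriv_translate r.1 f m r.2.2
  rw [h]
  exact (derivOn m f).continuous.comp
    (((continuous_subtype_val.comp continuous_snd).sub continuous_fst).subtype_mk _)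

end SmoothMap

variable {𝕜 : Type*} [RCLike 𝕜]
variable {V : Type*} [NormedAddCommGroup V] [NormedSpace ℝ V] [NormedSpace 𝕜 V]
  [IsScalarTower ℝ 𝕜 V]

theorem transport_apply (hUM : U ≤ M) (X : SmoothMap M E) (A : SmoothMap U (V →L[𝕜] V))
    (u : SmoothMap U V) {y : E} (hy : y ∈ U) :
    transport hUM X A u y = fderiv ℝ u y (X y) + A y (u y) :=
  indicator_of_mem (s := (U : Set E)) hy (fun y => fderiv ℝ u y (X y) + A y (u y))

theorem transport_eq_bilin (hUM : U ≤ M) (X : SmoothMap M E) (A : SmoothMap U (V →L[𝕜] V))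
    (u : SmoothMap U V) :
    transport hUM X A u =
      SmoothMap.bilin (ContinuousLinearMap.id ℝ (E →L[ℝ] V)) (SmoothMap.fderivMap u)
        (SmoothMap.restrict hUM X) +
      SmoothMap.bilin (ContinuousLinearMap.restrictScalarsL 𝕜 V V ℝ ℝ) A u :=
  SmoothMap.ext_on fun y hy => by
    rw [transport_apply hUM X A u hy, SmoothMap.add_apply, SmoothMap.bilin_apply _ _ _ hy,
      SmoothMap.bilin_apply _ _ _ hy, SmoothMap.fderivMap_apply _ hy,
      SmoothMap.restrict_apply hUM X hy]
    rfl

theorem continuous_transport [FiniteDimensional ℝ E] (hUM : U ≤ M) :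
    Continuous fun q : (SmoothMap M E × SmoothMap U (V →L[𝕜] V)) × SmoothMap U V =>
      transport hUM q.1.1 q.1.2 q.2 := by
  simp_rw [transport_eq_bilin]
  refine Continuous.add ?_ ?_
  · exact (SmoothMap.continuous_bilin (ContinuousLinearMap.id ℝ (E →L[ℝ] V))).comp
      ((SmoothMap.continuous_fderivMap.comp continuous_snd).prodMk
        ((SmoothMap.continuous_restrict hUM).comp (continuous_fst.comp continuous_fst)))
  · exact (SmoothMap.continuous_bilin (ContinuousLinearMap.restrictScalarsL 𝕜 V V ℝ ℝ)).comp
      ((continuous_snd.comp continuous_fst).prodMk continuous_snd)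

theorem transport_add (hUM : U ≤ M) (X : SmoothMap M E) (A : SmoothMap U (V →L[𝕜] V))
    (u v : SmoothMap U V) :
    transport hUM X A (u + v) = transport hUM X A u + transport hUM X A v :=
  SmoothMap.ext_on fun y hy => by
    have h : fderiv ℝ (u + v : SmoothMap U V) y = fderiv ℝ u y + fderiv ℝ v y :=
      fderiv_add (u.differentiableAt hy) (v.differentiableAt hy)
    rw [SmoothMap.add_apply, transport_apply hUM X A _ hy, transport_apply hUM X A _ hy,
      transport_apply hUM X A _ hy, h, SmoothMap.add_apply, _root_.add_apply, map_add]
    abel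

theorem transport_smul (hUM : U ≤ M) (X : SmoothMap M E) (A : SmoothMap U (V →L[𝕜] V))
    (r : ℝ) (u : SmoothMap U V) :
    transport hUM X A (r • u) = r • transport hUM X A u :=
  SmoothMap.ext_on fun y hy => by
    have h : fderiv ℝ (r • u : SmoothMap U V) y = r • fderiv ℝ u y :=
      fderiv_const_smul (u.differentiableAt hy) r
    rw [SmoothMap.smul_apply, transport_apply hUM X A _ hy, transport_apply hUM X A _ hy,
      h, SmoothMap.smul_apply, _root_.smul_apply, smul_add,
      (A y).map_smul_of_tower r (u y)]

/-- The operator `D_X + A` as a real-linear map. -/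
def transportₗ (hUM : U ≤ M) (X : SmoothMap M E) (A : SmoothMap U (V →L[𝕜] V)) :
    SmoothMap U V →ₗ[ℝ] SmoothMap U V where
  toFun := transport hUM X A
  map_add' := transport_add hUM X A
  map_smul' := transport_smul hUM X A

theorem transport_sub (hUM : U ≤ M) (X : SmoothMap M E) (A : SmoothMap U (V →L[𝕜] V))
    (u v : SmoothMap U V) :
    transport hUM X A (u - v) = transport hUM X A u - transport hUM X A v :=
  (transportₗ hUM X A).map_sub u v

theorem transport_data_add (hUM : U ≤ M) (c c' : SmoothMap M E × SmoothMap U (V →L[𝕜] V))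
    (u : SmoothMap U V) :
    transport hUM (c + c').1 (c + c').2 u = transport hUM c.1 c.2 u + transport hUM c'.1 c'.2 u :=
  SmoothMap.ext_on fun y hy => by
    rw [SmoothMap.add_apply, transport_apply hUM _ _ _ hy, transport_apply hUM _ _ _ hy,
      transport_apply hUM _ _ _ hy, Prod.fst_add, Prod.snd_add, SmoothMap.add_apply,
      SmoothMap.add_apply, map_add, _root_.add_apply]
    abel

theorem transport_data_smul (hUM : U ≤ M) (r : ℝ)
    (c : SmoothMap M E × SmoothMap U (V →L[𝕜] V)) (u : SmoothMap U V) :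
    transport hUM (r • c).1 (r • c).2 u = r • transport hUM c.1 c.2 u :=
  SmoothMap.ext_on fun y hy => by
    rw [SmoothMap.smul_apply, transport_apply hUM _ _ _ hy, transport_apply hUM _ _ _ hy,
      Prod.smul_fst, Prod.smul_snd, SmoothMap.smul_apply,
      SmoothMap.smul_apply, map_smul, _root_.smul_apply, smul_add]

end TransportContinuity

/-! ### Backward trajectories in a region of expansion -/

section Trajectories

variable {E : Type*} [NormedAddCommGroup E] [NormedSpace ℝ E]
variable {E' : Type*} [NormedAddCommGroup E'] [NormedSpace ℝ E']

/-- `β` is an integral curve of `-X` on `[0, ∞)`. -/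
def IsBackwardCurve (X : E → E) (β : ℝ → E) : Prop :=
  ∀ s, 0 ≤ s → HasDerivWithinAt β (-X (β s)) (Ici 0) s

theorem IsBackwardCurve.continuousOn {X : E → E} {β : ℝ → E} (h : IsBackwardCurve X β) :
    ContinuousOn β (Ici 0) := fun s hs => (h s hs).continuousWithinAt

theorem IsBackwardCurve.shift {X : E → E} {β : ℝ → E} (h : IsBackwardCurve X β) {σ : ℝ}
    (hσ : 0 ≤ σ) : IsBackwardCurve X fun s => β (σ + s) := by
  intro s hs
  have h1 : HasDerivWithinAt (fun s : ℝ => σ + s) 1 (Ici 0) s := by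
    simpa using (hasDerivWithinAt_id s (Ici 0)).const_add σ
  have h2 := (h (σ + s) (add_nonneg hσ hs)).scomp s h1
    (fun x hx => add_nonneg hσ hx)
  rw [one_smul] at h2
  exact h2

theorem isBackwardCurve_const {X : E → E} {x : E} (h : X x = 0) :
    IsBackwardCurve X fun _ => x := fun s _ => by
  simpa [h] using hasDerivWithinAt_const s (Ici 0) x

theorem IsIntegralCurveOn.isBackwardCurve {X : E → E} {γ : ℝ → E}
    (h : IsIntegralCurveOn γ (fun _ => X) (Iic 0)) : IsBackwardCurve X fun s => γ (-s) := by
  intro s hs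
  have h1 : HasDerivWithinAt (fun s : ℝ => -s) (-1) (Ici 0) s :=
    (hasDerivWithinAt_id s (Ici 0)).neg
  have h2 := (h (-s) (by simpa using hs)).scomp s h1 (fun x hx => by simpa using hx)
  rw [neg_smul, one_smul] at h2
  exact h2

/-- A linear endomorphism of `E` in the coordinates `e`. -/
def inCoords (e : E ≃L[ℝ] E') (L : E →L[ℝ] E) : E' →L[ℝ] E' :=
  ((e : E →L[ℝ] E').comp L).comp (e.symm : E' →L[ℝ] E)

/-- On `S` the vector field `X` is expanding at rate `c`, in the coordinates `e`. -/
def ExpandsOn (e : E ≃L[ℝ] E') (Λ c : ℝ) (X : E → E) (S : Set E) : Prop :=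
  ∀ x ∈ S, DifferentiableAt ℝ X x ∧
    ‖Λ • ContinuousLinearMap.id ℝ E' - inCoords e (fderiv ℝ X x)‖ ≤ Λ - c

theorem ExpandsOn.mono {e : E ≃L[ℝ] E'} {Λ c : ℝ} {X : E → E} {S S' : Set E}
    (h : ExpandsOn e Λ c X S) (hS : S' ⊆ S) : ExpandsOn e Λ c X S' := fun x hx => h x (hS hx)

/-- The mean value inequality for ξ ↦ Λξ - e(X(e⁻¹ξ)), whose derivative has norm at most Λ - c. -/
theorem ExpandsOn.norm_sub_le {e : E ≃L[ℝ] E'} {Λ c : ℝ} {X : E → E} {S : Set E}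
    (h : ExpandsOn e Λ c X S) (hS : Convex ℝ S) {x y : E} (hx : x ∈ S) (hy : y ∈ S) :
    ‖Λ • e (x - y) - e (X x - X y)‖ ≤ (Λ - c) * ‖e (x - y)‖ := by
  have hconv : Convex ℝ (e.symm ⁻¹' S) :=
    hS.linear_preimage (e.symm : E' →ₗ[ℝ] E)
  have hd : ∀ ξ ∈ e.symm ⁻¹' S, HasFDerivWithinAt (fun ξ => Λ • ξ - e (X (e.symm ξ)))
      (Λ • ContinuousLinearMap.id ℝ E' - inCoords e (fderiv ℝ X (e.symm ξ))) (e.symm ⁻¹' S) ξ := by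
    intro ξ hξ
    have h1 : HasFDerivAt (fun ξ => X (e.symm ξ))
        ((fderiv ℝ X (e.symm ξ)).comp (e.symm : E' →L[ℝ] E)) ξ :=
      (h _ hξ).1.hasFDerivAt.comp ξ e.symm.hasFDerivAt
    have h2 : HasFDerivAt (fun ξ => e (X (e.symm ξ)))
        ((e : E →L[ℝ] E').comp ((fderiv ℝ X (e.symm ξ)).comp (e.symm : E' →L[ℝ] E))) ξ :=
      e.hasFDerivAt.comp ξ h1
    exact (((hasFDerivAt_id ξ).const_smul Λ).sub h2).hasFDerivWithinAt
  have := hconv.norm_image_sub_le_of_norm_hasFDerivWithin_le hd (fun ξ hξ => (h _ hξ).2)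
    (x := e y) (y := e x) (by simpa using hy) (by simpa using hx)
  simp only [ContinuousLinearEquiv.symm_apply_apply] at this
  rw [map_sub, map_sub, smul_sub]
  convert this using 2
  abel

/-- Backward trajectories that stay in a convex region of expansion approach each other. -/
theorem ExpandsOn.contracts {e : E ≃L[ℝ] E'} {Λ c : ℝ} {X : E → E} {S : Set E}
    (h : ExpandsOn e Λ c X S) (hS : Convex ℝ S) {β₁ β₂ : ℝ → E} (h₁ : IsBackwardCurve X β₁)
    (h₂ : IsBackwardCurve X β₂) {T : ℝ} (hm : ∀ s ∈ Icc 0 T, β₁ s ∈ S ∧ β₂ s ∈ S) :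
    ∀ s ∈ Icc 0 T, ‖e (β₁ s - β₂ s)‖ ≤ Real.exp (-c * s) * ‖e (β₁ 0 - β₂ 0)‖ := by
  -- After multiplication by exp(Λs), the derivative is bounded by (Λ - c)‖H‖. Grönwall's inequality
  -- gives growth at rate Λ - c, hence decay at rate c once the factor is removed.
  set H : ℝ → E' := fun s => Real.exp (Λ * s) • e (β₁ s - β₂ s) with hH
  set H' : ℝ → E' := fun s => Real.exp (Λ * s) •
    (Λ • e (β₁ s - β₂ s) - e (X (β₁ s) - X (β₂ s))) with hH'
  have hder : ∀ s, 0 ≤ s → HasDerivWithinAt H (H' s) (Ici 0) s := by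
    intro s hs
    have h1 : HasDerivAt (fun s : ℝ => Real.exp (Λ * s)) (Real.exp (Λ * s) * Λ) s := by
      have : HasDerivAt (fun s : ℝ => Λ * s) Λ s := by
        simpa using (hasDerivAt_id s).const_mul Λ
      exact this.exp
    have h2 : HasDerivWithinAt (fun s => e (β₁ s - β₂ s)) (e (-X (β₁ s) - -X (β₂ s))) (Ici 0) s :=
      (e : E →L[ℝ] E').hasFDerivAt.comp_hasDerivWithinAt s ((h₁ s hs).sub (h₂ s hs))
    refine (h1.hasDerivWithinAt.smul h2).congr_deriv ?_
    simp only [hH', map_sub, map_neg]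
    module
  intro s hs
  have hg := norm_le_gronwallBound_of_norm_deriv_right_le (f := H) (f' := H') (a := 0) (b := T)
    (K := Λ - c) (ε := 0) (δ := ‖e (β₁ 0 - β₂ 0)‖)
    (fun r hr => ((hder r hr.1).continuousWithinAt).mono fun y hy => hy.1)
    (fun r hr => (hder r hr.1).mono fun y hy => hr.1.trans hy)
    (by simp [hH])
    (fun r hr => by
      have hr' : r ∈ Icc 0 T := ⟨hr.1, hr.2.le⟩
      have := h.norm_sub_le hS (hm r hr').1 (hm r hr').2
      simp only [hH, hH']
      rw [norm_smul, norm_smul, Real.norm_eq_abs, abs_of_pos (Real.exp_pos _), add_zero]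
      have := mul_le_mul_of_nonneg_left this (Real.exp_pos (Λ * r)).le
      linarith) s hs
  rw [gronwallBound_ε0, sub_zero] at hg
  simp only [hH] at hg
  rw [norm_smul, Real.norm_eq_abs, abs_of_pos (Real.exp_pos _)] at hg
  have e1 : Real.exp ((Λ - c) * s) = Real.exp (Λ * s) * Real.exp (-c * s) := by
    rw [← Real.exp_add]; ring_nf
  rw [e1] at hg
  have hp := Real.exp_pos (Λ * s)
  refine le_of_mul_le_mul_left ?_ hp
  linarith

theorem convex_coordBall (e : E ≃L[ℝ] E') (p : E) (R : ℝ) : Convex ℝ {x | ‖e (x - p)‖ ≤ R} := by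
  have : {x | ‖e (x - p)‖ ≤ R} = (e : E →ₗ[ℝ] E') ⁻¹' Metric.closedBall (e p) R := by
    ext x; simp [dist_eq_norm]
  rw [this]
  exact (convex_closedBall _ _).linear_preimage _

/-- A backward trajectory that starts close to a zero of an expanding vector field converges to
it exponentially. -/
theorem ExpandsOn.trapped {e : E ≃L[ℝ] E'} {Λ c R : ℝ} {X : E → E} {x₀ : E}
    (h : ExpandsOn e Λ c X {x | ‖e (x - x₀)‖ ≤ R}) (hc : 0 ≤ c) (hR : 0 < R) (hx₀ : X x₀ = 0)
    {β : ℝ → E} (hβ : IsBackwardCurve X β) (h0 : ‖e (β 0 - x₀)‖ < R) :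
    ∀ s, 0 ≤ s → ‖e (β s - x₀)‖ ≤ Real.exp (-c * s) * ‖e (β 0 - x₀)‖ := by
  have hkey : ∀ T, (∀ s ∈ Icc 0 T, ‖e (β s - x₀)‖ ≤ R) →
      ∀ s ∈ Icc 0 T, ‖e (β s - x₀)‖ ≤ Real.exp (-c * s) * ‖e (β 0 - x₀)‖ := fun T hT =>
    h.contracts (convex_coordBall e x₀ R) hβ (isBackwardCurve_const hx₀)
      fun s hs => ⟨hT s hs, by simpa using hR.le⟩
  intro s hs
  -- Contraction is available only while the trajectory stays in the ball, and contraction keeps it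
  -- there: a barrier argument closes the circle.
  have hlt : ∀ r ∈ Icc 0 s, ‖e (β r - x₀)‖ < R := by
    refine lt_of_continuousOn_of_barrier ?_ h0 ?_
    · exact (e.continuous.comp_continuousOn
        ((hβ.continuousOn.mono fun y hy => hy.1).sub continuousOn_const)).norm
    · intro r hr hle
      refine (hkey r hle r ⟨hr.1, le_rfl⟩).trans_lt (lt_of_le_of_lt ?_ h0)
      have : Real.exp (-c * r) ≤ 1 := Real.exp_le_one_iff.2 (by nlinarith [hr.1])
      exact mul_le_of_le_one_left (norm_nonneg _) this
  exact hkey s (fun r hr => (hlt r hr).le) s ⟨hs, le_rfl⟩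

/-- An expanding vector field that is small at `p` has a zero near `p`. -/
theorem ExpandsOn.exists_zero [FiniteDimensional ℝ E] {e : E ≃L[ℝ] E'} {Λ c R : ℝ} {X : E → E}
    {p : E} (h : ExpandsOn e Λ c X {x | ‖e (x - p)‖ ≤ R}) (hc : 0 < c) (hR : 0 ≤ R)
    (hX : ‖e (X p)‖ ≤ c * R) : ∃ x₀, ‖e (x₀ - p)‖ ≤ R ∧ X x₀ = 0 := by
  have : FiniteDimensional ℝ E' := e.toLinearEquiv.finiteDimensional
  have : CompleteSpace E' := FiniteDimensional.complete ℝ E'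
  have hΛc : 0 ≤ Λ - c := (norm_nonneg _).trans (h p (by simpa using hR)).2
  have hΛ : 0 < Λ := by linarith
  -- Zeros of X are the fixed points of f. It contracts by (Λ - c)/Λ and moves the centre by at most
  -- cR/Λ, hence maps the ball to itself.
  set f : E' → E' := fun ξ => ξ - Λ⁻¹ • e (X (e.symm ξ)) with hf
  set B := Metric.closedBall (e p) R with hB
  have hmem : ∀ ξ ∈ B, ‖e (e.symm ξ - p)‖ ≤ R := fun ξ hξ => by
    simpa [hB, dist_eq_norm] using hξ
  have hlip : ∀ ξ ∈ B, ∀ η ∈ B, dist (f ξ) (f η) ≤ (Λ⁻¹ * (Λ - c)) * dist ξ η := by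
    intro ξ hξ η hη
    have h1 := h.norm_sub_le (convex_coordBall e p R) (hmem ξ hξ) (hmem η hη)
    rw [dist_eq_norm, dist_eq_norm]
    have h2 : f ξ - f η = Λ⁻¹ • (Λ • e (e.symm ξ - e.symm η) -
        e (X (e.symm ξ) - X (e.symm η))) := by
      simp only [hf, map_sub, ContinuousLinearEquiv.apply_symm_apply, smul_sub, smul_smul,
        inv_mul_cancel₀ hΛ.ne', one_smul]
      abel
    rw [h2, norm_smul, norm_inv, Real.norm_eq_abs, abs_of_pos hΛ, mul_assoc]
    refine mul_le_mul_of_nonneg_left (h1.trans_eq ?_) (by positivity)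
    simp
  have hK1 : Λ⁻¹ * (Λ - c) < 1 := by
    rw [inv_mul_lt_iff₀ hΛ]; linarith
  have hK0 : 0 ≤ Λ⁻¹ * (Λ - c) := by positivity
  have hpB : e p ∈ B := Metric.mem_closedBall_self hR
  have hmaps : MapsTo f B B := by
    intro ξ hξ
    rw [hB, Metric.mem_closedBall]
    have h1 := hlip ξ hξ (e p) hpB
    have h2 : dist (f (e p)) (e p) ≤ Λ⁻¹ * (c * R) := by
      rw [dist_eq_norm, hf]
      simp only [ContinuousLinearEquiv.symm_apply_apply, sub_sub_cancel_left, norm_neg]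
      rw [norm_smul, norm_inv, Real.norm_eq_abs, abs_of_pos hΛ]
      exact mul_le_mul_of_nonneg_left hX (by positivity)
    calc dist (f ξ) (e p) ≤ dist (f ξ) (f (e p)) + dist (f (e p)) (e p) := dist_triangle _ _ _
      _ ≤ (Λ⁻¹ * (Λ - c)) * R + Λ⁻¹ * (c * R) := by
        refine add_le_add (h1.trans ?_) h2
        exact mul_le_mul_of_nonneg_left hξ hK0
      _ = R := by field_simp; ring
  have hcon : ContractingWith (Real.toNNReal (Λ⁻¹ * (Λ - c))) (hmaps.restrict f B B) := by
    refine ⟨by simpa using hK1, LipschitzWith.of_dist_le_mul fun ξ η => ?_⟩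
    rw [Real.coe_toNNReal _ hK0]
    exact hlip ξ ξ.2 η η.2
  obtain ⟨ξ, hξ, hfix, -⟩ := hcon.exists_fixedPoint' Metric.isClosed_closedBall.isComplete hmaps
    hpB (edist_ne_top _ _)
  refine ⟨e.symm ξ, hmem ξ hξ, ?_⟩
  have h1 : ξ - Λ⁻¹ • e (X (e.symm ξ)) = ξ := hfix
  have h2 : Λ⁻¹ • e (X (e.symm ξ)) = 0 := by simpa using h1
  rw [smul_eq_zero] at h2
  rcases h2 with h2 | h2
  · exact absurd h2 (inv_ne_zero hΛ.ne')
  · simpa using h2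

end Trajectories

/-! ### Stability of trajectories and of the source under perturbation of the field -/

section Trajectories

variable {E : Type*} [NormedAddCommGroup E] [NormedSpace ℝ E]
variable {E' : Type*} [NormedAddCommGroup E'] [NormedSpace ℝ E']

theorem norm_image_sub_le_of_closedBall {F : Type*} [NormedAddCommGroup F] [NormedSpace ℝ F]
    {X : E → F} {z : E} {ε L : ℝ}
    (h : ∀ x ∈ Metric.closedBall z ε, DifferentiableAt ℝ X x ∧ ‖fderiv ℝ X x‖ ≤ L) {x y : E}
    (hx : x ∈ Metric.closedBall z ε) (hy : y ∈ Metric.closedBall z ε) :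
    ‖X y - X x‖ ≤ L * ‖y - x‖ :=
  (convex_closedBall z ε).norm_image_sub_le_of_norm_hasFDerivWithin_le
    (fun w hw => (h w hw).1.hasFDerivAt.hasFDerivWithinAt) (fun w hw => (h w hw).2) hx hy

/-- Backward trajectories of a nearby vector field from a nearby point stay close to a given
backward trajectory, for a bounded time. -/
theorem norm_sub_lt_of_tube {X X' : E → E} {β₀ β : ℝ → E} {T ε L η : ℝ}
    (h₀ : IsBackwardCurve X β₀) (h : IsBackwardCurve X' β) (hT : 0 ≤ T) (hL : 1 ≤ L)
    (hη : 2 * η * Real.exp (L * T) < ε) (hη0 : 0 ≤ η)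
    (hX' : ∀ s ∈ Icc 0 T, ∀ x ∈ Metric.closedBall (β₀ s) ε,
      DifferentiableAt ℝ X' x ∧ ‖fderiv ℝ X' x‖ ≤ L)
    (hclose : ∀ s ∈ Icc 0 T, ‖X' (β₀ s) - X (β₀ s)‖ ≤ η) (hini : ‖β 0 - β₀ 0‖ ≤ η) :
    ∀ s ∈ Icc 0 T, ‖β s - β₀ s‖ < ε := by
  have hL0 : 0 < L := by linarith
  have hexp1 : 1 ≤ Real.exp (L * T) := Real.one_le_exp (by positivity)
  have hε : 0 < ε := lt_of_le_of_lt (by positivity) hη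
  have hc : ∀ s, ContinuousOn (fun r => β r - β₀ r) (Icc 0 s) := fun s =>
    (h.continuousOn.mono fun y hy => hy.1).sub (h₀.continuousOn.mono fun y hy => hy.1)
  refine lt_of_continuousOn_of_barrier (hc T).norm ?_ ?_
  · refine hini.trans_lt (lt_of_le_of_lt ?_ hη)
    nlinarith
  · intro s hs hle
    have hg := norm_le_gronwallBound_of_norm_deriv_right_le (f := fun r => β r - β₀ r)
      (f' := fun r => -X' (β r) - -X (β₀ r)) (a := 0) (b := s) (K := L) (ε := η) (δ := η)
      (hc s)
      (fun r hr => ((h r hr.1).sub (h₀ r hr.1)).mono fun y hy => hr.1.trans hy) hini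
      (fun r hr => by
        have hr' : r ∈ Icc 0 T := ⟨hr.1, hr.2.le.trans hs.2⟩
        have h1 := norm_image_sub_le_of_closedBall (hX' r hr')
          (Metric.mem_closedBall_self hε.le)
          (show β r ∈ Metric.closedBall (β₀ r) ε by
            rw [Metric.mem_closedBall, dist_eq_norm]; exact hle r ⟨hr.1, hr.2.le⟩)
        have h2 : -X' (β r) - -X (β₀ r) =
            -((X' (β r) - X' (β₀ r)) + (X' (β₀ r) - X (β₀ r))) := by abel
        rw [h2, norm_neg]
        exact (norm_add_le _ _).trans (add_le_add h1 (hclose r hr'))) s ⟨hs.1, le_rfl⟩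
    refine hg.trans_lt (lt_of_le_of_lt ?_ hη)
    rw [gronwallBound_of_K_ne_0 hL0.ne', sub_zero]
    have h3 : Real.exp (L * s) ≤ Real.exp (L * T) := by
      apply Real.exp_le_exp.2; gcongr; exact hs.2
    have h4 : η / L ≤ η := div_le_self hη0 hL
    have h5 : η / L * (Real.exp (L * s) - 1) ≤ η * Real.exp (L * T) := by
      apply mul_le_mul h4 (by linarith) _ hη0
      have : 1 ≤ Real.exp (L * s) := Real.one_le_exp (mul_nonneg hL0.le hs.1)
      linarith
    have h6 : η * Real.exp (L * s) ≤ η * Real.exp (L * T) := by gcongr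
    linarith

/-- Two backward trajectories in a tube of bounded convex sections separate at most
exponentially. -/
theorem norm_sub_le_of_tube {X : E → E} {z : ℝ → E} {β₁ β₂ : ℝ → E} {T ε L : ℝ}
    (h₁ : IsBackwardCurve X β₁) (h₂ : IsBackwardCurve X β₂)
    (hX : ∀ s ∈ Icc 0 T, ∀ x ∈ Metric.closedBall (z s) ε,
      DifferentiableAt ℝ X x ∧ ‖fderiv ℝ X x‖ ≤ L)
    (hm₁ : ∀ s ∈ Icc 0 T, β₁ s ∈ Metric.closedBall (z s) ε)
    (hm₂ : ∀ s ∈ Icc 0 T, β₂ s ∈ Metric.closedBall (z s) ε) :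
    ∀ s ∈ Icc 0 T, ‖β₁ s - β₂ s‖ ≤ ‖β₁ 0 - β₂ 0‖ * Real.exp (L * s) := by
  intro s hs
  have hg := norm_le_gronwallBound_of_norm_deriv_right_le (f := fun r => β₁ r - β₂ r)
    (f' := fun r => -X (β₁ r) - -X (β₂ r)) (a := 0) (b := T) (K := L) (ε := 0)
    (δ := ‖β₁ 0 - β₂ 0‖)
    ((h₁.continuousOn.mono fun y hy => hy.1).sub (h₂.continuousOn.mono fun y hy => hy.1))
    (fun r hr => ((h₁ r hr.1).sub (h₂ r hr.1)).mono fun y hy => hr.1.trans hy) le_rfl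
    (fun r hr => by
      have hr' : r ∈ Icc 0 T := ⟨hr.1, hr.2.le⟩
      have h1 := norm_image_sub_le_of_closedBall (hX r hr') (hm₂ r hr') (hm₁ r hr')
      have h2 : -X (β₁ r) - -X (β₂ r) = -(X (β₁ r) - X (β₂ r)) := by abel
      rw [h2, norm_neg, add_zero]
      exact h1) s hs
  rwa [gronwallBound_ε0, sub_zero] at hg

variable {M U : Opens E}

theorem eventually_norm_fderiv_sub_lt {F : Type*} [NormedAddCommGroup F] [NormedSpace ℝ F]
    (g : SmoothMap U F) {K : Set E} (hK : IsCompact K)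
    (hKU : K ⊆ U) {ε : ℝ} (hε : 0 < ε) :
    ∀ᶠ f : SmoothMap U F in 𝓝 g, ∀ x ∈ K, ‖fderiv ℝ f x - fderiv ℝ g x‖ < ε := by
  filter_upwards [(SmoothMap.continuous_fderivMap.tendsto g).eventually
    ((SmoothMap.fderivMap g).eventually_norm_apply_sub_lt hK hKU hε)] with f hf x hx
  have := hf x hx
  rwa [SmoothMap.fderivMap_apply _ (hKU hx), SmoothMap.fderivMap_apply _ (hKU hx)] at this

theorem inCoords_sub (e : E ≃L[ℝ] E') (L L' : E →L[ℝ] E) :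
    inCoords e (L - L') = inCoords e L - inCoords e L' := by
  ext x; simp [inCoords]

theorem norm_inCoords_le (e : E ≃L[ℝ] E') (L : E →L[ℝ] E) :
    ‖inCoords e L‖ ≤ ‖(e : E →L[ℝ] E')‖ * ‖(e.symm : E' →L[ℝ] E)‖ * ‖L‖ := by
  calc ‖inCoords e L‖ ≤ ‖(e : E →L[ℝ] E')‖ * ‖L‖ * ‖(e.symm : E' →L[ℝ] E)‖ :=
        (ContinuousLinearMap.opNorm_comp_le _ _).trans
          (mul_le_mul_of_nonneg_right (ContinuousLinearMap.opNorm_comp_le _ _) (norm_nonneg _))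
    _ = _ := by ring

theorem norm_adapted_le_of_close (e : E ≃L[ℝ] E') {Λ c δ : ℝ} {L L' : E →L[ℝ] E}
    (h : ‖Λ • ContinuousLinearMap.id ℝ E' - inCoords e L‖ ≤ Λ - c)
    (hd : ‖(e : E →L[ℝ] E')‖ * ‖(e.symm : E' →L[ℝ] E)‖ * ‖L' - L‖ ≤ δ) :
    ‖Λ • ContinuousLinearMap.id ℝ E' - inCoords e L'‖ ≤ Λ - (c - δ) := by
  have h1 : Λ • ContinuousLinearMap.id ℝ E' - inCoords e L' =
      (Λ • ContinuousLinearMap.id ℝ E' - inCoords e L) - inCoords e (L' - L) := by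
    rw [inCoords_sub]; abel
  rw [h1]
  have := norm_sub_le (Λ • ContinuousLinearMap.id ℝ E' - inCoords e L) (inCoords e (L' - L))
  have := norm_inCoords_le e (L' - L)
  linarith

/-- Expansion on a compact set is an open condition in the C¹ topology, up to an arbitrarily small
loss in the rate. -/
theorem eventually_expandsOn {e : E ≃L[ℝ] E'} {Λ c c₁ : ℝ} (hc : c < c₁) {X : SmoothMap M E}
    {K : Set E} (hK : IsCompact K) (hKM : K ⊆ M) (h : ExpandsOn e Λ c₁ X K) :
    ∀ᶠ X' : SmoothMap M E in 𝓝 X, ExpandsOn e Λ c X' K := by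
  set N := ‖(e : E →L[ℝ] E')‖ * ‖(e.symm : E' →L[ℝ] E)‖ with hN
  have hN0 : 0 ≤ N := by positivity
  have hδ : 0 < (c₁ - c) / (N + 1) := div_pos (by linarith) (by linarith)
  filter_upwards [eventually_norm_fderiv_sub_lt X hK hKM hδ] with X' hX' x hx
  refine ⟨X'.differentiableAt (hKM hx), ?_⟩
  have h1 : N * ‖fderiv ℝ X' x - fderiv ℝ X x‖ ≤ c₁ - c := by
    calc N * ‖fderiv ℝ X' x - fderiv ℝ X x‖ ≤ (N + 1) * ((c₁ - c) / (N + 1)) := by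
          have := (hX' x hx).le
          gcongr
          linarith
      _ = c₁ - c := by field_simp
  have := norm_adapted_le_of_close e (h x hx).2 h1
  simpa using this

theorem isCompact_coordBall [FiniteDimensional ℝ E] (e : E ≃L[ℝ] E') (p : E) (R : ℝ) :
    IsCompact {x | ‖e (x - p)‖ ≤ R} := by
  have : FiniteDimensional ℝ E' := e.toLinearEquiv.finiteDimensional
  have : ProperSpace E' := FiniteDimensional.proper ℝ E'
  have h : {x | ‖e (x - p)‖ ≤ R} = e.toHomeomorph ⁻¹' Metric.closedBall (e p) R := by
    ext x; simp [dist_eq_norm]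
  rw [h]
  exact e.toHomeomorph.isCompact_preimage.2 (isCompact_closedBall _ _)

/-- The backward trajectory provided by star-shapedness. -/
theorem IsStarShaped.exists_backwardCurve {X : E → E} {S : Set E} {p : E}
    (h : IsStarShaped X S p) {q : E} (hq : q ∈ S) :
    ∃ β : ℝ → E, β 0 = q ∧ IsBackwardCurve X β ∧ (∀ s, 0 ≤ s → β s ∈ S) ∧
      Tendsto β atTop (𝓝 p) := by
  obtain ⟨γ, h0, hγ, hm, hlim⟩ := h.2 q hq
  exact ⟨fun s => γ (-s), by simpa using h0, IsIntegralCurveOn.isBackwardCurve hγ,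
    fun s hs => hm (-s) (by simpa using hs), hlim.comp tendsto_neg_atTop_atBot⟩

/-- For vector fields near `X` the point around which `U` is star-shaped is close to the one
of `X`. -/
theorem eventually_starPoint_near [FiniteDimensional ℝ E] (hUM : U ≤ M) {e : E ≃L[ℝ] E'}
    {Λ c c₁ R : ℝ} (hc : 0 < c) (hcc : c < c₁) (hR : 0 < R) {X : SmoothMap M E} {p : E}
    (hRU : {x | ‖e (x - p)‖ ≤ R} ⊆ U) (h : ExpandsOn e Λ c₁ X {x | ‖e (x - p)‖ ≤ R})
    (hXp : X p = 0) {ρ : ℝ} (hρ : 0 < ρ) (hρR : ρ < R) :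
    ∀ᶠ X' : SmoothMap M E in 𝓝 X, ∀ p', IsStarShaped X' (U : Set E) p' → ‖e (p' - p)‖ ≤ ρ := by
  have hpU : p ∈ U := hRU (by simpa using hR.le)
  have hcρ : 0 < c * ρ / (‖(e : E →L[ℝ] E')‖ + 1) := by positivity
  filter_upwards [eventually_expandsOn hcc (isCompact_coordBall e p R) (hRU.trans hUM) h,
    X.eventually_norm_apply_sub_lt isCompact_singleton (singleton_subset_iff.2 (hUM hpU)) hcρ]
    with X' hX' hX'p p' hp'
  have h1 : ‖e (X' p)‖ ≤ c * ρ := by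
    have h2 := (hX'p p rfl).le
    rw [hXp, sub_zero] at h2
    calc ‖e (X' p)‖ ≤ ‖(e : E →L[ℝ] E')‖ * ‖X' p‖ := (e : E →L[ℝ] E').le_opNorm _
      _ ≤ (‖(e : E →L[ℝ] E')‖ + 1) * (c * ρ / (‖(e : E →L[ℝ] E')‖ + 1)) := by
        gcongr; linarith
      _ = c * ρ := by field_simp
  obtain ⟨x₀, hx₀, hzero⟩ := (hX'.mono (S' := {x | ‖e (x - p)‖ ≤ ρ})
    fun x hx => le_trans hx hρR.le).exists_zero hc hρ.le h1
  have hx₀U : x₀ ∈ U := hRU (hx₀.trans hρR.le)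
  -- The trajectory from the zero x₀ is constant by the trapping estimate, and it converges to p' by
  -- star-shapedness. Hence p' = x₀.
  obtain ⟨β, h0, hβ, -, hlim⟩ := hp'.exists_backwardCurve hx₀U
  have hsub : {x | ‖e (x - x₀)‖ ≤ R - ρ} ⊆ {x | ‖e (x - p)‖ ≤ R} := by
    intro x hx
    have h3 : e (x - p) = e (x - x₀) + e (x₀ - p) := by rw [← map_add]; congr 1; abel
    have h4 : ‖e (x - x₀)‖ ≤ R - ρ := hx
    show ‖e (x - p)‖ ≤ R
    rw [h3]
    have := norm_add_le (e (x - x₀)) (e (x₀ - p))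
    linarith
  have htrap := (hX'.mono hsub).trapped hc.le (by linarith) hzero hβ (by
    rw [h0]; simpa using hρR)
  have hconst : ∀ s, 0 ≤ s → β s = x₀ := by
    intro s hs
    have := htrap s hs
    rw [h0] at this
    simp only [sub_self, map_zero, norm_zero, mul_zero, norm_le_zero_iff] at this
    have h5 : β s - x₀ = 0 := e.map_eq_zero_iff.1 this
    exact sub_eq_zero.1 h5
  have : Tendsto β atTop (𝓝 x₀) :=
    tendsto_const_nhds.congr' ((eventually_ge_atTop 0).mono fun s hs => (hconst s hs).symm)
  rw [tendsto_nhds_unique hlim this]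
  exact hx₀

end Trajectories

/-! ### Locally uniform control of the trajectories of nearby fields -/

section Trajectories

variable {E : Type*} [NormedAddCommGroup E] [NormedSpace ℝ E]
variable {E' : Type*} [NormedAddCommGroup E'] [NormedSpace ℝ E']
variable {M U : Opens E}

theorem norm_coords_triangle (e : E ≃L[ℝ] E') (x y z : E) :
    ‖e (x - z)‖ ≤ ‖e (x - y)‖ + ‖e (y - z)‖ := by
  have h : e (x - z) = e (x - y) + e (y - z) := by rw [← map_add]; congr 1; abel
  rw [h]
  exact norm_add_le _ _

variable [FiniteDimensional ℝ E]

/-- Locally uniform control of the backward trajectories of all vector fields near `X` that start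
near a given point of the basin of `p`. -/
theorem exists_local_trajectory_bound (hUM : U ≤ M) {e : E ≃L[ℝ] E'}
    {Λ c c₁ R : ℝ} (hc : 0 < c) (hcc : c < c₁) (hR : 0 < R) {X : SmoothMap M E} {p : E}
    (hRU : {x | ‖e (x - p)‖ ≤ R} ⊆ U) (h : ExpandsOn e Λ c₁ X {x | ‖e (x - p)‖ ≤ R})
    {β₀ : ℝ → E} (hβ₀ : IsBackwardCurve X β₀) (hβ₀U : ∀ s, 0 ≤ s → β₀ s ∈ U)
    (hlim : Tendsto β₀ atTop (𝓝 p)) :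
    ∃ W ∈ 𝓝 (β₀ 0), ∃ K₀, IsCompact K₀ ∧ K₀ ⊆ U ∧ ∃ T C : ℝ, 0 ≤ T ∧ 0 ≤ C ∧
      ∀ᶠ X' : SmoothMap M E in 𝓝 X, ∀ p', X' p' = 0 → ‖e (p' - p)‖ ≤ R / 8 →
        ∀ β₁ β₂ : ℝ → E, β₁ 0 ∈ W → β₂ 0 ∈ W → IsBackwardCurve X' β₁ → IsBackwardCurve X' β₂ →
          (∀ s, 0 ≤ s → segment ℝ (β₁ s) (β₂ s) ⊆ K₀) ∧
          (∀ s, T ≤ s → ‖e (β₁ s - p')‖ ≤ R / 2) ∧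
          ∀ s, 0 ≤ s → ‖β₁ s - β₂ s‖ ≤ C * Real.exp (-c * s) * ‖β₁ 0 - β₂ 0‖ := by
  set Ne := ‖(e : E →L[ℝ] E')‖ with hNe
  set Ns := ‖(e.symm : E' →L[ℝ] E)‖ with hNs
  have : ProperSpace E := FiniteDimensional.proper ℝ E
  -- the entrance time
  have hev : ∀ᶠ s in atTop, ‖e (β₀ s - p)‖ < R / 8 := by
    have h1 : Tendsto (fun s => ‖e (β₀ s - p)‖) atTop (𝓝 ‖e (p - p)‖) :=
      ((e.continuous.tendsto _).comp (hlim.sub_const p)).norm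
    refine h1.eventually (gt_mem_nhds ?_)
    simp only [sub_self, map_zero, norm_zero]
    positivity
  obtain ⟨T, hT8, hT⟩ := (hev.and (eventually_ge_atTop 0)).exists
  -- the tube
  have hcomp : IsCompact (β₀ '' Icc 0 T) :=
    isCompact_Icc.image_of_continuousOn (hβ₀.continuousOn.mono fun y hy => hy.1)
  obtain ⟨ε₀, hε₀, hε₀U⟩ := hcomp.exists_cthickening_subset_open U.isOpen
    (by rintro _ ⟨s, hs, rfl⟩; exact hβ₀U s hs.1)
  set ε := min ε₀ (R / 8 / (Ne + 1)) with hε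
  have hNe0 : 0 ≤ Ne := norm_nonneg _
  have hNs0 : 0 ≤ Ns := norm_nonneg _
  have hεpos : 0 < ε := lt_min hε₀ (by positivity)
  set Kt := Metric.cthickening ε (β₀ '' Icc 0 T) with hKt
  have hKtc : IsCompact Kt := hcomp.cthickening
  have hKtU : Kt ⊆ U := (Metric.cthickening_mono (min_le_left _ _) _).trans hε₀U
  have hball : ∀ s ∈ Icc 0 T, Metric.closedBall (β₀ s) ε ⊆ Kt := fun s hs =>
    Metric.closedBall_subset_cthickening (mem_image_of_mem _ hs) ε
  obtain ⟨L₀, hL₀⟩ := SmoothMap.eventually_norm_le X 1 hKtc (hKtU.trans hUM)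
  set L := max L₀ 1 with hL
  -- Makes 2η exp(LT) = ε/2, as required to stay in the tube of radius ε up to time T.
  set η := ε / (4 * Real.exp (L * T)) with hη
  have hη0 : 0 < η := by positivity
  have hηε : 2 * η * Real.exp (L * T) < ε := by
    rw [hη]; field_simp; linarith
  set Sp := {x | ‖e (x - p)‖ ≤ R} with hSp
  refine ⟨Metric.closedBall (β₀ 0) η, Metric.closedBall_mem_nhds _ hη0, Kt ∪ Sp,
    hKtc.union (isCompact_coordBall e p R), union_subset hKtU hRU, T,
    (1 + Ns * Ne) * Real.exp (L * T) * Real.exp (c * T), hT, by positivity, ?_⟩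
  filter_upwards [hL₀, X.eventually_norm_apply_sub_lt hKtc (hKtU.trans hUM) hη0,
    eventually_expandsOn hcc (isCompact_coordBall e p R) (hRU.trans hUM) h]
    with X' hX'L hX'η hX'e p' hp' hp'p β₁ β₂ hW₁ hW₂ hβ₁ hβ₂
  have hX'ball : ∀ s ∈ Icc 0 T, ∀ x ∈ Metric.closedBall (β₀ s) ε,
      DifferentiableAt ℝ X' x ∧ ‖fderiv ℝ X' x‖ ≤ L := by
    intro s hs x hx
    have hxK := hball s hs hx
    refine ⟨X'.differentiableAt (hUM (hKtU hxK)), ?_⟩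
    rw [← norm_iteratedFDeriv_one]
    exact (hX'L 1 le_rfl x hxK).trans (le_max_left _ _)
  have hclose : ∀ s ∈ Icc 0 T, ‖X' (β₀ s) - X (β₀ s)‖ ≤ η := fun s hs =>
    (hX'η _ (hball s hs (Metric.mem_closedBall_self hεpos.le))).le
  have htube : ∀ β : ℝ → E, β 0 ∈ Metric.closedBall (β₀ 0) η → IsBackwardCurve X' β →
      ∀ s ∈ Icc 0 T, ‖β s - β₀ s‖ < ε := fun β hβ0 hβ =>
    norm_sub_lt_of_tube hβ₀ hβ hT (le_max_right _ _) hηε hη0.le hX'ball hclose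
      (by rwa [Metric.mem_closedBall, dist_eq_norm] at hβ0)
  have hsubp' : {x | ‖e (x - p')‖ ≤ R / 2} ⊆ Sp := fun x hx => by
    have h1 := norm_coords_triangle e x p' p
    have h2 : ‖e (x - p')‖ ≤ R / 2 := hx
    show ‖e (x - p)‖ ≤ R
    linarith
  -- At time T three errors of at most R/8 add up: β to β₀, β₀ to p, and p to p'. Their sum is below
  -- R/2, and the trajectory is trapped from then on.
  have htail : ∀ β : ℝ → E, β 0 ∈ Metric.closedBall (β₀ 0) η → IsBackwardCurve X' β →
      ∀ s, T ≤ s → ‖e (β s - p')‖ ≤ R / 2 := by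
    intro β hβ0 hβ s hs
    have h1 : ‖e (β T - p')‖ < R / 2 := by
      have h2 := htube β hβ0 hβ T ⟨hT, le_rfl⟩
      have h3 : ‖e (β T - β₀ T)‖ ≤ R / 8 := by
        calc ‖e (β T - β₀ T)‖ ≤ Ne * ‖β T - β₀ T‖ := (e : E →L[ℝ] E').le_opNorm _
          _ ≤ (Ne + 1) * (R / 8 / (Ne + 1)) := by
            have := h2.le.trans (min_le_right _ _)
            gcongr
            linarith
          _ = R / 8 := by field_simp
      have h4 := norm_coords_triangle e (β T) (β₀ T) p'
      have h5 := norm_coords_triangle e (β₀ T) p p'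
      have h6 : ‖e (p - p')‖ = ‖e (p' - p)‖ := by rw [← norm_neg, ← map_neg]; congr 2; abel
      linarith
    have h2 := (hX'e.mono hsubp').trapped hc.le (by linarith) hp' (hβ.shift hT)
      (by simpa using h1) (s - T) (by linarith)
    simp only [add_sub_cancel, add_zero] at h2
    have h3 : Real.exp (-c * (s - T)) ≤ 1 := Real.exp_le_one_iff.2 (by nlinarith)
    calc _ ≤ _ := h2
      _ ≤ 1 * ‖e (β T - p')‖ := by gcongr
      _ ≤ R / 2 := by linarith
  refine ⟨fun s hs => ?_, htail β₁ hW₁ hβ₁, fun s hs => ?_⟩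
  · rcases le_total s T with hsT | hsT
    · refine Subset.trans ?_ subset_union_left
      refine Subset.trans ?_ (hball s ⟨hs, hsT⟩)
      refine (convex_closedBall _ _).segment_subset ?_ ?_ <;>
      rw [Metric.mem_closedBall, dist_eq_norm]
      · exact (htube β₁ hW₁ hβ₁ s ⟨hs, hsT⟩).le
      · exact (htube β₂ hW₂ hβ₂ s ⟨hs, hsT⟩).le
    · refine Subset.trans ?_ subset_union_right
      exact (convex_coordBall e p R).segment_subset (hsubp' (htail β₁ hW₁ hβ₁ s hsT))
        (hsubp' (htail β₂ hW₂ hβ₂ s hsT))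
  · have hmem : ∀ β : ℝ → E, β 0 ∈ Metric.closedBall (β₀ 0) η → IsBackwardCurve X' β →
        ∀ s ∈ Icc 0 T, β s ∈ Metric.closedBall (β₀ s) ε := fun β h1 h2 s hs => by
      rw [Metric.mem_closedBall, dist_eq_norm]
      exact (htube β h1 h2 s hs).le
    have hpair := norm_sub_le_of_tube hβ₁ hβ₂ hX'ball (hmem β₁ hW₁ hβ₁) (hmem β₂ hW₂ hβ₂)
    set d := ‖β₁ 0 - β₂ 0‖ with hd
    have hd0 : 0 ≤ d := norm_nonneg _
    have hL0 : 0 ≤ L := zero_le_one.trans (le_max_right _ _)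
    have hpair' : ∀ s ∈ Icc 0 T, ‖β₁ s - β₂ s‖ ≤ d * Real.exp (L * T) := fun s hs =>
      (hpair s hs).trans (by gcongr; exact hs.2)
    -- Up to time T, Grönwall's inequality costs a factor exp(LT). Afterwards the two trajectories
    -- contract at rate c, and exp(cT) accounts for this starting only at time T.
    rcases le_total s T with hsT | hsT
    · have h1 : 1 ≤ Real.exp (c * T) * Real.exp (-c * s) := by
        rw [← Real.exp_add]; exact Real.one_le_exp (by nlinarith)
      have h2 : 1 ≤ 1 + Ns * Ne := by nlinarith [mul_nonneg hNs0 hNe0]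
      calc ‖β₁ s - β₂ s‖ ≤ 1 * Real.exp (L * T) * 1 * d := by
            have := hpair' s ⟨hs, hsT⟩; linarith
        _ ≤ (1 + Ns * Ne) * Real.exp (L * T) * (Real.exp (c * T) * Real.exp (-c * s)) * d := by
          gcongr
        _ = _ := by ring
    · have h1 := hX'e.contracts (convex_coordBall e p R) (hβ₁.shift hT) (hβ₂.shift hT)
        (T := s - T) (fun r hr => ⟨hsubp' (htail β₁ hW₁ hβ₁ _ (by linarith [hr.1])),
          hsubp' (htail β₂ hW₂ hβ₂ _ (by linarith [hr.1]))⟩) (s - T) ⟨by linarith, le_rfl⟩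
      simp only [add_sub_cancel, add_zero] at h1
      have h2 : ‖β₁ s - β₂ s‖ ≤ Ns * ‖e (β₁ s - β₂ s)‖ := by
        have := (e.symm : E' →L[ℝ] E).le_opNorm (e (β₁ s - β₂ s))
        simpa using this
      have h3 : ‖e (β₁ T - β₂ T)‖ ≤ Ne * (d * Real.exp (L * T)) :=
        ((e : E →L[ℝ] E').le_opNorm _).trans (by
          gcongr; exact hpair' T ⟨hT, le_rfl⟩)
      have h4 : Real.exp (-c * (s - T)) = Real.exp (c * T) * Real.exp (-c * s) := by
        rw [← Real.exp_add]; ring_nf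
      calc ‖β₁ s - β₂ s‖ ≤ Ns * (Real.exp (-c * (s - T)) * (Ne * (d * Real.exp (L * T)))) := by
            refine h2.trans ?_
            gcongr
            exact h1.trans (by gcongr)
        _ = (Ns * Ne) * Real.exp (L * T) * Real.exp (c * T) * Real.exp (-c * s) * d := by
          rw [h4]; ring
        _ ≤ _ := by gcongr; linarith

/-- The part of the previous statement that concerns single trajectories, over a compact set of
initial points. -/
theorem exists_compact_trajectory_bound (hUM : U ≤ M) {e : E ≃L[ℝ] E'}
    {Λ c c₁ R : ℝ} (hc : 0 < c) (hcc : c < c₁) (hR : 0 < R) {X : SmoothMap M E} {p : E}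
    (hRU : {x | ‖e (x - p)‖ ≤ R} ⊆ U) (h : ExpandsOn e Λ c₁ X {x | ‖e (x - p)‖ ≤ R})
    (hstar : IsStarShaped X (U : Set E) p) {K : Set E} (hK : IsCompact K) (hKU : K ⊆ U) :
    ∃ K₀, IsCompact K₀ ∧ K₀ ⊆ U ∧ ∃ T : ℝ, 0 ≤ T ∧
      ∀ᶠ X' : SmoothMap M E in 𝓝 X, ∀ p', X' p' = 0 → ‖e (p' - p)‖ ≤ R / 8 →
        ∀ β : ℝ → E, β 0 ∈ K → IsBackwardCurve X' β →
          (∀ s, 0 ≤ s → β s ∈ K₀) ∧ ∀ s, T ≤ s → ‖e (β s - p')‖ ≤ R / 2 := by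
  -- The property passes to subsets and to finite unions, so by compactness the local version
  -- suffices.
  refine hK.induction_on (p := fun K => ∃ K₀, IsCompact K₀ ∧ K₀ ⊆ U ∧ ∃ T : ℝ, 0 ≤ T ∧
      ∀ᶠ X' : SmoothMap M E in 𝓝 X, ∀ p', X' p' = 0 → ‖e (p' - p)‖ ≤ R / 8 →
        ∀ β : ℝ → E, β 0 ∈ K → IsBackwardCurve X' β →
          (∀ s, 0 ≤ s → β s ∈ K₀) ∧ ∀ s, T ≤ s → ‖e (β s - p')‖ ≤ R / 2) ?_ ?_ ?_ ?_
  · exact ⟨∅, isCompact_empty, empty_subset _, 0, le_rfl,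
      Eventually.of_forall fun X' p' _ _ β hβ => absurd hβ (notMem_empty _)⟩
  · rintro s t hst ⟨K₀, h1, h2, T, h3, h4⟩
    exact ⟨K₀, h1, h2, T, h3, h4.mono fun X' hX' p' a b β hβ => hX' p' a b β (hst hβ)⟩
  · rintro s t ⟨K₁, h1, h2, T₁, h3, h4⟩ ⟨K₂, h1', h2', T₂, h3', h4'⟩
    refine ⟨K₁ ∪ K₂, h1.union h1', union_subset h2 h2', max T₁ T₂, h3.trans (le_max_left _ _), ?_⟩
    filter_upwards [h4, h4'] with X' g g' p' a b β hβ hβ'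
    rcases hβ with hβ | hβ
    · obtain ⟨k1, k2⟩ := g p' a b β hβ hβ'
      exact ⟨fun s hs => Or.inl (k1 s hs), fun s hs => k2 s ((le_max_left _ _).trans hs)⟩
    · obtain ⟨k1, k2⟩ := g' p' a b β hβ hβ'
      exact ⟨fun s hs => Or.inr (k1 s hs), fun s hs => k2 s ((le_max_right _ _).trans hs)⟩
  · intro q hq
    obtain ⟨β₀, h0, hβ₀, hβ₀U, hlim⟩ := hstar.exists_backwardCurve (hKU hq)
    obtain ⟨W, hW, K₀, hK₀, hK₀U, T, C, hT, hC, hev⟩ :=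
      exists_local_trajectory_bound hUM hc hcc hR hRU h hβ₀ hβ₀U hlim
    rw [h0] at hW
    refine ⟨W, mem_nhdsWithin_of_mem_nhds hW, K₀, hK₀, hK₀U, T, hT, ?_⟩
    filter_upwards [hev] with X' hX' p' a b β hβ hβ'
    obtain ⟨k1, k2, -⟩ := hX' p' a b β β hβ hβ hβ' hβ'
    exact ⟨fun s hs => k1 s hs (left_mem_segment ℝ _ _), k2⟩

end Trajectories

/-! ### Exponential decay to the source and the backward flow -/

section Trajectories

variable {E : Type*} [NormedAddCommGroup E] [NormedSpace ℝ E]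
variable {E' : Type*} [NormedAddCommGroup E'] [NormedSpace ℝ E']
variable {M U : Opens E}

/-- The constant in the exponential decay of backward trajectories. -/
def decayConst (e : E ≃L[ℝ] E') (c R T D : ℝ) : ℝ :=
  ‖(e.symm : E' →L[ℝ] E)‖ * ‖(e : E →L[ℝ] E')‖ +
    (‖(e.symm : E' →L[ℝ] E)‖ * (R / 2) + D) * Real.exp (c * T) /
      (3 * R / 4 / (‖(e : E →L[ℝ] E')‖ + 1))

theorem decayConst_nonneg (e : E ≃L[ℝ] E') (c T : ℝ) {R D : ℝ} (hR : 0 ≤ R) (hD : 0 ≤ D) :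
    0 ≤ decayConst e c R T D := by
  unfold decayConst
  positivity

/-- A backward trajectory in a bounded set that enters the region of expansion after a controlled
time decays exponentially, with controlled constant. -/
theorem norm_sub_le_exp_of_tail {e : E ≃L[ℝ] E'} {Λ c R T D : ℝ} {X : E → E} {p : E}
    (hc : 0 ≤ c) (hR : 0 < R) (hT : 0 ≤ T) (hD : 0 ≤ D)
    (h : ExpandsOn e Λ c X {x | ‖e (x - p)‖ ≤ 3 * R / 4}) (hXp : X p = 0)
    {β : ℝ → E} (hβ : IsBackwardCurve X β) (hbd : ∀ s, 0 ≤ s → ‖β s - p‖ ≤ D)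
    (htail : ∀ s, T ≤ s → ‖e (β s - p)‖ ≤ R / 2) :
    ∀ s, 0 ≤ s → ‖β s - p‖ ≤ decayConst e c R T D * Real.exp (-c * s) * ‖β 0 - p‖ := by
  unfold decayConst
  set Ne := ‖(e : E →L[ℝ] E')‖ with hNe
  set Ns := ‖(e.symm : E' →L[ℝ] E)‖ with hNs
  have hNe0 : 0 ≤ Ne := norm_nonneg _
  have hNs0 : 0 ≤ Ns := norm_nonneg _
  set r := 3 * R / 4 / (Ne + 1) with hr
  have hr0 : 0 < r := by positivity
  have hinv : ∀ x : E, ‖x‖ ≤ Ns * ‖e x‖ := fun x => by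
    have := (e.symm : E' →L[ℝ] E).le_opNorm (e x)
    simpa using this
  intro s hs
  have hexp : 0 < Real.exp (-c * s) := Real.exp_pos _
  -- Near p the trapping estimate is already proportional to ‖β 0 - p‖. Far from p one has ‖β 0 - p‖
  -- ≥ r, so any bound of the form const · exp(-cs) can be multiplied by ‖β 0 - p‖ / r.
  rcases lt_or_ge ‖e (β 0 - p)‖ (3 * R / 4) with h0 | h0
  · have h1 := h.trapped hc (by linarith) hXp hβ h0 s hs
    have h2 : ‖e (β 0 - p)‖ ≤ Ne * ‖β 0 - p‖ := (e : E →L[ℝ] E').le_opNorm _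
    calc ‖β s - p‖ ≤ Ns * (Real.exp (-c * s) * (Ne * ‖β 0 - p‖)) :=
          (hinv _).trans (by gcongr; exact h1.trans (by gcongr))
      _ = (Ns * Ne) * Real.exp (-c * s) * ‖β 0 - p‖ := by ring
      _ ≤ _ := by
        gcongr
        have : 0 ≤ (Ns * (R / 2) + D) * Real.exp (c * T) / r := by positivity
        linarith
  · have hr1 : r ≤ ‖β 0 - p‖ := by
      rw [hr, div_le_iff₀ (by positivity)]
      have h2 : ‖e (β 0 - p)‖ ≤ Ne * ‖β 0 - p‖ := (e : E →L[ℝ] E').le_opNorm _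
      nlinarith [norm_nonneg (β 0 - p)]
    have h1 : ‖β s - p‖ ≤ (Ns * (R / 2) + D) * Real.exp (c * T) * Real.exp (-c * s) := by
      rcases le_total s T with hsT | hsT
      · have h2 : 1 ≤ Real.exp (c * T) * Real.exp (-c * s) := by
          rw [← Real.exp_add]; exact Real.one_le_exp (by nlinarith)
        calc ‖β s - p‖ ≤ D * 1 := by simpa using hbd s hs
          _ ≤ (Ns * (R / 2) + D) * (Real.exp (c * T) * Real.exp (-c * s)) := by
            gcongr
            have : 0 ≤ Ns * (R / 2) := by positivity
            linarith
          _ = _ := by ring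
      · have h2 := h.trapped hc (by linarith) hXp (hβ.shift hT) (by
          simp only [add_zero]
          exact (htail T le_rfl).trans_lt (by linarith)) (s - T) (by linarith)
        simp only [add_sub_cancel, add_zero] at h2
        have h4 : Real.exp (-c * (s - T)) = Real.exp (c * T) * Real.exp (-c * s) := by
          rw [← Real.exp_add]; ring_nf
        calc ‖β s - p‖ ≤ Ns * (Real.exp (-c * (s - T)) * (R / 2)) :=
              (hinv _).trans (by
                gcongr
                exact h2.trans (by gcongr; exact htail T le_rfl))
          _ = (Ns * (R / 2)) * (Real.exp (c * T) * Real.exp (-c * s)) := by rw [h4]; ring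
          _ ≤ (Ns * (R / 2) + D) * (Real.exp (c * T) * Real.exp (-c * s)) := by
            gcongr; linarith
          _ = _ := by ring
    calc ‖β s - p‖ ≤ (Ns * (R / 2) + D) * Real.exp (c * T) * Real.exp (-c * s) := h1
      _ = (Ns * (R / 2) + D) * Real.exp (c * T) / r * Real.exp (-c * s) * r := by field_simp
      _ ≤ (Ns * Ne + (Ns * (R / 2) + D) * Real.exp (c * T) / r) * Real.exp (-c * s) *
          ‖β 0 - p‖ := by
        gcongr
        have : 0 ≤ Ns * Ne := by positivity
        linarith

/-- `β` is the flow of `-X` on `U`, and it contracts `U` to `p` at the exponential rate `c`, with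
locally uniform constants. -/
structure IsBackwardFlow (X : E → E) (U : Set E) (p : E) (c : ℝ) (β : E → ℝ → E) : Prop where
  init : ∀ q ∈ U, β q 0 = q
  curve : ∀ q ∈ U, IsBackwardCurve X (β q)
  mem : ∀ q ∈ U, ∀ s, 0 ≤ s → β q s ∈ U
  add : ∀ q ∈ U, ∀ s, 0 ≤ s → ∀ r, 0 ≤ r → β (β q s) r = β q (s + r)
  compact : ∀ K ⊆ U, IsCompact K → ∃ K₀ ⊆ U, IsCompact K₀ ∧ ∃ C : ℝ, 0 ≤ C ∧ ∀ q ∈ K, ∀ s, 0 ≤ s →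
    β q s ∈ K₀ ∧ ‖β q s - p‖ ≤ C * Real.exp (-c * s) * ‖q - p‖
  pair : ∀ q ∈ U, ∃ W ∈ 𝓝 q, W ⊆ U ∧ ∃ K₀ ⊆ U, IsCompact K₀ ∧ ∃ C : ℝ, 0 ≤ C ∧
    ∀ q₁ ∈ W, ∀ q₂ ∈ W, ∀ s, 0 ≤ s → segment ℝ (β q₁ s) (β q₂ s) ⊆ K₀ ∧
      ‖β q₁ s - β q₂ s‖ ≤ C * Real.exp (-c * s) * ‖q₁ - q₂‖

/-- The estimates valid for all fields near X are applied to X itself, with p' = p. -/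
theorem exists_isBackwardFlow [FiniteDimensional ℝ E] (hUM : U ≤ M) {e : E ≃L[ℝ] E'}
    {Λ c c₁ R : ℝ} (hc : 0 < c) (hcc : c < c₁) (hR : 0 < R) {X : SmoothMap M E} {p : E}
    (hRU : {x | ‖e (x - p)‖ ≤ R} ⊆ U) (h : ExpandsOn e Λ c₁ X {x | ‖e (x - p)‖ ≤ R})
    (hXp : X p = 0) (hstar : IsStarShaped X (U : Set E) p) :
    ∃ β : E → ℝ → E, IsBackwardFlow X (U : Set E) p c β := by
  classical
  have hcurve : ∀ q, ∃ β : ℝ → E, q ∈ U → β 0 = q ∧ IsBackwardCurve X β ∧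
      (∀ s, 0 ≤ s → β s ∈ U) ∧ Tendsto β atTop (𝓝 p) := by
    intro q
    by_cases hq : q ∈ U
    · obtain ⟨β, hβ⟩ := hstar.exists_backwardCurve hq
      exact ⟨β, fun _ => hβ⟩
    · exact ⟨fun _ => q, fun hq' => absurd hq' hq⟩
  choose β hβ using hcurve
  have hp8 : ‖e (p - p)‖ ≤ R / 8 := by simp; linarith
  have hloc : ∀ q ∈ U, ∃ W ∈ 𝓝 q, ∃ K₀, IsCompact K₀ ∧ K₀ ⊆ U ∧ ∃ C : ℝ, 0 ≤ C ∧
      ∀ β₁ β₂ : ℝ → E, β₁ 0 ∈ W → β₂ 0 ∈ W → IsBackwardCurve X β₁ → IsBackwardCurve X β₂ →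
        ∀ s, 0 ≤ s → segment ℝ (β₁ s) (β₂ s) ⊆ K₀ ∧
          ‖β₁ s - β₂ s‖ ≤ C * Real.exp (-c * s) * ‖β₁ 0 - β₂ 0‖ := by
    intro q hq
    obtain ⟨h0, h1, h2, h3⟩ := hβ q hq
    obtain ⟨W, hW, K₀, hK₀, hK₀U, T, C, hT, hC, hev⟩ :=
      exists_local_trajectory_bound hUM hc hcc hR hRU h h1 h2 h3
    rw [h0] at hW
    refine ⟨W, hW, K₀, hK₀, hK₀U, C, hC, fun β₁ β₂ a₁ a₂ b₁ b₂ s hs => ?_⟩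
    obtain ⟨k1, -, k3⟩ := hev.self_of_nhds p hXp hp8 β₁ β₂ a₁ a₂ b₁ b₂
    exact ⟨k1 s hs, k3 s hs⟩
  refine ⟨β, fun q hq => (hβ q hq).1, fun q hq => (hβ q hq).2.1, fun q hq => (hβ q hq).2.2.1,
    ?_, ?_, ?_⟩
  -- The flow law is uniqueness of backward trajectories, read off from the separation estimate with
  -- equal initial points.
  · intro q hq s hs r hr
    have hqs := (hβ q hq).2.2.1 s hs
    obtain ⟨W, hW, K₀, -, -, C, -, hC⟩ := hloc _ hqs
    have h1 := (hβ _ hqs).1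
    have := (hC (β (β q s)) (fun r => β q (s + r)) (by rw [h1]; exact mem_of_mem_nhds hW)
      (by simpa using mem_of_mem_nhds hW) (hβ _ hqs).2.1 ((hβ q hq).2.1.shift hs) r hr).2
    rw [h1] at this
    simp only [add_zero, sub_self, norm_zero, mul_zero, norm_le_zero_iff] at this
    exact sub_eq_zero.1 this
  · intro K hKU hK
    obtain ⟨K₀, hK₀, hK₀U, T, hT, hev⟩ :=
      exists_compact_trajectory_bound hUM hc hcc hR hRU h hstar hK hKU
    have hev' := hev.self_of_nhds p hXp hp8
    obtain ⟨D, hD⟩ := hK₀.isBounded.exists_norm_le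
    refine ⟨K₀, hK₀U, hK₀, decayConst e c R T (|D| + ‖p‖),
      decayConst_nonneg e c T hR.le (by positivity), fun q hq s hs => ?_⟩
    have hq' := hKU hq
    obtain ⟨h1, h2⟩ := hev' (β q) (by rw [(hβ q hq').1]; exact hq) (hβ q hq').2.1
    refine ⟨h1 s hs, ?_⟩
    have hexp : ExpandsOn e Λ c X {x | ‖e (x - p)‖ ≤ 3 * R / 4} := by
      intro x hx
      have hx' : ‖e (x - p)‖ ≤ 3 * R / 4 := hx
      have := h x (show ‖e (x - p)‖ ≤ R by linarith)
      exact ⟨this.1, this.2.trans (by linarith)⟩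
    have := norm_sub_le_exp_of_tail hc.le hR hT (D := |D| + ‖p‖) (by positivity) hexp hXp
      (hβ q hq').2.1 (fun s hs => (norm_sub_le _ _).trans
        (add_le_add ((hD _ (h1 s hs)).trans (le_abs_self D)) le_rfl)) h2 s hs
    rw [(hβ q hq').1] at this
    exact this
  · intro q hq
    obtain ⟨W, hW, K₀, hK₀, hK₀U, C, hC0, hC⟩ := hloc q hq
    refine ⟨W ∩ U, inter_mem hW (U.isOpen.mem_nhds hq), inter_subset_right, K₀, hK₀U, hK₀, C, hC0,
      fun q₁ h₁ q₂ h₂ s hs => ?_⟩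
    have e₁ := (hβ q₁ h₁.2).1
    have e₂ := (hβ q₂ h₂.2).1
    have := hC (β q₁) (β q₂) (by rw [e₁]; exact h₁.1) (by rw [e₂]; exact h₂.1) (hβ q₁ h₁.2).2.1
      (hβ q₂ h₂.2).2.1 s hs
    rwa [e₁, e₂] at this

end Trajectories

/-! ### The equation satisfied by the derivative of a solution -/

section Lift

set_option maxSynthPendingDepth 5

variable {E : Type*} [NormedAddCommGroup E] [NormedSpace ℝ E]
variable {E' : Type*} [NormedAddCommGroup E'] [NormedSpace ℝ E']
variable {F : Type*} [NormedAddCommGroup F] [NormedSpace ℝ F]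
variable {V : Type*} [NormedAddCommGroup V] [NormedSpace ℝ V]

/-- Precomposition with the inverse of the coordinates `e`. -/
def preCoord (e : E ≃L[ℝ] E') (F : Type*) [NormedAddCommGroup F] [NormedSpace ℝ F] :
    (E →L[ℝ] F) →L[ℝ] (E' →L[ℝ] F) :=
  (ContinuousLinearMap.compL ℝ E' E F).flip (e.symm : E' →L[ℝ] E)

theorem preCoord_apply (e : E ≃L[ℝ] E') (L : E →L[ℝ] F) (ξ : E') :
    preCoord e F L ξ = L (e.symm ξ) := rfl

/-- The derivative of `u`, expressed in the coordinates `e`. -/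
def coordDeriv (e : E ≃L[ℝ] E') (u : E → F) : E → E' →L[ℝ] F := fun x =>
  preCoord e F (fderiv ℝ u x)

theorem coordDeriv_apply (e : E ≃L[ℝ] E') (u : E → F) (x : E) (ξ : E') :
    coordDeriv e u x ξ = fderiv ℝ u x (e.symm ξ) := rfl

theorem fderiv_eq_preCoord_coordDeriv (e : E ≃L[ℝ] E') (u : E → F) :
    fderiv ℝ u = preCoord e.symm F ∘ coordDeriv e u := by
  funext x
  ext y
  simp [preCoord_apply, coordDeriv_apply]

/-- Conjugation by the coordinates `e`, as a continuous linear map. -/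
def inCoordsL (e : E ≃L[ℝ] E') : (E →L[ℝ] E) →L[ℝ] (E' →L[ℝ] E') :=
  (ContinuousLinearMap.compL ℝ E' E E' (e : E →L[ℝ] E')).comp (preCoord e E)

/-- The zeroth order coefficient of the equation satisfied by the derivative of a solution. -/
def liftCoeff (e : E ≃L[ℝ] E') (X : E → E) (A : E → V →L[ℝ] V) :
    E → (E' →L[ℝ] V) →L[ℝ] (E' →L[ℝ] V) := fun x =>
  ContinuousLinearMap.compL ℝ E' V V (A x) +
    (ContinuousLinearMap.compL ℝ E' E' V).flip (inCoordsL e (fderiv ℝ X x))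

theorem liftCoeff_apply (e : E ≃L[ℝ] E') (X : E → E) (A : E → V →L[ℝ] V) (x : E)
    (w : E' →L[ℝ] V) :
    liftCoeff e X A x w = (A x).comp w + w.comp (inCoords e (fderiv ℝ X x)) := rfl

/-- The flip of arguments, as a bilinear pairing. -/
def flipPairing (E' V : Type*) [NormedAddCommGroup E'] [NormedSpace ℝ E'] [NormedAddCommGroup V]
    [NormedSpace ℝ V] : (E' →L[ℝ] V →L[ℝ] V) →L[ℝ] V →L[ℝ] E' →L[ℝ] V :=
  (ContinuousLinearMap.flipₗᵢ ℝ E' V V : _ →L[ℝ] _)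

theorem flipPairing_apply (a : E' →L[ℝ] V →L[ℝ] V) (v : V) (ξ : E') :
    flipPairing E' V a v ξ = a ξ v := rfl

/-- Postcomposition with A and precomposition with DX contribute independently, so the rates a and c
add. This gain of c compensates the order of vanishing lost in differentiating. -/
theorem norm_smul_id_sub_liftCoeff_le {e : E ≃L[ℝ] E'} {X : E → E} {A : E → V →L[ℝ] V} {x : E}
    {l a Λ c : ℝ} (hA : ‖l • ContinuousLinearMap.id ℝ V - A x‖ ≤ l - a)
    (hX : ‖Λ • ContinuousLinearMap.id ℝ E' - inCoords e (fderiv ℝ X x)‖ ≤ Λ - c) :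
    ‖(l + Λ) • ContinuousLinearMap.id ℝ (E' →L[ℝ] V) - liftCoeff e X A x‖ ≤
      (l + Λ) - (a + c) := by
  have h0 : 0 ≤ (l + Λ) - (a + c) := by
    have h1 := (norm_nonneg _).trans hA
    have h2 := (norm_nonneg _).trans hX
    linarith
  refine ContinuousLinearMap.opNorm_le_bound _ h0 fun w => ?_
  have h1 : ((l + Λ) • ContinuousLinearMap.id ℝ (E' →L[ℝ] V) - liftCoeff e X A x) w =
      (l • ContinuousLinearMap.id ℝ V - A x).comp w +
        w.comp (Λ • ContinuousLinearMap.id ℝ E' - inCoords e (fderiv ℝ X x)) := by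
    ext ξ
    simp only [_root_.sub_apply, _root_.smul_apply, ContinuousLinearMap.id_apply, liftCoeff_apply,
      _root_.add_apply, ContinuousLinearMap.comp_apply, map_sub, map_smul]
    module
  rw [h1]
  calc _ ≤ ‖(l • ContinuousLinearMap.id ℝ V - A x).comp w‖ +
        ‖w.comp (Λ • ContinuousLinearMap.id ℝ E' - inCoords e (fderiv ℝ X x))‖ := norm_add_le _ _
    _ ≤ (l - a) * ‖w‖ + ‖w‖ * (Λ - c) :=
      add_le_add ((ContinuousLinearMap.opNorm_comp_le _ _).trans (by gcongr))
        ((ContinuousLinearMap.opNorm_comp_le _ _).trans (by gcongr))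
    _ = _ := by ring

theorem norm_liftCoeff_sub_le (e : E ≃L[ℝ] E') (X : E → E) (A : E → V →L[ℝ] V) (x y : E) :
    ‖liftCoeff e X A x - liftCoeff e X A y‖ ≤
      ‖A x - A y‖ + ‖inCoords e (fderiv ℝ X x - fderiv ℝ X y)‖ := by
  refine ContinuousLinearMap.opNorm_le_bound _ (by positivity) fun w => ?_
  have h1 : (liftCoeff e X A x - liftCoeff e X A y) w =
      (A x - A y).comp w + w.comp (inCoords e (fderiv ℝ X x - fderiv ℝ X y)) := by
    ext ξ
    simp only [_root_.sub_apply, liftCoeff_apply, _root_.add_apply, inCoords,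
      ContinuousLinearMap.comp_apply, map_sub]
    abel
  rw [h1]
  calc _ ≤ ‖(A x - A y).comp w‖ + ‖w.comp (inCoords e (fderiv ℝ X x - fderiv ℝ X y))‖ :=
        norm_add_le _ _
    _ ≤ ‖A x - A y‖ * ‖w‖ + ‖w‖ * ‖inCoords e (fderiv ℝ X x - fderiv ℝ X y)‖ :=
      add_le_add (ContinuousLinearMap.opNorm_comp_le _ _) (ContinuousLinearMap.opNorm_comp_le _ _)
    _ = _ := by ring

/-- Postcomposition, as a linear map from endomorphisms of `V` to those of `E' →L[ℝ] V`. -/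
def postL (E' V : Type*) [NormedAddCommGroup E'] [NormedSpace ℝ E'] [NormedAddCommGroup V]
    [NormedSpace ℝ V] : (V →L[ℝ] V) →L[ℝ] (E' →L[ℝ] V) →L[ℝ] (E' →L[ℝ] V) :=
  ContinuousLinearMap.compL ℝ E' V V

/-- Precomposition, as a linear map from endomorphisms of `E` to those of `E' →L[ℝ] V`. -/
def preL (e : E ≃L[ℝ] E') (V : Type*) [NormedAddCommGroup V] [NormedSpace ℝ V] :
    (E →L[ℝ] E) →L[ℝ] (E' →L[ℝ] V) →L[ℝ] (E' →L[ℝ] V) :=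
  ((ContinuousLinearMap.compL ℝ E' E' V).flip).comp (inCoordsL e)

theorem liftCoeff_eq (e : E ≃L[ℝ] E') (X : E → E) (A : E → V →L[ℝ] V) :
    liftCoeff e X A = fun x => postL E' V (A x) + preL e V (fderiv ℝ X x) := rfl

variable {U : Set E}

theorem contDiffOn_fderiv {n : ℕ∞} {u : E → F} (hU : IsOpen U) (hu : ContDiffOn ℝ (n + 1 : ℕ∞) u U) :
    ContDiffOn ℝ n (fderiv ℝ u) U :=
  hu.fderiv_of_isOpen hU (by exact_mod_cast le_rfl)

theorem contDiffOn_coordDeriv (e : E ≃L[ℝ] E') {n : ℕ∞} {u : E → F} (hU : IsOpen U)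
    (hu : ContDiffOn ℝ (n + 1 : ℕ∞) u U) : ContDiffOn ℝ n (coordDeriv e u) U :=
  (preCoord e F).contDiff.comp_contDiffOn (contDiffOn_fderiv hU hu)

theorem contDiffOn_liftCoeff (e : E ≃L[ℝ] E') {n : ℕ∞} {X : E → E} {A : E → V →L[ℝ] V}
    (hU : IsOpen U) (hX : ContDiffOn ℝ (n + 1 : ℕ∞) X U) (hA : ContDiffOn ℝ n A U) :
    ContDiffOn ℝ n (liftCoeff e X A) U := by
  rw [liftCoeff_eq]
  exact ((postL E' V).contDiff.comp_contDiffOn hA).add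
    ((preL e V).contDiff.comp_contDiffOn (contDiffOn_fderiv hU hX))

/-- The derivative of a solution solves the lifted equation. -/
theorem lifted_equation (e : E ≃L[ℝ] E') {X : E → E} {A : E → V →L[ℝ] V} {u v : E → V}
    (hU : IsOpen U) (hX : ContDiffOn ℝ ∞ X U) (hA : ContDiffOn ℝ ∞ A U) (hu : ContDiffOn ℝ ∞ u U)
    (h : ∀ x ∈ U, fderiv ℝ u x (X x) + A x (u x) = v x) :
    ∀ x ∈ U, fderiv ℝ (coordDeriv e u) x (X x) + liftCoeff e X A x (coordDeriv e u x) =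
      coordDeriv e v x - flipPairing E' V (coordDeriv e A x) (u x) := by
  intro x hx
  have hxU := hU.mem_nhds hx
  have hXd : HasFDerivAt X (fderiv ℝ X x) x :=
    ((hX.contDiffAt hxU).differentiableAt (by simp)).hasFDerivAt
  have hAd : HasFDerivAt A (fderiv ℝ A x) x :=
    ((hA.contDiffAt hxU).differentiableAt (by simp)).hasFDerivAt
  have hud : HasFDerivAt u (fderiv ℝ u x) x :=
    ((hu.contDiffAt hxU).differentiableAt (by simp)).hasFDerivAt
  have hu2 : HasFDerivAt (fderiv ℝ u) (fderiv ℝ (fderiv ℝ u) x) x :=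
    (((hu.fderiv_of_isOpen hU (m := ∞) (by simp)).contDiffAt hxU).differentiableAt
      (by simp)).hasFDerivAt
  -- Differentiating Du(X) in direction ξ produces D²u(ξ, X). By symmetry this is the derivative of
  -- Du along X, evaluated at ξ.
  have hsymm : IsSymmSndFDerivAt ℝ u x := (hu.contDiffAt hxU).isSymmSndFDerivAt
    (by simp only [minSmoothness_of_isRCLikeNormedField]; exact WithTop.coe_le_coe.2 (le_top : (2 : ℕ∞) ≤ ⊤))
  have hvd : HasFDerivAt v _ x :=
    ((hu2.clm_apply hXd).add (hAd.clm_apply hud)).congr_of_eventuallyEq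
      (eventually_of_mem hxU fun y hy => (h y hy).symm)
  have hcd : fderiv ℝ (coordDeriv e u) x = (preCoord e V).comp (fderiv ℝ (fderiv ℝ u) x) :=
    ((preCoord e V).hasFDerivAt.comp x hu2).fderiv
  ext ξ
  rw [hcd, _root_.add_apply, _root_.sub_apply, liftCoeff_apply, coordDeriv_apply, hvd.fderiv]
  have hs := hsymm (X x) (e.symm ξ)
  simp only [ContinuousLinearMap.comp_apply, preCoord_apply, _root_.add_apply, coordDeriv_apply,
    flipPairing_apply, inCoords, ContinuousLinearMap.flip_apply, ContinuousLinearEquiv.coe_coe,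
    ContinuousLinearEquiv.symm_apply_apply, hs]
  abel

end Lift

/-! ### Bounds weighted by powers of the distance to the source -/

section Weighted

set_option maxSynthPendingDepth 5

variable {E : Type*} [NormedAddCommGroup E] [NormedSpace ℝ E]
variable {E' : Type*} [NormedAddCommGroup E'] [NormedSpace ℝ E']
variable {F : Type*} [NormedAddCommGroup F] [NormedSpace ℝ F]
variable {G : Type*} [NormedAddCommGroup G] [NormedSpace ℝ G]
variable {H : Type*} [NormedAddCommGroup H] [NormedSpace ℝ H]

/-- The derivatives of `f` up to order `k` are bounded on `Z` by the powers of the distance to `p`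
that one expects if `f` vanishes to order `N` at `p`. -/
def WeightedBound (Z : Set E) (p : E) (k N : ℕ) (K : ℝ) (f : E → F) : Prop :=
  ∀ j ≤ k, ∀ x ∈ Z, ‖iteratedFDeriv ℝ j f x‖ ≤ K * ‖x - p‖ ^ (N - j)

variable {U Z : Set E} {p : E} {k N : ℕ} {K M : ℝ}

namespace WeightedBound

theorem norm_le {f : E → F} (h : WeightedBound Z p k N K f) {x : E} (hx : x ∈ Z) :
    ‖f x‖ ≤ K * ‖x - p‖ ^ N := by
  simpa using h 0 (Nat.zero_le _) x hx

theorem of_norm_le {f : E → F} (h : ∀ x ∈ Z, ‖f x‖ ≤ K * ‖x - p‖ ^ N) :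
    WeightedBound Z p 0 N K f := by
  intro j hj x hx
  obtain rfl : j = 0 := by omega
  simpa using h x hx

theorem mono_order {f : E → F} {k' : ℕ} (h : WeightedBound Z p k N K f) (hk : k' ≤ k) :
    WeightedBound Z p k' N K f := fun j hj => h j (hj.trans hk)

theorem mono_const {f : E → F} {K' : ℝ} (h : WeightedBound Z p k N K f) (hK : K ≤ K') :
    WeightedBound Z p k N K' f := fun j hj x hx =>
  (h j hj x hx).trans (by gcongr)

theorem mono_set {f : E → F} {Z' : Set E} (h : WeightedBound Z p k N K f) (hZ : Z' ⊆ Z) :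
    WeightedBound Z' p k N K f := fun j hj x hx => h j hj x (hZ hx)

/-- On a set of radius M, lowering the exponent by at most l costs at most M^l. This absorbs the
discrepancies caused by truncated exponents N - j. -/
theorem pow_le_of_le {r : ℝ} {m n l : ℕ} (hr : 0 ≤ r) (hrM : r ≤ M) (hM : 1 ≤ M) (h : m ≤ n)
    (hl : n - m ≤ l) : r ^ n ≤ M ^ l * r ^ m := by
  obtain ⟨d, rfl⟩ := Nat.exists_eq_add_of_le h
  rw [pow_add, mul_comm]
  gcongr
  exact (pow_le_pow_left₀ hr hrM d).trans (pow_le_pow_right₀ hM (by omega))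

theorem pred {f : E → F} (h : WeightedBound Z p k N K f) (hK : 0 ≤ K) (hM : 1 ≤ M)
    (hZ : ∀ x ∈ Z, ‖x - p‖ ≤ M) : WeightedBound Z p k (N - 1) (K * M) f := by
  intro j hj x hx
  refine (h j hj x hx).trans ?_
  rw [mul_assoc]
  gcongr
  have := pow_le_of_le (l := 1) (norm_nonneg (x - p)) (hZ x hx) hM
    (show N - 1 - j ≤ N - j by omega) (by omega)
  simpa using this

theorem sub {f g : E → F} {K' : ℝ} (hU : IsOpen U) (hZ : Z ⊆ U) (hf : ContDiffOn ℝ k f U)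
    (hg : ContDiffOn ℝ k g U)
    (h : WeightedBound Z p k N K f) (h' : WeightedBound Z p k N K' g) :
    WeightedBound Z p k N (K + K') (fun x => f x - g x) := by
  intro j hj x hx
  have hxU := hU.mem_nhds (hZ hx)
  have hf' : ContDiffAt ℝ j f x := (hf.contDiffAt hxU).of_le (by exact_mod_cast hj)
  have hg' : ContDiffAt ℝ j g x := (hg.contDiffAt hxU).of_le (by exact_mod_cast hj)
  have : iteratedFDeriv ℝ j (fun x => f x - g x) x =
      iteratedFDeriv ℝ j f x - iteratedFDeriv ℝ j g x := iteratedFDeriv_sub_apply hf' hg'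
  rw [this, add_mul]
  exact (norm_sub_le _ _).trans (add_le_add (h j hj x hx) (h' j hj x hx))

end WeightedBound

theorem norm_iteratedFDeriv_clm_comp_le (L : F →L[ℝ] G) {f : E → F} {n : ℕ} {x : E}
    (hf : ContDiffAt ℝ n f x) :
    ‖iteratedFDeriv ℝ n (fun y => L (f y)) x‖ ≤ ‖L‖ * ‖iteratedFDeriv ℝ n f x‖ :=
  L.norm_iteratedFDeriv_comp_left hf le_rfl

theorem norm_iteratedFDeriv_bilinear_le (B : F →L[ℝ] G →L[ℝ] H) {f : E → F} {g : E → G} {n : ℕ}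
    (hU : IsOpen U) (hf : ContDiffOn ℝ n f U) (hg : ContDiffOn ℝ n g U) {x : E} (hx : x ∈ U) :
    ‖iteratedFDeriv ℝ n (fun y => B (f y) (g y)) x‖ ≤ ‖B‖ * ∑ i ∈ Finset.range (n + 1),
      (n.choose i : ℝ) * ‖iteratedFDeriv ℝ i f x‖ * ‖iteratedFDeriv ℝ (n - i) g x‖ := by
  have h := B.norm_iteratedFDerivWithin_le_of_bilinear hf hg hU.uniqueDiffOn hx le_rfl
  simpa only [iteratedFDerivWithin_of_isOpen _ hU hx] using h

/-- In the Leibniz formula, derivatives falling on f leave g with a power of the distance at least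
as high as needed. The excess is at most k powers, whence M^k. -/
theorem WeightedBound.bilinear (B : F →L[ℝ] G →L[ℝ] H) {f : E → F} {g : E → G} {M' : ℝ}
    (hU : IsOpen U) (hZ : Z ⊆ U) (hf : ContDiffOn ℝ k f U) (hg : ContDiffOn ℝ k g U)
    (hK : 0 ≤ K) (hM : 1 ≤ M) (hZM : ∀ x ∈ Z, ‖x - p‖ ≤ M)
    (hfM : ∀ j ≤ k, ∀ x ∈ Z, ‖iteratedFDeriv ℝ j f x‖ ≤ M') (h : WeightedBound Z p k N K g) :
    WeightedBound Z p k N (‖B‖ * (2 ^ k * M' * M ^ k) * K) (fun x => B (f x) (g x)) := by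
  intro j hj x hx
  have hM' : 0 ≤ M' := (norm_nonneg _).trans (hfM j hj x hx)
  refine (norm_iteratedFDeriv_bilinear_le B hU (hf.of_le (by exact_mod_cast hj))
    (hg.of_le (by exact_mod_cast hj)) (hZ hx)).trans ?_
  have h1 : ∀ i ∈ Finset.range (j + 1), (j.choose i : ℝ) * ‖iteratedFDeriv ℝ i f x‖ *
      ‖iteratedFDeriv ℝ (j - i) g x‖ ≤ j.choose i * (M' * (K * (M ^ k * ‖x - p‖ ^ (N - j)))) := by
    intro i hi
    have hi' : i ≤ j := by simpa [Nat.lt_succ_iff] using hi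
    rw [mul_assoc]
    gcongr
    · exact hfM i (hi'.trans hj) x hx
    · refine (h (j - i) (by omega) x hx).trans ?_
      gcongr
      exact WeightedBound.pow_le_of_le (norm_nonneg _) (hZM x hx) hM (by omega) (by omega)
  calc _ ≤ ‖B‖ * ∑ i ∈ Finset.range (j + 1),
        (j.choose i * (M' * (K * (M ^ k * ‖x - p‖ ^ (N - j)))) : ℝ) := by
        exact mul_le_mul_of_nonneg_left (Finset.sum_le_sum h1) (norm_nonneg _)
    _ = ‖B‖ * (2 ^ j * (M' * (K * (M ^ k * ‖x - p‖ ^ (N - j))))) := by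
        rw [← Finset.sum_mul]
        congr 2
        exact_mod_cast Nat.sum_range_choose j
    _ ≤ ‖B‖ * (2 ^ k * (M' * (K * (M ^ k * ‖x - p‖ ^ (N - j))))) := by
        gcongr
        norm_num
    _ = _ := by ring

theorem norm_iteratedFDeriv_coordDeriv_le (e : E ≃L[ℝ] E') {f : E → F} {j : ℕ} {x : E}
    (hU : IsOpen U) (hx : x ∈ U) (hf : ContDiffOn ℝ (j + 1 : ℕ) f U) :
    ‖iteratedFDeriv ℝ j (coordDeriv e f) x‖ ≤ ‖preCoord e F‖ * ‖iteratedFDeriv ℝ (j + 1) f x‖ := by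
  rw [← norm_iteratedFDeriv_fderiv]
  exact norm_iteratedFDeriv_clm_comp_le _
    ((contDiffOn_fderiv (n := j) hU (by exact_mod_cast hf)).contDiffAt (hU.mem_nhds hx))

theorem norm_iteratedFDeriv_succ_le (e : E ≃L[ℝ] E') {f : E → F} {j : ℕ} {x : E}
    (hU : IsOpen U) (hx : x ∈ U) (hf : ContDiffOn ℝ (j + 1 : ℕ) f U) :
    ‖iteratedFDeriv ℝ (j + 1) f x‖ ≤
      ‖preCoord e.symm F‖ * ‖iteratedFDeriv ℝ j (coordDeriv e f) x‖ := by
  rw [← norm_iteratedFDeriv_fderiv, fderiv_eq_preCoord_coordDeriv e]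
  exact norm_iteratedFDeriv_clm_comp_le _
    ((contDiffOn_coordDeriv (n := j) e hU (by exact_mod_cast hf)).contDiffAt (hU.mem_nhds hx))

theorem WeightedBound.coordDeriv (e : E ≃L[ℝ] E') {f : E → F} (hU : IsOpen U) (hZ : Z ⊆ U)
    (hf : ContDiffOn ℝ (k + 1 : ℕ) f U) (h : WeightedBound Z p (k + 1) N K f) :
    WeightedBound Z p k (N - 1) (‖preCoord e F‖ * K) (coordDeriv e f) := by
  intro j hj x hx
  refine (norm_iteratedFDeriv_coordDeriv_le e hU (hZ hx)
    (hf.of_le (by exact_mod_cast Nat.succ_le_succ hj))).trans ?_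
  rw [mul_assoc, show N - 1 - j = N - (j + 1) by omega]
  gcongr
  exact h (j + 1) (by omega) x hx

theorem WeightedBound.of_coordDeriv (e : E ≃L[ℝ] E') {f : E → F} {K' : ℝ} (hU : IsOpen U)
    (hZ : Z ⊆ U) (hf : ContDiffOn ℝ (k + 1 : ℕ) f U) (h : WeightedBound Z p 0 N K f)
    (h' : WeightedBound Z p k (N - 1) K' (SingularTransport.coordDeriv e f)) :
    WeightedBound Z p (k + 1) N (max K (‖preCoord e.symm F‖ * K')) f := by
  rintro (_ | j) hj x hx
  · exact (h 0 le_rfl x hx).trans (by gcongr; exact le_max_left _ _)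
  · refine (norm_iteratedFDeriv_succ_le e hU (hZ hx) (hf.of_le (by exact_mod_cast hj))).trans ?_
    calc _ ≤ ‖preCoord e.symm F‖ * (K' * ‖x - p‖ ^ (N - 1 - j)) := by
          gcongr
          exact h' j (by omega) x hx
      _ = (‖preCoord e.symm F‖ * K') * ‖x - p‖ ^ (N - (j + 1)) := by
          rw [mul_assoc, show N - 1 - j = N - (j + 1) by omega]
      _ ≤ _ := by
          gcongr
          exact le_max_right _ _

/-- Taylor's theorem in the form of weighted bounds. -/
theorem weightedBound_of_iteratedFDeriv_eq_zero {f : E → F} {r : ℝ} (hU : IsOpen U)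
    (hf : ContDiffOn ℝ ∞ f U) (hr : 0 < r) (hr1 : r ≤ 1) (hrU : Metric.ball p r ⊆ U)
    (h0 : ∀ j < N, iteratedFDeriv ℝ j f p = 0)
    (hB : ∀ j ≤ N, ∀ x ∈ Metric.ball p r, ‖iteratedFDeriv ℝ j f x‖ ≤ K)
    (hZB : ∀ j ≤ k, ∀ x ∈ Z, ‖iteratedFDeriv ℝ j f x‖ ≤ K) :
    WeightedBound Z p k N (K / r ^ N) f := by
  have hK : 0 ≤ K := (norm_nonneg _).trans (hB 0 (Nat.zero_le _) p (Metric.mem_ball_self hr))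
  have hKr : K ≤ K / r ^ N := by
    rw [le_div_iff₀ (by positivity)]
    exact mul_le_of_le_one_right hK (pow_le_one₀ hr.le hr1)
  -- Descending from the N-th derivative: each application of the mean value inequality lowers the
  -- order of differentiation by one and gains one power of the distance, since the derivative
  -- vanishes at p.
  have key : ∀ i ≤ N, ∀ x ∈ Metric.ball p r,
      ‖iteratedFDeriv ℝ (N - i) f x‖ ≤ K * ‖x - p‖ ^ i := by
    intro i
    induction i with
    | zero => intro _ x hx; simpa using hB N le_rfl x hx
    | succ i ih =>
      intro hi x hx
      have hsub : Metric.closedBall p ‖x - p‖ ⊆ Metric.ball p r := by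
        apply Metric.closedBall_subset_ball
        simpa [dist_eq_norm] using hx
      have hd : ∀ y ∈ Metric.closedBall p ‖x - p‖,
          DifferentiableAt ℝ (iteratedFDeriv ℝ (N - (i + 1)) f) y := fun y hy =>
        (hf.contDiffAt (hU.mem_nhds (hrU (hsub hy)))).differentiableAt_iteratedFDeriv
          (WithTop.coe_lt_coe.2 (ENat.natCast_lt_top _))
      have hb : ∀ y ∈ Metric.closedBall p ‖x - p‖,
          ‖fderiv ℝ (iteratedFDeriv ℝ (N - (i + 1)) f) y‖ ≤ K * ‖x - p‖ ^ i := by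
        intro y hy
        rw [norm_fderiv_iteratedFDeriv, show N - (i + 1) + 1 = N - i by omega]
        refine (ih (by omega) y (hsub hy)).trans ?_
        gcongr
        simpa [dist_eq_norm] using hy
      have hmv := (convex_closedBall p ‖x - p‖).norm_image_sub_le_of_norm_fderiv_le hd hb
        (Metric.mem_closedBall_self (norm_nonneg _)) (show x ∈ _ by simp [dist_eq_norm])
      rw [h0 _ (by omega), sub_zero] at hmv
      exact hmv.trans_eq (by rw [pow_succ]; ring)
  intro j hj x hx
  by_cases hxr : x ∈ Metric.ball p r
  · rcases le_or_gt j N with hjN | hjN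
    · have := key (N - j) (Nat.sub_le _ _) x hxr
      rw [Nat.sub_sub_self hjN] at this
      exact this.trans (by gcongr)
    · rw [Nat.sub_eq_zero_of_le hjN.le, pow_zero, mul_one]
      exact (hZB j hj x hx).trans hKr
  -- Away from p the weight is bounded below: r^N ≤ ‖x - p‖^(N - j), because r ≤ 1.
  · have hxr' : r ≤ ‖x - p‖ := by simpa [dist_eq_norm] using hxr
    refine (hZB j hj x hx).trans ?_
    rw [div_mul_eq_mul_div, le_div_iff₀ (by positivity)]
    gcongr
    calc r ^ N ≤ r ^ (N - j) := pow_le_pow_of_le_one hr.le hr1 (Nat.sub_le _ _)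
      _ ≤ _ := by gcongr

end Weighted

/-! ### Quantitative estimates for all derivatives of flat solutions -/

section Estimate

set_option maxSynthPendingDepth 5

universe u

variable {E : Type} [NormedAddCommGroup E] [NormedSpace ℝ E]
variable {E' : Type} [NormedAddCommGroup E'] [NormedSpace ℝ E']
variable {V : Type u} [NormedAddCommGroup V] [NormedSpace ℝ V]

/-- Quantitative control, on a set `Z` attracted by `p`, of the coefficients of a transport
equation. -/
structure TransportControl (e : E ≃L[ℝ] E') (U Z : Set E) (p : E) (X : E → E) (A : E → V →L[ℝ] V)
    (k : ℕ) (M C l a Λ c : ℝ) : Prop where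
  isOpen : IsOpen U
  subset : Z ⊆ U
  smoothX : ContDiffOn ℝ ∞ X U
  smoothA : ContDiffOn ℝ ∞ A U
  attracted : ∀ x ∈ Z, ∃ β : ℝ → E, β 0 = x ∧ IsBackwardCurve X β ∧ ∀ s, 0 ≤ s →
    β s ∈ Z ∧ ‖β s - p‖ ≤ C * Real.exp (-c * s) * ‖x - p‖
  norm_sub_le : ∀ x ∈ Z, ‖x - p‖ ≤ M
  boundA : ∀ j ≤ k, ∀ x ∈ Z, ‖iteratedFDeriv ℝ j A x‖ ≤ M
  lipA : ∀ x ∈ Z, ‖A x - A p‖ ≤ M * ‖x - p‖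
  lipX : ∀ x ∈ Z, ‖fderiv ℝ X x - fderiv ℝ X p‖ ≤ M * ‖x - p‖
  boundX : ∀ j ≤ k + 1, ∀ x ∈ Z, ‖iteratedFDeriv ℝ j X x‖ ≤ M
  dampA : ‖l • ContinuousLinearMap.id ℝ V - A p‖ ≤ l - a
  dampX : ‖Λ • ContinuousLinearMap.id ℝ E' - inCoords e (fderiv ℝ X p)‖ ≤ Λ - c

theorem norm_damping_le {l a : ℝ} {A B : V →L[ℝ] V}
    (h : ‖l • ContinuousLinearMap.id ℝ V - B‖ ≤ l - a) :
    ‖l • ContinuousLinearMap.id ℝ V - A‖ ≤ l - a + ‖A - B‖ := by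
  rw [show l • ContinuousLinearMap.id ℝ V - A = (l • ContinuousLinearMap.id ℝ V - B) - (A - B) by
    abel]
  exact (norm_sub_le _ _).trans (by gcongr)

theorem pow_decay_le {C c s r t : ℝ} (N : ℕ) (hr : 0 ≤ r) (h : r ≤ C * Real.exp (-c * s) * t) :
    r ^ N ≤ C ^ N * t ^ N * Real.exp (-(c * N) * s) := by
  calc r ^ N ≤ (C * Real.exp (-c * s) * t) ^ N := pow_le_pow_left₀ hr h N
    _ = _ := by
      rw [mul_pow, mul_pow, ← Real.exp_nat_mul, show (N : ℝ) * (-c * s) = -(c * N) * s by ring]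
      ring

variable {e : E ≃L[ℝ] E'} {U Z : Set E} {p : E} {X : E → E} {A : E → V →L[ℝ] V} {k : ℕ}
  {M C l a Λ c : ℝ}

/-- A constant controlling the coefficients of the lifted equation. -/
def liftConst (e : E ≃L[ℝ] E') (V : Type u) [NormedAddCommGroup V] [NormedSpace ℝ V] (M : ℝ) : ℝ :=
  M * (1 + ‖postL E' V‖ + ‖preL e V‖ + ‖(e : E →L[ℝ] E')‖ * ‖(e.symm : E' →L[ℝ] E)‖)

theorem le_liftConst (e : E ≃L[ℝ] E') (hM : 0 ≤ M) : M ≤ liftConst e V M := by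
  rw [liftConst]
  refine le_mul_of_one_le_right hM ?_
  have h1 := norm_nonneg (postL E' V)
  have h2 := norm_nonneg (preL e V)
  have h3 : 0 ≤ ‖(e : E →L[ℝ] E')‖ * ‖(e.symm : E' →L[ℝ] E)‖ := by positivity
  linarith

/-- Control passes to the lifted equation at the price of one derivative and a larger constant; the
attracted set and its constant C stay the same. -/
theorem TransportControl.lift (h : TransportControl e U Z p X A (k + 1) M C l a Λ c)
    (hM : 0 ≤ M) :
    TransportControl e U Z p X (liftCoeff e X A) k (liftConst e V M) C (l + Λ) (a + c) Λ c where
  isOpen := h.isOpen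
  subset := h.subset
  smoothX := h.smoothX
  smoothA := contDiffOn_liftCoeff (n := ⊤) e h.isOpen (by simpa using h.smoothX) h.smoothA
  attracted := h.attracted
  norm_sub_le := fun x hx => (h.norm_sub_le x hx).trans (le_liftConst e hM)
  boundA := by
    intro j hj x hx
    have hxU := h.isOpen.mem_nhds (h.subset hx)
    have hA : ContDiffAt ℝ j A x := (h.smoothA.contDiffAt hxU).of_le (by exact_mod_cast le_top)
    have hX : ContDiffAt ℝ j (fderiv ℝ X) x :=
      ((h.smoothX.fderiv_of_isOpen h.isOpen (m := ∞) (by simp)).contDiffAt hxU).of_le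
        (by exact_mod_cast le_top)
    have h1 : iteratedFDeriv ℝ j (liftCoeff e X A) x =
        iteratedFDeriv ℝ j (fun x => postL E' V (A x)) x +
          iteratedFDeriv ℝ j (fun x => preL e V (fderiv ℝ X x)) x :=
      iteratedFDeriv_add_apply ((postL E' V).contDiff.contDiffAt.comp x hA)
        ((preL e V).contDiff.contDiffAt.comp x hX)
    have h2 := norm_iteratedFDeriv_clm_comp_le (postL E' V) hA
    have h3 := norm_iteratedFDeriv_clm_comp_le (preL e V) hX
    rw [norm_iteratedFDeriv_fderiv] at h3
    have h4 := h.boundA j (by omega) x hx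
    have h5 := h.boundX (j + 1) (by omega) x hx
    have h6 : 0 ≤ ‖(e : E →L[ℝ] E')‖ * ‖(e.symm : E' →L[ℝ] E)‖ := by positivity
    rw [h1, liftConst]
    calc _ ≤ ‖postL E' V‖ * M + ‖preL e V‖ * M := by
          refine (norm_add_le _ _).trans (add_le_add (h2.trans ?_) (h3.trans ?_))
          · exact mul_le_mul_of_nonneg_left h4 (norm_nonneg _)
          · exact mul_le_mul_of_nonneg_left h5 (norm_nonneg _)
      _ ≤ _ := by nlinarith
  lipA := by
    intro x hx
    refine (norm_liftCoeff_sub_le e X A x p).trans ?_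
    have h2 := (norm_inCoords_le e (fderiv ℝ X x - fderiv ℝ X p)).trans
      (mul_le_mul_of_nonneg_left (h.lipX x hx) (by positivity))
    have h3 := h.lipA x hx
    have h4 := norm_nonneg (postL E' V)
    have h5 := norm_nonneg (preL e V)
    calc _ ≤ M * (1 + 0 + 0 + ‖(e : E →L[ℝ] E')‖ * ‖(e.symm : E' →L[ℝ] E)‖) * ‖x - p‖ := by
          linarith
      _ ≤ _ := by rw [liftConst]; gcongr
  lipX := fun x hx => (h.lipX x hx).trans (by gcongr; exact le_liftConst e hM)
  boundX := fun j hj x hx => (h.boundX j (by omega) x hx).trans (le_liftConst e hM)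
  dampA := norm_smul_id_sub_liftCoeff_le h.dampA h.dampX
  dampX := h.dampX

theorem TransportControl.mono (h : TransportControl e U Z p X A (k + 1) M C l a Λ c) :
    TransportControl e U Z p X A k M C l a Λ c :=
  { h with
    boundA := fun j hj => h.boundA j (by omega)
    boundX := fun j hj => h.boundX j (by omega) }

/-- The equation along a backward trajectory. -/
theorem hasDerivWithinAt_along {u v : E → V} {β : ℝ → E} (hβ : IsBackwardCurve X β) {s : ℝ}
    (hs : 0 ≤ s) (hu : DifferentiableAt ℝ u (β s))
    (h : fderiv ℝ u (β s) (X (β s)) + A (β s) (u (β s)) = v (β s)) :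
    HasDerivWithinAt (fun s => u (β s)) (A (β s) (u (β s)) - v (β s)) (Ici 0) s := by
  have h1 := hu.hasFDerivAt.comp_hasDerivWithinAt s (hβ s hs)
  refine h1.congr_deriv ?_
  rw [map_neg, ← h]
  abel

/-- Along the backward trajectory from x, vanishing of v to order N becomes decay at rate κ = cN.
The Lipschitz bound for A makes the deviation from A p a transient with D = M(CM). The estimate is
then read off at time 0. -/
theorem TransportControl.norm_le (h : TransportControl e U Z p X A k M C l a Λ c) {N : ℕ}
    (hM : 0 ≤ M) (hC : 0 ≤ C) (hc : 0 < c) (haN : 0 < a + c * N) {K : ℝ} (hK : 0 ≤ K)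
    {u v : E → V}
    (hu : ContDiffOn ℝ ∞ u U) (huv : ∀ x ∈ U, fderiv ℝ u x (X x) + A x (u x) = v x)
    (hu0 : ∃ K₀, WeightedBound Z p k N K₀ u) (hv : WeightedBound Z p k N K v) :
    WeightedBound Z p 0 N
      (2 * C ^ N / (a + c * N) * Real.exp (2 * (M * (C * M)) / c) * K) u := by
  refine WeightedBound.of_norm_le fun x hx => ?_
  obtain ⟨β, h0, hβ, hβZ⟩ := h.attracted x hx
  have hal : a ≤ l := by linarith [(norm_nonneg _).trans h.dampA]
  have key := norm_le_of_decaying_solution (Am := fun s => A (β s)) (z := fun s => u (β s))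
    (g := fun s => v (β s)) (l := l) (a := a) (κ := c * N) (c := c) (D := M * (C * M))
    (K := K * (C ^ N * ‖x - p‖ ^ N)) hc haN hal (by positivity)
    (fun s hs => hasDerivWithinAt_along hβ hs
      ((hu.contDiffAt (h.isOpen.mem_nhds (h.subset (hβZ s hs).1))).differentiableAt (by simp))
      (huv _ (h.subset (hβZ s hs).1)))
    (fun s hs => by
      refine (norm_damping_le h.dampA).trans ?_
      have h1 := h.lipA _ (hβZ s hs).1
      have h2 := (hβZ s hs).2
      have h3 := h.norm_sub_le x hx
      have : M * ‖β s - p‖ ≤ M * (C * M) * Real.exp (-c * s) := by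
        calc M * ‖β s - p‖ ≤ M * (C * Real.exp (-c * s) * M) := by gcongr; exact h2.trans (by gcongr)
          _ = _ := by ring
      linarith)
    (fun s hs => by
      refine (hv.norm_le (hβZ s hs).1).trans ?_
      rw [mul_assoc]
      gcongr
      exact pow_decay_le N (norm_nonneg _) (hβZ s hs).2)
    (by
      obtain ⟨K₀, hK₀⟩ := hu0
      refine ⟨|K₀| * (C ^ N * ‖x - p‖ ^ N), fun s hs => ?_⟩
      refine (hK₀.norm_le (hβZ s hs).1).trans ?_
      rw [mul_assoc]
      gcongr
      · exact le_abs_self _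
      · exact pow_decay_le N (norm_nonneg _) (hβZ s hs).2)
    0 le_rfl
  simp only [h0, mul_zero, Real.exp_zero, mul_one] at key
  refine key.trans_eq ?_
  ring

/-- The a priori estimate for solutions vanishing to order `N` at the source, with a constant that
depends only on the controlled quantities. -/
theorem exists_weighted_estimate (e : E ≃L[ℝ] E') (k : ℕ) :
    ∀ (V : Type u) [NormedAddCommGroup V] [NormedSpace ℝ V] (N : ℕ) (M C l a Λ c : ℝ),
      1 ≤ M → 0 ≤ C → 0 < c → 0 < a + c * N → ∃ Q : ℝ, 0 ≤ Q ∧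
        ∀ (U Z : Set E) (p : E) (X : E → E) (A : E → V →L[ℝ] V),
          TransportControl e U Z p X A k M C l a Λ c → ∀ (K : ℝ) (u v : E → V), 0 ≤ K →
          ContDiffOn ℝ ∞ u U → ContDiffOn ℝ ∞ v U →
          (∀ x ∈ U, fderiv ℝ u x (X x) + A x (u x) = v x) →
          (∃ K₀, WeightedBound Z p k N K₀ u) → WeightedBound Z p k N K v →
          WeightedBound Z p k N (Q * K) u := by
  -- The induction ranges over all V because the lifted equation takes values in E' →L[ℝ] V.
  induction k with
  | zero =>
    intro V _ _ N M C l a Λ c hM hC hc haN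
    refine ⟨2 * C ^ N / (a + c * N) * Real.exp (2 * (M * (C * M)) / c), by positivity, ?_⟩
    intro U Z p X A h K u v hK hu hv huv hu0 hvK
    exact h.norm_le (by linarith) hC hc haN hK hu huv hu0 hvK
  | succ k ih =>
    intro V _ _ N M C l a Λ c hM hC hc haN
    have hM0 : 0 ≤ M := by linarith
    obtain ⟨Q₀, hQ₀, H₀⟩ := ih V N M C l a Λ c hM hC hc haN
    -- For N ≥ 1 this is the old quantity a + cN. For N = 0 the truncated N - 1 is 0 and the
    -- quantity increases by c.
    have haN' : 0 < a + c + c * ((N - 1 : ℕ) : ℝ) := by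
      rcases N with _ | N
      · simp at haN ⊢; linarith
      · rw [Nat.add_sub_cancel]
        push_cast at haN
        linarith
    obtain ⟨Q₁, hQ₁, H₁⟩ := ih (E' →L[ℝ] V) (N - 1) (liftConst e V M) C (l + Λ) (a + c) Λ c
      (hM.trans (le_liftConst e hM0)) hC hc haN'
    set B : ℝ := ‖preCoord e V‖ +
      ‖flipPairing E' V‖ * (2 ^ k * (‖preCoord e (V →L[ℝ] V)‖ * M) * M ^ k) * Q₀ * M with hB
    have hB0 : 0 ≤ B := by
      have h1 := norm_nonneg (flipPairing E' V)
      have h2 := norm_nonneg (preCoord e V)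
      have h3 := norm_nonneg (preCoord e (V →L[ℝ] V))
      positivity
    refine ⟨max Q₀ (‖preCoord e.symm V‖ * (Q₁ * B)), le_max_of_le_left hQ₀, ?_⟩
    intro U Z p X A h K u v hK hu hv huv hu0 hvK
    have hle : ∀ n : ℕ, ((n : ℕ∞) : WithTop ℕ∞) ≤ ∞ := fun n => by exact_mod_cast le_top
    obtain ⟨K₀, hK₀⟩ := hu0
    -- The forcing of the lifted equation contains u itself, but only derivatives of u up to order
    -- k, which the induction hypothesis already controls.
    have hu1 : WeightedBound Z p k N (Q₀ * K) u := H₀ U Z p X A h.mono K u v hK hu hv huv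
      ⟨K₀, hK₀.mono_order (by omega)⟩ (hvK.mono_order (by omega))
    have hflip : WeightedBound Z p k (N - 1) _
        (fun x => flipPairing E' V (coordDeriv e A x) (u x)) :=
      WeightedBound.pred (WeightedBound.bilinear (flipPairing E' V) h.isOpen h.subset
        ((contDiffOn_coordDeriv (n := ⊤) e h.isOpen (by simpa using h.smoothA)).of_le (hle k))
        (hu.of_le (hle k)) (mul_nonneg hQ₀ hK) hM h.norm_sub_le
        (M' := ‖preCoord e (V →L[ℝ] V)‖ * M) (fun j hj x hx =>
          (norm_iteratedFDeriv_coordDeriv_le e h.isOpen (h.subset hx)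
            (h.smoothA.of_le (hle (j + 1)))).trans
            (mul_le_mul_of_nonneg_left (h.boundA (j + 1) (by omega) x hx) (norm_nonneg _))) hu1)
        (by
          have h1 := norm_nonneg (flipPairing E' V)
          have h3 := norm_nonneg (preCoord e (V →L[ℝ] V))
          positivity) hM h.norm_sub_le
    have hv1 : WeightedBound Z p k (N - 1) (B * K)
        (fun x => coordDeriv e v x - flipPairing E' V (coordDeriv e A x) (u x)) := by
      refine (WeightedBound.sub h.isOpen h.subset
        ((contDiffOn_coordDeriv (n := ⊤) e h.isOpen (by simpa using hv)).of_le (hle k))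
        ?_ (hvK.coordDeriv e h.isOpen h.subset (hv.of_le (hle (k + 1)))) hflip).mono_const ?_
      · exact (((flipPairing E' V).contDiff.comp_contDiffOn
          (contDiffOn_coordDeriv (n := ⊤) e h.isOpen (by simpa using h.smoothA))).clm_apply
            hu).of_le (hle k)
      · rw [hB]
        apply le_of_eq
        ring
    have hcu : ContDiffOn ℝ ∞ (coordDeriv e u) U :=
      contDiffOn_coordDeriv (n := ⊤) e h.isOpen (by simpa using hu)
    have hfin := H₁ U Z p X (liftCoeff e X A) (h.lift hM0) (B * K) (coordDeriv e u) _
      (mul_nonneg hB0 hK) hcu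
      ((contDiffOn_coordDeriv (n := ⊤) e h.isOpen (by simpa using hv)).sub
        (((flipPairing E' V).contDiff.comp_contDiffOn
          (contDiffOn_coordDeriv (n := ⊤) e h.isOpen (by simpa using h.smoothA))).clm_apply hu))
      (lifted_equation e h.isOpen h.smoothX h.smoothA hu huv)
      ⟨_, hK₀.coordDeriv e h.isOpen h.subset (hu.of_le (hle (k + 1)))⟩ hv1
    refine (WeightedBound.of_coordDeriv e h.isOpen h.subset (hu.of_le (hle (k + 1)))
      (hu1.mono_order (Nat.zero_le _)) hfin).mono_const ?_
    rw [max_mul_of_nonneg _ _ hK]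
    apply le_of_eq
    congr 1
    ring

end Estimate

/-! ### Families of equations with small forcing -/

section SmallForcing

variable {V : Type*} [NormedAddCommGroup V] [NormedSpace ℝ V] {ι : Type*} {L : Filter ι}

/-- A bounded multiple at rate κ and uniform smallness combine to smallness at any lower rate κ'.
Beyond a fixed time S the surplus rate κ - κ' beats K; before S the uniform smallness suffices. -/
theorem eventually_small_decay {g : ι → ℝ → V} {θ : ι → ℝ} {K κ κ' : ℝ} (hθ : ∀ i, 0 ≤ θ i)
    (hκ : κ' < κ)
    (h1 : ∀ᶠ i in L, ∀ s, 0 ≤ s → ‖g i s‖ ≤ K * θ i * Real.exp (-κ * s))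
    (h2 : ∀ ε, 0 < ε → ∀ᶠ i in L, ∀ s, 0 ≤ s → ‖g i s‖ ≤ ε * θ i) {ε : ℝ} (hε : 0 < ε) :
    ∀ᶠ i in L, ∀ s, 0 ≤ s → ‖g i s‖ ≤ ε * θ i * Real.exp (-κ' * s) := by
  obtain ⟨S, hS0, hS⟩ : ∃ S : ℝ, 0 ≤ S ∧ |K| * Real.exp (-(κ - κ') * S) ≤ ε := by
    have ht : Tendsto (fun S : ℝ => |K| * Real.exp (-(κ - κ') * S)) atTop (𝓝 (|K| * 0)) := by
      refine (Real.tendsto_exp_atBot.comp ?_).const_mul _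
      exact tendsto_id.const_mul_atTop_of_neg (by linarith)
    rw [mul_zero] at ht
    obtain ⟨S, hS, hS0⟩ := ((ht.eventually (gt_mem_nhds hε)).and (eventually_ge_atTop 0)).exists
    exact ⟨S, hS0, hS.le⟩
  filter_upwards [h1, h2 (ε * Real.exp (-|κ'| * S)) (by positivity)] with i hi1 hi2 s hs
  rcases le_total s S with hsS | hsS
  · refine (hi2 s hs).trans ?_
    rw [mul_right_comm]
    refine mul_le_mul_of_nonneg_left (Real.exp_le_exp.2 ?_) (mul_nonneg hε.le (hθ i))
    have h3 : κ' * s ≤ |κ'| * S :=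
      (mul_le_mul_of_nonneg_right (le_abs_self _) hs).trans (by gcongr)
    linarith
  · refine (hi1 s hs).trans ?_
    have h3 : Real.exp (-κ * s) = Real.exp (-(κ - κ') * s) * Real.exp (-κ' * s) := by
      rw [← Real.exp_add]; ring_nf
    have h4 : Real.exp (-(κ - κ') * s) ≤ Real.exp (-(κ - κ') * S) := by
      apply Real.exp_le_exp.2
      nlinarith
    have h5 : K * Real.exp (-(κ - κ') * s) ≤ ε :=
      (mul_le_mul (le_abs_self K) h4 (Real.exp_pos _).le (abs_nonneg _)).trans hS
    calc K * θ i * Real.exp (-κ * s)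
        = (K * Real.exp (-(κ - κ') * s)) * (θ i * Real.exp (-κ' * s)) := by rw [h3]; ring
      _ ≤ ε * (θ i * Real.exp (-κ' * s)) :=
        mul_le_mul_of_nonneg_right h5 (mul_nonneg (hθ i) (Real.exp_pos _).le)
      _ = _ := by ring

/-- Decaying solutions with small forcing are small. -/
theorem eventually_norm_initial_le {Am : ι → ℝ → V →L[ℝ] V} {z g : ι → ℝ → V} {θ : ι → ℝ}
    {l a κ c D K : ℝ} (hc : 0 < c) (ha : 0 < a + κ) (hl : a ≤ l) (hD : 0 ≤ D)
    (hθ : ∀ i, 0 ≤ θ i)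
    (hz : ∀ᶠ i in L, ∀ s, 0 ≤ s →
      HasDerivWithinAt (z i) (Am i s (z i s) - g i s) (Ici 0) s)
    (hA : ∀ᶠ i in L, ∀ s, 0 ≤ s →
      ‖l • ContinuousLinearMap.id ℝ V - Am i s‖ ≤ l - a + D * Real.exp (-c * s))
    (h1 : ∀ᶠ i in L, ∀ s, 0 ≤ s → ‖g i s‖ ≤ K * θ i * Real.exp (-κ * s))
    (h2 : ∀ ε, 0 < ε → ∀ᶠ i in L, ∀ s, 0 ≤ s → ‖g i s‖ ≤ ε * θ i)
    (hz0 : ∀ᶠ i in L, ∃ K₀, ∀ s, 0 ≤ s → ‖z i s‖ ≤ K₀ * Real.exp (-κ * s)) {ε : ℝ} (hε : 0 < ε) :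
    ∀ᶠ i in L, ‖z i 0‖ ≤ ε * θ i := by
  -- Half of the margin a + κ is sacrificed, so that a + κ' is still positive.
  set κ' : ℝ := κ - (a + κ) / 2 with hκ'
  have hκκ : κ' < κ := by linarith
  have haκ : 0 < a + κ' := by rw [hκ']; linarith
  set Q : ℝ := 2 / (a + κ') * Real.exp (2 * D / c) with hQ
  have hQ0 : 0 < Q := by positivity
  filter_upwards [hz, hA, hz0, eventually_small_decay hθ hκκ h1 h2 (div_pos hε hQ0)]
    with i hzi hAi hzeroi hgi
  have key := norm_le_of_decaying_solution hc haκ hl hD hzi hAi hgi (by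
    obtain ⟨K₀, hK₀⟩ := hzeroi
    refine ⟨|K₀|, fun s hs => (hK₀ s hs).trans ?_⟩
    gcongr
    exact le_abs_self _) 0 le_rfl
  rw [mul_zero, Real.exp_zero, mul_one] at key
  refine key.trans_eq ?_
  rw [show 2 * (ε / Q * θ i) / (a + κ') * Real.exp (2 * D / c) = (ε / Q * θ i) * Q by rw [hQ]; ring]
  field_simp

end SmallForcing

/-! ### Uniform continuity and first order Taylor remainders on compact sets -/

section Remainder

variable {E : Type*} [NormedAddCommGroup E] [NormedSpace ℝ E]
variable {F : Type*} [NormedAddCommGroup F] [NormedSpace ℝ F] {U K : Set E} {f : E → F}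

theorem exists_norm_sub_le_of_continuousOn (hK : IsCompact K) (hf : ContinuousOn f K) {ε : ℝ}
    (hε : 0 < ε) : ∃ δ, 0 < δ ∧ ∀ x ∈ K, ∀ y ∈ K, ‖y - x‖ < δ → ‖f y - f x‖ ≤ ε := by
  obtain ⟨δ, hδ, h⟩ := Metric.uniformContinuousOn_iff.1
    (hK.uniformContinuousOn_of_continuous hf) ε hε
  refine ⟨δ, hδ, fun x hx y hy hxy => ?_⟩
  have := h y hy x hx (by rwa [dist_eq_norm])
  rw [dist_eq_norm] at this
  exact this.le

theorem norm_sub_le_of_mem_segment {x y z : E} (hz : z ∈ segment ℝ x y) : ‖z - x‖ ≤ ‖y - x‖ := by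
  have : segment ℝ x y ⊆ Metric.closedBall x ‖y - x‖ :=
    (convex_closedBall x _).segment_subset (by simp) (by simp [dist_eq_norm])
  simpa [dist_eq_norm] using this hz

theorem norm_segment_sub_le {x y z p : E} {r : ℝ} (hz : z ∈ segment ℝ x y) (hx : ‖x - p‖ ≤ r)
    (hy : ‖y - p‖ ≤ r) : ‖z - p‖ ≤ r := by
  have : segment ℝ x y ⊆ Metric.closedBall p r :=
    (convex_closedBall p _).segment_subset (by simpa [dist_eq_norm]) (by simpa [dist_eq_norm])
  simpa [dist_eq_norm] using this hz

theorem exists_remainder_le (hU : IsOpen U) (hf : ContDiffOn ℝ 1 f U) (hK : IsCompact K)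
    (hKU : K ⊆ U) {ε : ℝ} (hε : 0 < ε) : ∃ δ, 0 < δ ∧ ∀ x y, segment ℝ x y ⊆ K → ‖y - x‖ < δ →
      ‖f y - f x - fderiv ℝ f x (y - x)‖ ≤ ε * ‖y - x‖ := by
  obtain ⟨δ, hδ, h⟩ := exists_norm_sub_le_of_continuousOn hK
    ((hf.continuousOn_fderiv_of_isOpen hU le_rfl).mono hKU) hε
  refine ⟨δ, hδ, fun x y hxy hd => ?_⟩
  refine (convex_segment x y).norm_image_sub_le_of_norm_fderiv_le' (𝕜 := ℝ) (fun z hz =>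
    (hf.contDiffAt (hU.mem_nhds (hKU (hxy hz)))).differentiableAt (by simp)) (fun z hz =>
    h x (hxy (left_mem_segment ℝ x y)) z (hxy hz)
      ((norm_sub_le_of_mem_segment hz).trans_lt hd)) (left_mem_segment ℝ x y)
      (right_mem_segment ℝ x y)

theorem norm_sub_le_of_fderiv_le_segment (hU : IsOpen U) (hf : ContDiffOn ℝ 1 f U) {x y : E}
    {B : ℝ} (hxy : segment ℝ x y ⊆ U) (hB : ∀ z ∈ segment ℝ x y, ‖fderiv ℝ f z‖ ≤ B) :
    ‖f y - f x‖ ≤ B * ‖y - x‖ :=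
  (convex_segment x y).norm_image_sub_le_of_norm_fderiv_le (𝕜 := ℝ) (fun z hz =>
    (hf.contDiffAt (hU.mem_nhds (hxy hz))).differentiableAt (by simp)) hB (left_mem_segment ℝ x y)
      (right_mem_segment ℝ x y)

theorem norm_remainder_le_of_fderiv_le_segment (hU : IsOpen U) (hf : ContDiffOn ℝ 1 f U) {x y : E}
    {B : ℝ} (hxy : segment ℝ x y ⊆ U) (hB : ∀ z ∈ segment ℝ x y, ‖fderiv ℝ f z‖ ≤ B) :
    ‖f y - f x - fderiv ℝ f x (y - x)‖ ≤ 2 * B * ‖y - x‖ := by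
  have h1 := norm_sub_le_of_fderiv_le_segment hU hf hxy hB
  have h2 := (fderiv ℝ f x).le_opNorm (y - x)
  have h3 := hB x (left_mem_segment ℝ x y)
  calc _ ≤ ‖f y - f x‖ + ‖fderiv ℝ f x (y - x)‖ := norm_sub_le _ _
    _ ≤ B * ‖y - x‖ + B * ‖y - x‖ := add_le_add h1 (h2.trans (by gcongr))
    _ = _ := by ring

end Remainder

/-! ### Functions vanishing to a given order at the source -/

section Flat

variable {E : Type*} [NormedAddCommGroup E] [NormedSpace ℝ E]
variable {E' : Type*} [NormedAddCommGroup E'] [NormedSpace ℝ E']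
variable {F : Type*} [NormedAddCommGroup F] [NormedSpace ℝ F]
variable {G : Type*} [NormedAddCommGroup G] [NormedSpace ℝ G]
variable {H : Type*} [NormedAddCommGroup H] [NormedSpace ℝ H]
variable {U K : Set E} {p : E} {k N : ℕ}

set_option maxSynthPendingDepth 5

/-- `f` is of class `C^k` on `U` and vanishes to order `N` at `p`, in the sense of weighted bounds
on compact sets. -/
def FlatOn (U : Set E) (p : E) (k N : ℕ) (f : E → F) : Prop :=
  ContDiffOn ℝ k f U ∧ ∀ K ⊆ U, IsCompact K → ∃ C : ℝ, 0 ≤ C ∧ WeightedBound K p k N C f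

theorem exists_norm_iteratedFDeriv_le (hU : IsOpen U) {f : E → F} (hf : ContDiffOn ℝ k f U)
    (hKU : K ⊆ U) (hK : IsCompact K) :
    ∃ C : ℝ, 0 ≤ C ∧ ∀ j ≤ k, ∀ x ∈ K, ‖iteratedFDeriv ℝ j f x‖ ≤ C := by
  have h : ∀ j ≤ k, ∃ C : ℝ, ∀ x ∈ K, ‖iteratedFDeriv ℝ j f x‖ ≤ C := by
    intro j hj
    have hc : ContinuousOn (iteratedFDeriv ℝ j f) U :=
      (hf.continuousOn_iteratedFDerivWithin (by exact_mod_cast hj) hU.uniqueDiffOn).congr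
        fun x hx => (iteratedFDerivWithin_of_isOpen j hU hx).symm
    exact hK.exists_bound_of_continuousOn (hc.mono hKU)
  choose! C hC using h
  refine ⟨∑ j ∈ Finset.range (k + 1), |C j|, by positivity, fun j hj x hx => ?_⟩
  refine (hC j hj x hx).trans ((le_abs_self _).trans ?_)
  exact Finset.single_le_sum (f := fun j => |C j|) (fun i _ => abs_nonneg _)
    (Finset.mem_range.2 (by omega))

theorem exists_norm_sub_le_of_isCompact (hK : IsCompact K) (p : E) :
    ∃ M : ℝ, 1 ≤ M ∧ ∀ x ∈ K, ‖x - p‖ ≤ M := by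
  obtain ⟨M, hM⟩ := hK.exists_bound_of_continuousOn (f := fun x => x - p) (by fun_prop)
  exact ⟨max 1 M, le_max_left _ _, fun x hx => (hM x hx).trans (le_max_right _ _)⟩

namespace FlatOn

theorem mono_order {f : E → F} (h : FlatOn U p k N f) {k' : ℕ} (hk : k' ≤ k) :
    FlatOn U p k' N f := by
  refine ⟨h.1.of_le (by exact_mod_cast hk), fun K hKU hK => ?_⟩
  obtain ⟨C, hC, hCK⟩ := h.2 K hKU hK
  exact ⟨C, hC, hCK.mono_order hk⟩

theorem pred {f : E → F} (h : FlatOn U p k N f) : FlatOn U p k (N - 1) f := by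
  refine ⟨h.1, fun K hKU hK => ?_⟩
  obtain ⟨C, hC, hCK⟩ := h.2 K hKU hK
  obtain ⟨M, hM, hKM⟩ := exists_norm_sub_le_of_isCompact hK p
  exact ⟨C * M, by positivity, hCK.pred hC hM hKM⟩

theorem sub (hU : IsOpen U) {f g : E → F} (hf : FlatOn U p k N f) (hg : FlatOn U p k N g) :
    FlatOn U p k N fun x => f x - g x := by
  refine ⟨hf.1.sub hg.1, fun K hKU hK => ?_⟩
  obtain ⟨C, hC, hCK⟩ := hf.2 K hKU hK
  obtain ⟨C', hC', hCK'⟩ := hg.2 K hKU hK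
  exact ⟨C + C', by positivity, hCK.sub hU hKU hf.1 hg.1 hCK'⟩

theorem coordDeriv (hU : IsOpen U) (e : E ≃L[ℝ] E') {f : E → F} (h : FlatOn U p (k + 1) N f) :
    FlatOn U p k (N - 1) (coordDeriv e f) := by
  refine ⟨contDiffOn_coordDeriv (n := k) e hU (by exact_mod_cast h.1), fun K hKU hK => ?_⟩
  obtain ⟨C, hC, hCK⟩ := h.2 K hKU hK
  exact ⟨_, mul_nonneg (norm_nonneg _) hC, hCK.coordDeriv e hU hKU h.1⟩

theorem bilinear (hU : IsOpen U) (B : F →L[ℝ] G →L[ℝ] H) {f : E → F} {g : E → G}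
    (hf : ContDiffOn ℝ k f U) (hg : FlatOn U p k N g) :
    FlatOn U p k N fun x => B (f x) (g x) := by
  refine ⟨(B.contDiff.comp_contDiffOn hf).clm_apply hg.1, fun K hKU hK => ?_⟩
  obtain ⟨C, hC, hCK⟩ := hg.2 K hKU hK
  obtain ⟨M, hM, hKM⟩ := exists_norm_sub_le_of_isCompact hK p
  obtain ⟨M', hM', hfM⟩ := exists_norm_iteratedFDeriv_le hU hf hKU hK
  have := norm_nonneg B
  exact ⟨_, by positivity, hCK.bilinear B hU hKU hf hg.1 hC hM hKM hfM⟩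

theorem of_iteratedFDeriv_eq_zero [FiniteDimensional ℝ E] (hU : IsOpen U) (hp : p ∈ U) {f : E → F}
    (hf : ContDiffOn ℝ ∞ f U) (h0 : ∀ j < N, iteratedFDeriv ℝ j f p = 0) : FlatOn U p k N f := by
  have hle : ∀ n : ℕ, ((n : ℕ∞) : WithTop ℕ∞) ≤ ∞ := fun n => by exact_mod_cast le_top
  refine ⟨hf.of_le (hle k), fun K hKU hK => ?_⟩
  obtain ⟨r, hr, hrU⟩ := Metric.nhds_basis_closedBall.mem_iff.1 (hU.mem_nhds hp)
  obtain ⟨C, hC, hCK⟩ := exists_norm_iteratedFDeriv_le (k := max k N) hU (hf.of_le (hle _))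
    (union_subset hKU (show Metric.closedBall p (min r 1) ⊆ U from
      (Metric.closedBall_subset_closedBall (min_le_left _ _)).trans hrU))
    (hK.union (isCompact_closedBall p (min r 1)))
  refine ⟨C / (min r 1) ^ N, by positivity, weightedBound_of_iteratedFDeriv_eq_zero hU hf
    (lt_min hr one_pos) (min_le_right _ _) ?_ h0 ?_ ?_⟩
  · exact (Metric.ball_subset_closedBall.trans
      (Metric.closedBall_subset_closedBall (min_le_left _ _))).trans hrU
  · exact fun j hj x hx => hCK j (hj.trans (le_max_right _ _)) x
      (Or.inr (Metric.ball_subset_closedBall hx))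
  · exact fun j hj x hx => hCK j (hj.trans (le_max_left _ _)) x (Or.inl hx)

end FlatOn

/-- The case k = 0, N = 1 of the weighted Taylor bound, applied to f - f p. No convexity of K is
needed. -/
theorem exists_norm_sub_le_mul [FiniteDimensional ℝ E] (hU : IsOpen U) (hp : p ∈ U) {f : E → F}
    (hf : ContDiffOn ℝ ∞ f U) (hKU : K ⊆ U) (hK : IsCompact K) :
    ∃ M : ℝ, 0 ≤ M ∧ ∀ x ∈ K, ‖f x - f p‖ ≤ M * ‖x - p‖ := by
  have h : FlatOn U p 0 1 fun x => f x - f p :=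
    FlatOn.of_iteratedFDeriv_eq_zero hU hp (hf.sub contDiffOn_const) (by
      intro j hj
      obtain rfl : j = 0 := by omega
      ext
      simp)
  obtain ⟨M, hM, hMK⟩ := h.2 K hKU hK
  exact ⟨M, hM, fun x hx => by simpa using hMK.norm_le hx⟩

end Flat

/-! ### Mild solutions: existence and continuity -/

section Mild

set_option maxSynthPendingDepth 5

variable {E : Type*} [NormedAddCommGroup E] [NormedSpace ℝ E]
variable {E' : Type*} [NormedAddCommGroup E'] [NormedSpace ℝ E']
variable {V : Type*} [NormedAddCommGroup V] [NormedSpace ℝ V]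

/-- A transport equation on a domain attracted by the source `p`, with damping constants for its
coefficients at `p`. -/
structure TransportSetup (e : E ≃L[ℝ] E') (U : Set E) (p : E) (X : E → E) (β : E → ℝ → E)
    (A : E → V →L[ℝ] V) (l a Λ c : ℝ) : Prop where
  isOpen : IsOpen U
  mem : p ∈ U
  pos : 0 < c
  smoothX : ContDiffOn ℝ ∞ X U
  smoothA : ContDiffOn ℝ ∞ A U
  flow : IsBackwardFlow X U p c β
  dampA : ‖l • ContinuousLinearMap.id ℝ V - A p‖ ≤ l - a
  dampX : ‖Λ • ContinuousLinearMap.id ℝ E' - inCoords e (fderiv ℝ X p)‖ ≤ Λ - c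

variable {e : E ≃L[ℝ] E'} {U : Set E} {p : E} {X : E → E} {β : E → ℝ → E}
  {A : E → V →L[ℝ] V} {l a Λ c : ℝ} {N : ℕ}

namespace TransportSetup

theorem lift (h : TransportSetup e U p X β A l a Λ c) :
    TransportSetup e U p X β (liftCoeff e X A) (l + Λ) (a + c) Λ c where
  isOpen := h.isOpen
  mem := h.mem
  pos := h.pos
  smoothX := h.smoothX
  smoothA := contDiffOn_liftCoeff (n := ⊤) e h.isOpen (by simpa using h.smoothX) h.smoothA
  flow := h.flow
  dampA := norm_smul_id_sub_liftCoeff_le h.dampA h.dampX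
  dampX := h.dampX

theorem le (h : TransportSetup e U p X β A l a Λ c) : a ≤ l := by
  linarith [(norm_nonneg _).trans h.dampA]

theorem exists_damping [FiniteDimensional ℝ E] (h : TransportSetup e U p X β A l a Λ c) {K₀ : Set E} (hK₀U : K₀ ⊆ U)
    (hK₀ : IsCompact K₀) : ∃ D : ℝ, 0 ≤ D ∧ ∀ x ∈ K₀,
      ‖l • ContinuousLinearMap.id ℝ V - A x‖ ≤ l - a + D * ‖x - p‖ := by
  obtain ⟨D, hD, hDK⟩ := exists_norm_sub_le_mul h.isOpen h.mem h.smoothA hK₀U hK₀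
  exact ⟨D, hD, fun x hx => (norm_damping_le h.dampA).trans (by linarith [hDK x hx])⟩

end TransportSetup

/-- `u` solves the equation along the backward trajectories and decays along each of them at the
rate of a function vanishing to order `N` at the source. -/
def IsMild (U : Set E) (β : E → ℝ → E) (A : E → V →L[ℝ] V) (c : ℝ) (N : ℕ) (v u : E → V) : Prop :=
  ∀ q ∈ U, (∀ s, 0 ≤ s → HasDerivWithinAt (fun s => u (β q s))
      (A (β q s) (u (β q s)) - v (β q s)) (Ici 0) s) ∧
    ∃ K : ℝ, ∀ s, 0 ≤ s → ‖u (β q s)‖ ≤ K * Real.exp (-(c * N) * s)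

variable [FiniteDimensional ℝ E]

/-- The equation is solved separately along each trajectory, and u q is the initial value of the
decaying solution along the trajectory from q. -/
theorem TransportSetup.exists_isMild [CompleteSpace V] (h : TransportSetup e U p X β A l a Λ c)
    (haN : 0 < a + c * N) {v : E → V} (hv : FlatOn U p 0 N v) :
    ∃ u, IsMild U β A c N v u := by
  have hsol : ∀ q ∈ U, ∃ D : ℝ, 0 ≤ D ∧
      (∀ s, 0 ≤ s → ‖l • ContinuousLinearMap.id ℝ V - A (β q s)‖ ≤ l - a + D * Real.exp (-c * s)) ∧
      ∃ z : ℝ → V, (∀ s, 0 ≤ s →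
        HasDerivWithinAt z (A (β q s) (z s) - v (β q s)) (Ici 0) s) ∧
        ∃ K, ∀ s, 0 ≤ s → ‖z s‖ ≤ K * Real.exp (-(c * N) * s) := by
    intro q hq
    obtain ⟨K₀, hK₀U, hK₀, C, hC, hCK⟩ :=
      h.flow.compact {q} (by simpa using hq) isCompact_singleton
    obtain ⟨D, hD, hDK⟩ := h.exists_damping hK₀U hK₀
    obtain ⟨Cv, hCv, hvK⟩ := hv.2 K₀ hK₀U hK₀
    have hβc := (h.flow.curve q hq).continuousOn
    have hmaps : MapsTo (β q) (Ici 0) U := fun s hs => h.flow.mem q hq s hs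
    have hdamp : ∀ s, 0 ≤ s → ‖l • ContinuousLinearMap.id ℝ V - A (β q s)‖ ≤
        l - a + D * (C * ‖q - p‖) * Real.exp (-c * s) := by
      intro s hs
      obtain ⟨h1, h2⟩ := hCK q rfl s hs
      refine (hDK _ h1).trans ?_
      have : D * ‖β q s - p‖ ≤ D * (C * Real.exp (-c * s) * ‖q - p‖) := by gcongr
      linarith
    refine ⟨D * (C * ‖q - p‖), by positivity, hdamp, ?_⟩
    refine exists_decaying_solution (Am := fun s => A (β q s)) (g := fun s => v (β q s))
      (K := Cv * (C ^ N * ‖q - p‖ ^ N)) h.pos haN h.le (by positivity)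
      (mul_nonneg h.pos.le (Nat.cast_nonneg _)) (h.smoothA.continuousOn.comp hβc hmaps)
      (hv.1.continuousOn.comp hβc hmaps) hdamp ?_
    intro s hs
    obtain ⟨h1, h2⟩ := hCK q rfl s hs
    refine (hvK.norm_le h1).trans ?_
    rw [mul_assoc]
    gcongr
    exact pow_decay_le N (norm_nonneg _) h2
  choose! D hD hDq z hz hzK using hsol
  -- The solution chosen along the trajectory of β q s and the shifted solution of q differ by a
  -- decaying solution without forcing, which vanishes. So the separate choices fit together into
  -- one function.
  have hagree : ∀ q ∈ U, ∀ s, 0 ≤ s → z (β q s) 0 = z q s := by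
    intro q hq σ hσ
    have hqσ := h.flow.mem q hq σ hσ
    have hzero := norm_le_of_decaying_solution (Am := fun s => A (β (β q σ) s))
      (z := fun s => z (β q σ) s - z q (σ + s)) (g := fun _ => 0) (K := 0) (κ := c * N)
      h.pos haN h.le (hD _ hqσ) (fun s hs => by
        have h1 := hz _ hqσ s hs
        have h2 := (hz q hq (σ + s) (by positivity)).scomp s
          (h := fun s => σ + s) (h' := 1) (s := Ici 0)
          (by simpa using (hasDerivWithinAt_id s (Ici 0)).const_add σ)
          (fun r hr => by simp only [mem_Ici] at hr ⊢; positivity)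
        refine (h1.sub h2).congr_deriv ?_
        rw [h.flow.add q hq σ hσ s hs]
        simp only [one_smul, map_sub, sub_zero]
        abel) (hDq _ hqσ) (fun s hs => by simp) (by
        obtain ⟨K₁, hK₁⟩ := hzK _ hqσ
        obtain ⟨K₂, hK₂⟩ := hzK _ hq
        refine ⟨K₁ + |K₂|, fun s hs => (norm_sub_le _ _).trans ?_⟩
        rw [add_mul]
        refine add_le_add (hK₁ s hs) ((hK₂ (σ + s) (by positivity)).trans ?_)
        have hcN : 0 ≤ c * N := mul_nonneg h.pos.le (Nat.cast_nonneg _)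
        refine mul_le_mul (le_abs_self _) (Real.exp_le_exp.2 ?_) (Real.exp_pos _).le (abs_nonneg _)
        nlinarith) 0 le_rfl
    simp only [mul_zero, zero_div, zero_mul, add_zero] at hzero
    exact sub_eq_zero.1 (norm_le_zero_iff.1 hzero)
  refine ⟨fun q => z q 0, fun q hq => ⟨fun s hs => ?_, ?_⟩⟩
  · change HasDerivWithinAt (fun s => z (β q s) 0) (A (β q s) (z (β q s) 0) - v (β q s)) _ _
    rw [hagree q hq s hs]
    exact (hz q hq s hs).congr (fun r hr => hagree q hq r hr) (hagree q hq s hs)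
  · obtain ⟨K, hK⟩ := hzK q hq
    exact ⟨K, fun s hs => (congrArg norm (hagree q hq s hs)).trans_le (hK s hs)⟩

theorem TransportSetup.weightedBound_of_isMild (h : TransportSetup e U p X β A l a Λ c)
    (haN : 0 < a + c * N) {k : ℕ} {u v : E → V} (hv : FlatOn U p k N v)
    (hu : IsMild U β A c N v u) {K : Set E} (hKU : K ⊆ U) (hK : IsCompact K) :
    ∃ C : ℝ, 0 ≤ C ∧ WeightedBound K p 0 N C u := by
  obtain ⟨K₀, hK₀U, hK₀, C, hC, hCK⟩ := h.flow.compact K hKU hK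
  obtain ⟨D, hD, hDK⟩ := h.exists_damping hK₀U hK₀
  obtain ⟨M, hM, hKM⟩ := exists_norm_sub_le_of_isCompact hK p
  obtain ⟨Cv, hCv, hvK⟩ := hv.2 K₀ hK₀U hK₀
  refine ⟨2 * (Cv * C ^ N) / (a + c * N) * Real.exp (2 * (D * (C * M)) / c), by positivity,
    WeightedBound.of_norm_le fun q hq => ?_⟩
  have key := norm_le_of_decaying_solution (Am := fun s => A (β q s)) (z := fun s => u (β q s))
    (g := fun s => v (β q s)) (l := l) (a := a) (κ := c * N) (c := c) (D := D * (C * M))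
    (K := Cv * (C ^ N * ‖q - p‖ ^ N)) h.pos haN h.le (by positivity) (hu q (hKU hq)).1
    (fun s hs => by
      obtain ⟨h1, h2⟩ := hCK q hq s hs
      refine (hDK _ h1).trans ?_
      have : D * ‖β q s - p‖ ≤ D * (C * Real.exp (-c * s) * M) := by
        gcongr
        exact h2.trans (by gcongr; exact hKM q hq)
      linarith)
    (fun s hs => by
      obtain ⟨h1, h2⟩ := hCK q hq s hs
      refine (hvK.norm_le h1).trans ?_
      rw [mul_assoc]
      gcongr
      exact pow_decay_le N (norm_nonneg _) h2)
    (hu q (hKU hq)).2 0 le_rfl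
  simp only [h.flow.init q (hKU hq), mul_zero, Real.exp_zero, mul_one] at key
  refine key.trans_eq ?_
  ring

/-- Uniform information on the trajectories starting near `q`. -/
theorem TransportSetup.exists_nearby (h : TransportSetup e U p X β A l a Λ c) {q : E}
    (hq : q ∈ U) : ∃ W ∈ 𝓝 q, W ⊆ U ∧ ∃ K₀ ⊆ U, IsCompact K₀ ∧ ∃ C : ℝ, 0 ≤ C ∧ ∀ q' ∈ W, ∀ s, 0 ≤ s →
      segment ℝ (β q s) (β q' s) ⊆ K₀ ∧ ‖β q' s - β q s‖ ≤ C * ‖q' - q‖ * Real.exp (-c * s) ∧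
      ∀ x ∈ segment ℝ (β q s) (β q' s), ‖x - p‖ ≤ C * Real.exp (-c * s) * 1 := by
  obtain ⟨W, hW, hWU, K₀, hK₀U, hK₀, C, hC, hCW⟩ := h.flow.pair q hq
  obtain ⟨K₁, hK₁, hqK₁, hK₁U⟩ := exists_compact_subset h.isOpen hq
  obtain ⟨_, _, _, C', hC', hCK'⟩ := h.flow.compact K₁ hK₁U hK₁
  obtain ⟨M, hM, hKM⟩ := exists_norm_sub_le_of_isCompact hK₁ p
  have hd : ∀ q' ∈ K₁, ∀ s, 0 ≤ s → ‖β q' s - p‖ ≤ (C + C' * M) * Real.exp (-c * s) * 1 := by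
    intro q' hq' s hs
    refine ((hCK' q' hq' s hs).2).trans ?_
    have h1 := hKM q' hq'
    calc C' * Real.exp (-c * s) * ‖q' - p‖ ≤ C' * Real.exp (-c * s) * M := by gcongr
      _ ≤ C' * Real.exp (-c * s) * M + C * Real.exp (-c * s) := by
        have : 0 ≤ C * Real.exp (-c * s) := by positivity
        linarith
      _ = _ := by ring
  refine ⟨W ∩ K₁, inter_mem hW (mem_interior_iff_mem_nhds.1 hqK₁), inter_subset_left.trans hWU,
    K₀, hK₀U, hK₀, C + C' * M, by positivity, fun q' hq' s hs => ?_⟩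
  obtain ⟨h1, h2⟩ := hCW q (mem_of_mem_nhds hW) q' hq'.1 s hs
  refine ⟨h1, ?_, fun x hx => norm_segment_sub_le hx (hd q (interior_subset hqK₁) s hs)
    (hd q' hq'.2 s hs)⟩
  rw [norm_sub_rev, norm_sub_rev q' q]
  refine h2.trans ?_
  have : 0 ≤ C' * M * (‖q - q'‖ * Real.exp (-c * s)) := by positivity
  linarith

theorem norm_sub_add_decay {a b x y E₀ : ℝ} (h1 : a ≤ x * E₀) (h2 : b ≤ y * E₀) :
    a + b ≤ (x + y) * E₀ := by linarith

/-- The difference of u along the trajectories from q' and q solves the equation with forcing (v' -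
v) - (A' - A)u. This decays at rate cN and becomes uniformly small as q' tends to q, so
`eventually_norm_initial_le` applies with θ = 1. -/
theorem TransportSetup.continuousOn_of_isMild (h : TransportSetup e U p X β A l a Λ c)
    (haN : 0 < a + c * N) {u v : E → V} (hv : FlatOn U p 0 N v)
    (hu : IsMild U β A c N v u) : ContinuousOn u U := by
  intro q hq
  apply ContinuousAt.continuousWithinAt
  obtain ⟨W, hW, hWU, K₀, hK₀U, hK₀, C, hC, hCW⟩ := h.exists_nearby hq
  obtain ⟨D, hD, hDK⟩ := h.exists_damping hK₀U hK₀
  obtain ⟨Cv, hCv, hvK⟩ := hv.2 K₀ hK₀U hK₀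
  obtain ⟨B, hB⟩ := hK₀.exists_bound_of_continuousOn (h.smoothA.continuousOn.mono hK₀U)
  obtain ⟨Ku, hKu⟩ := (hu q hq).2
  have hcN : 0 ≤ c * N := mul_nonneg h.pos.le (Nat.cast_nonneg _)
  have hexp : ∀ s : ℝ, 0 ≤ s → Real.exp (-(c * N) * s) ≤ 1 := fun s hs =>
    Real.exp_le_one_iff.2 (by nlinarith)
  have hKu0 : 0 ≤ Ku := by
    have := (norm_nonneg _).trans (hKu 0 le_rfl)
    simpa using this
  have hmem : ∀ q' ∈ W, ∀ s, 0 ≤ s → β q s ∈ K₀ ∧ β q' s ∈ K₀ := fun q' hq' s hs =>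
    ⟨(hCW q' hq' s hs).1 (left_mem_segment ℝ _ _), (hCW q' hq' s hs).1 (right_mem_segment ℝ _ _)⟩
  have hvd : ∀ q' ∈ W, ∀ s, 0 ≤ s → ∀ x ∈ segment ℝ (β q s) (β q' s),
      ‖v x‖ ≤ Cv * C ^ N * Real.exp (-(c * N) * s) := by
    intro q' hq' s hs x hx
    refine (hvK.norm_le ((hCW q' hq' s hs).1 hx)).trans ?_
    rw [mul_assoc]
    gcongr
    simpa using pow_decay_le N (norm_nonneg _) ((hCW q' hq' s hs).2.2 x hx)
  have key : ∀ ε : ℝ, 0 < ε → ∀ᶠ q' in 𝓝 q, ‖u (β q' 0) - u (β q 0)‖ ≤ ε * 1 := by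
    intro ε hε
    refine eventually_norm_initial_le (L := 𝓝 q) (Am := fun q' s => A (β q' s))
      (z := fun q' s => u (β q' s) - u (β q s))
      (g := fun q' s => (v (β q' s) - v (β q s)) - (A (β q' s) - A (β q s)) (u (β q s)))
      (θ := fun _ => 1) (κ := c * N) (D := D * C) (K := 2 * (Cv * C ^ N) + 2 * B * Ku)
      h.pos haN h.le (by positivity) (fun _ => zero_le_one) ?_ ?_ ?_ ?_ ?_ hε
    · filter_upwards [hW] with q' hq' s hs
      refine (((hu q' (hWU hq')).1 s hs).sub ((hu q hq).1 s hs)).congr_deriv ?_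
      simp only [map_sub, _root_.sub_apply]
      abel
    · filter_upwards [hW] with q' hq' s hs
      refine (hDK _ (hmem q' hq' s hs).2).trans ?_
      have h1 := (hCW q' hq' s hs).2.2 _ (right_mem_segment ℝ _ _)
      have : D * ‖β q' s - p‖ ≤ D * (C * Real.exp (-c * s) * 1) := by gcongr
      linarith
    · filter_upwards [hW] with q' hq' s hs
      have h1 := hvd q' hq' s hs _ (right_mem_segment ℝ _ _)
      have h2 := hvd q' hq' s hs _ (left_mem_segment ℝ _ _)
      have h3 := (A (β q' s) - A (β q s)).le_opNorm (u (β q s))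
      have h4 : ‖A (β q' s) - A (β q s)‖ ≤ 2 * B := by
        linarith [norm_sub_le (A (β q' s)) (A (β q s)), hB _ (hmem q' hq' s hs).1,
          hB _ (hmem q' hq' s hs).2]
      have h5 : ‖(A (β q' s) - A (β q s)) (u (β q s))‖ ≤
          2 * B * (Ku * Real.exp (-(c * N) * s)) :=
        h3.trans (mul_le_mul h4 (hKu s hs) (norm_nonneg _) ((norm_nonneg _).trans h4))
      have h6 := norm_sub_le (v (β q' s) - v (β q s)) ((A (β q' s) - A (β q s)) (u (β q s)))
      have h7 := norm_sub_le (v (β q' s)) (v (β q s))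
      linarith
    · intro ε' hε'
      obtain ⟨δ₁, hδ₁, H₁⟩ := exists_norm_sub_le_of_continuousOn hK₀
        (hv.1.continuousOn.mono hK₀U) (half_pos hε')
      obtain ⟨δ₂, hδ₂, H₂⟩ := exists_norm_sub_le_of_continuousOn hK₀
        (h.smoothA.continuousOn.mono hK₀U) (show 0 < ε' / (2 * (Ku + 1)) by positivity)
      have hnear : ∀ᶠ q' in 𝓝 q, C * ‖q' - q‖ < min δ₁ δ₂ := by
        have : Tendsto (fun q' => C * ‖q' - q‖) (𝓝 q) (𝓝 (C * ‖q - q‖)) :=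
          Continuous.tendsto (by fun_prop) q
        rw [sub_self, norm_zero, mul_zero] at this
        exact this.eventually (gt_mem_nhds (lt_min hδ₁ hδ₂))
      filter_upwards [hW, hnear] with q' hq' hn s hs
      have hle : ‖β q' s - β q s‖ < min δ₁ δ₂ := by
        refine lt_of_le_of_lt ((hCW q' hq' s hs).2.1.trans ?_) hn
        exact mul_le_of_le_one_right (by positivity)
          (Real.exp_le_one_iff.2 (by nlinarith [h.pos]))
      obtain ⟨m1, m2⟩ := hmem q' hq' s hs
      have h1 := H₁ _ m1 _ m2 (hle.trans_le (min_le_left _ _))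
      have h2 := H₂ _ m1 _ m2 (hle.trans_le (min_le_right _ _))
      have h3 := (A (β q' s) - A (β q s)).le_opNorm (u (β q s))
      have h4 : ‖u (β q s)‖ ≤ Ku + 1 := by
        have := (hKu s hs).trans (mul_le_of_le_one_right hKu0 (hexp s hs))
        linarith
      have h5 : ‖(A (β q' s) - A (β q s)) (u (β q s))‖ ≤ ε' / (2 * (Ku + 1)) * (Ku + 1) :=
        h3.trans (mul_le_mul h2 h4 (norm_nonneg _) (by positivity))
      have h5' : ε' / (2 * (Ku + 1)) * (Ku + 1) = ε' / 2 := by field_simp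
      have h6 := norm_sub_le (v (β q' s) - v (β q s)) ((A (β q' s) - A (β q s)) (u (β q s)))
      linarith
    · filter_upwards [hW] with q' hq'
      obtain ⟨K', hK'⟩ := (hu q' (hWU hq')).2
      exact ⟨K' + Ku, fun s hs => (norm_sub_le _ _).trans
        (norm_sub_add_decay (hK' s hs) (hKu s hs))⟩
  rw [ContinuousAt, Metric.tendsto_nhds]
  intro ε hε
  filter_upwards [key (ε / 2) (half_pos hε), hW] with q' hq' hq'W
  rw [h.flow.init q hq, h.flow.init q' (hWU hq'W)] at hq'
  rw [dist_eq_norm]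
  linarith

end Mild

/-! ### Differentiability of mild solutions and solvability for flat data -/

section Regularity

set_option maxSynthPendingDepth 5

universe u

variable {E : Type} [NormedAddCommGroup E] [NormedSpace ℝ E]
variable {E' : Type} [NormedAddCommGroup E'] [NormedSpace ℝ E']
variable {V : Type u} [NormedAddCommGroup V] [NormedSpace ℝ V]
variable {e : E ≃L[ℝ] E'} {U : Set E} {p : E} {X : E → E} {β : E → ℝ → E}
  {A : E → V →L[ℝ] V} {l a Λ c : ℝ} {N : ℕ}

/-- The equation for the first order remainder of a mild solution along two trajectories. -/
theorem hasDerivWithinAt_remainder {u v : E → V} {w : E → E' →L[ℝ] V} {β₁ β₂ : ℝ → E} {s : ℝ}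
    (hs : 0 ≤ s) (h₁ : IsBackwardCurve X β₁) (h₂ : IsBackwardCurve X β₂)
    (hu₁ : HasDerivWithinAt (fun s => u (β₁ s)) (A (β₁ s) (u (β₁ s)) - v (β₁ s)) (Ici 0) s)
    (hu₂ : HasDerivWithinAt (fun s => u (β₂ s)) (A (β₂ s) (u (β₂ s)) - v (β₂ s)) (Ici 0) s)
    (hw : HasDerivWithinAt (fun s => w (β₁ s)) (liftCoeff e X A (β₁ s) (w (β₁ s)) -
      (coordDeriv e v (β₁ s) - flipPairing E' V (coordDeriv e A (β₁ s)) (u (β₁ s)))) (Ici 0) s) :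
    HasDerivWithinAt (fun s => u (β₂ s) - u (β₁ s) - w (β₁ s) (e (β₂ s - β₁ s)))
      (A (β₂ s) (u (β₂ s) - u (β₁ s) - w (β₁ s) (e (β₂ s - β₁ s))) -
        ((v (β₂ s) - v (β₁ s) - fderiv ℝ v (β₁ s) (β₂ s - β₁ s)) -
          (A (β₂ s) - A (β₁ s) - fderiv ℝ A (β₁ s) (β₂ s - β₁ s)) (u (β₁ s)) -
          (A (β₂ s) - A (β₁ s)) (w (β₁ s) (e (β₂ s - β₁ s))) -
          w (β₁ s) (e (X (β₂ s) - X (β₁ s) - fderiv ℝ X (β₁ s) (β₂ s - β₁ s))))) (Ici 0) s := by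
  have hζ : HasDerivWithinAt (fun s => e (β₂ s - β₁ s)) (e (-X (β₂ s) - -X (β₁ s))) (Ici 0) s :=
    (e : E →L[ℝ] E').hasFDerivAt.comp_hasDerivWithinAt s ((h₂ s hs).sub (h₁ s hs))
  refine ((hu₂.sub hu₁).sub (hw.clm_apply hζ)).congr_deriv ?_
  simp only [liftCoeff_apply, _root_.sub_apply, _root_.add_apply, ContinuousLinearMap.comp_apply,
    coordDeriv_apply, flipPairing_apply, inCoords, ContinuousLinearEquiv.coe_coe,
    ContinuousLinearEquiv.symm_apply_apply, map_sub, map_neg]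
  abel

theorem flatOn_congr {F : Type*} [NormedAddCommGroup F] [NormedSpace ℝ F] {k : ℕ} (hU : IsOpen U)
    {f g : E → F} (hfg : ∀ x ∈ U, f x = g x) (hg : FlatOn U p k N g) : FlatOn U p k N f := by
  refine ⟨hg.1.congr hfg, fun K hKU hK => ?_⟩
  obtain ⟨C, hC, hCK⟩ := hg.2 K hKU hK
  refine ⟨C, hC, fun j hj x hx => ?_⟩
  have : f =ᶠ[𝓝 x] g := eventually_of_mem (hU.mem_nhds (hKU hx)) hfg
  rw [this.iteratedFDeriv ℝ j |>.eq_of_nhds]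
  exact hCK j hj x hx

variable [FiniteDimensional ℝ E]

/-- The first order remainder of u along two trajectories, with w as candidate derivative, solves
the original equation. Its forcing consists of the Taylor remainders of v, A and X and of a product
of two first order differences. It is at most a constant times ‖q' - q‖ exp(-cNs), and uniformly
o(‖q' - q‖), so the remainder at time 0 is o(‖q' - q‖). -/
theorem TransportSetup.hasFDerivAt_of_isMild (h : TransportSetup e U p X β A l a Λ c)
    (haN : 0 < a + c * N) {u v : E → V} {w : E → E' →L[ℝ] V} (hv : FlatOn U p 1 N v)
    (hu : IsMild U β A c N v u)
    (hw : IsMild U β (liftCoeff e X A) c (N - 1)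
      (fun x => coordDeriv e v x - flipPairing E' V (coordDeriv e A x) (u x)) w)
    {q : E} (hq : q ∈ U) : HasFDerivAt u ((w q).comp (e : E →L[ℝ] E')) q := by
  have hle1 : (1 : WithTop ℕ∞) ≤ ∞ := by exact_mod_cast le_top
  have hA1 := h.smoothA.of_le hle1
  have hX1 := h.smoothX.of_le hle1
  have hv1 : ContDiffOn ℝ 1 v U := by exact_mod_cast hv.1
  obtain ⟨W, hW, hWU, K₀, hK₀U, hK₀, C, hC, hCW⟩ := h.exists_nearby hq
  obtain ⟨D, hD, hDK⟩ := h.exists_damping hK₀U hK₀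
  obtain ⟨Cv, hCv, hvK⟩ := hv.2 K₀ hK₀U hK₀
  obtain ⟨B₀, hB₀⟩ := hK₀.exists_bound_of_continuousOn (h.smoothA.continuousOn.mono hK₀U)
  obtain ⟨B, hB⟩ := hK₀.exists_bound_of_continuousOn
    ((hA1.continuousOn_fderiv_of_isOpen h.isOpen le_rfl).mono hK₀U)
  obtain ⟨B', hB'⟩ := hK₀.exists_bound_of_continuousOn
    ((hX1.continuousOn_fderiv_of_isOpen h.isOpen le_rfl).mono hK₀U)
  obtain ⟨Ku, hKu⟩ := (hu q hq).2
  obtain ⟨Kw, hKw⟩ := (hw q hq).2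
  have hKu0 : 0 ≤ Ku := by simpa using (norm_nonneg _).trans (hKu 0 le_rfl)
  have hKw0 : 0 ≤ Kw := by simpa using (norm_nonneg _).trans (hKw 0 le_rfl)
  have hqW : q ∈ W := mem_of_mem_nhds hW
  have hq0 : β q 0 ∈ K₀ := (hCW q hqW 0 le_rfl).1 (left_mem_segment ℝ _ _)
  have hB00 : 0 ≤ B₀ := (norm_nonneg _).trans (hB₀ _ hq0)
  have hB0 : 0 ≤ B := (norm_nonneg _).trans (hB _ hq0)
  have hB'0 : 0 ≤ B' := (norm_nonneg _).trans (hB' _ hq0)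
  set ne : ℝ := ‖(e : E →L[ℝ] E')‖ with hne
  have hne0 : 0 ≤ ne := norm_nonneg _
  have hen : ∀ y : E, ‖e y‖ ≤ ne * ‖y‖ := fun y => (e : E →L[ℝ] E').le_opNorm y
  have hexp0 : ∀ s : ℝ, 0 ≤ s → Real.exp (-(c * N) * s) ≤ 1 := fun s hs =>
    Real.exp_le_one_iff.2 (by
      have : 0 ≤ c * N := mul_nonneg h.pos.le (Nat.cast_nonneg _)
      nlinarith)
  have hexp1 : ∀ s : ℝ, 0 ≤ s → Real.exp (-(c * (N - 1 : ℕ)) * s) ≤ 1 := fun s hs =>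
    Real.exp_le_one_iff.2 (by
      have : 0 ≤ c * (N - 1 : ℕ) := mul_nonneg h.pos.le (Nat.cast_nonneg _)
      nlinarith)
  have hexpc : ∀ s : ℝ, 0 ≤ s → Real.exp (-c * s) ≤ 1 := fun s hs =>
    Real.exp_le_one_iff.2 (by nlinarith [h.pos])
  -- The bounds for w and Dv decay only at rate c(N - 1); the missing factor exp(-cs) comes from the
  -- contraction of β q' - β q.
  have hexp : ∀ s : ℝ, 0 ≤ s →
      Real.exp (-(c * (N - 1 : ℕ)) * s) * Real.exp (-c * s) ≤ Real.exp (-(c * N) * s) := by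
    intro s hs
    rw [← Real.exp_add]
    apply Real.exp_le_exp.2
    have h1 : (N : ℝ) ≤ (N - 1 : ℕ) + 1 := by exact_mod_cast (by omega : N ≤ N - 1 + 1)
    have h2 : c * s * N ≤ c * s * ((N - 1 : ℕ) + 1) :=
      mul_le_mul_of_nonneg_left h1 (mul_nonneg h.pos.le hs)
    linarith
  have hmem : ∀ q' ∈ W, ∀ s, 0 ≤ s → β q s ∈ K₀ ∧ β q' s ∈ K₀ := fun q' hq' s hs =>
    ⟨(hCW q' hq' s hs).1 (left_mem_segment ℝ _ _), (hCW q' hq' s hs).1 (right_mem_segment ℝ _ _)⟩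
  have hζ : ∀ q' ∈ W, ∀ s, 0 ≤ s →
      ‖β q' s - β q s‖ ≤ C * ‖q' - q‖ * Real.exp (-c * s) := fun q' hq' s hs =>
    (hCW q' hq' s hs).2.1
  have hwe : ∀ s, 0 ≤ s → ∀ y : E,
      ‖w (β q s) (e y)‖ ≤ Kw * Real.exp (-(c * (N - 1 : ℕ)) * s) * (ne * ‖y‖) := fun s hs y =>
    ((w (β q s)).le_opNorm _).trans (mul_le_mul (hKw s hs) (hen y) (norm_nonneg _) (by positivity))
  have hvd : ∀ q' ∈ W, ∀ s, 0 ≤ s → ∀ x ∈ segment ℝ (β q s) (β q' s),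
      ‖fderiv ℝ v x‖ ≤ Cv * C ^ (N - 1) * Real.exp (-(c * (N - 1 : ℕ)) * s) := by
    intro q' hq' s hs x hx
    have h1 := hvK 1 le_rfl x ((hCW q' hq' s hs).1 hx)
    rw [← norm_iteratedFDeriv_fderiv, norm_iteratedFDeriv_zero] at h1
    refine h1.trans ?_
    rw [mul_assoc]
    gcongr
    simpa using pow_decay_le (N - 1) (norm_nonneg _) ((hCW q' hq' s hs).2.2 x hx)
  have hKU := fun q' hq' s hs => (hCW q' hq' s hs).1.trans hK₀U
  have key : ∀ ε : ℝ, 0 < ε → ∀ᶠ q' in 𝓝 q,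
      ‖u (β q' 0) - u (β q 0) - w (β q 0) (e (β q' 0 - β q 0))‖ ≤ ε * ‖q' - q‖ := by
    intro ε hε
    refine eventually_norm_initial_le (L := 𝓝 q) (Am := fun q' s => A (β q' s))
      (z := fun q' s => u (β q' s) - u (β q s) - w (β q s) (e (β q' s - β q s)))
      (g := fun q' s => (v (β q' s) - v (β q s) - fderiv ℝ v (β q s) (β q' s - β q s)) -
          (A (β q' s) - A (β q s) - fderiv ℝ A (β q s) (β q' s - β q s)) (u (β q s)) -
          (A (β q' s) - A (β q s)) (w (β q s) (e (β q' s - β q s))) -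
          w (β q s) (e (X (β q' s) - X (β q s) - fderiv ℝ X (β q s) (β q' s - β q s))))
      (θ := fun q' => ‖q' - q‖) (κ := c * N) (D := D * C)
      (K := 2 * (Cv * C ^ (N - 1)) * C + 2 * B * C * Ku + 2 * B₀ * (Kw * ne * C) +
        Kw * ne * (2 * B') * C)
      h.pos haN h.le (by positivity) (fun _ => norm_nonneg _) ?_ ?_ ?_ ?_ ?_ hε
    · filter_upwards [hW] with q' hq' s hs
      exact hasDerivWithinAt_remainder hs (h.flow.curve q hq) (h.flow.curve q' (hWU hq'))
        ((hu q hq).1 s hs) ((hu q' (hWU hq')).1 s hs) ((hw q hq).1 s hs)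
    · filter_upwards [hW] with q' hq' s hs
      refine (hDK _ (hmem q' hq' s hs).2).trans ?_
      have h1 := (hCW q' hq' s hs).2.2 _ (right_mem_segment ℝ _ _)
      have : D * ‖β q' s - p‖ ≤ D * (C * Real.exp (-c * s) * 1) := by gcongr
      linarith
    · filter_upwards [hW] with q' hq' s hs
      have hz := hζ q' hq' s hs
      set ζ := β q' s - β q s
      set E₀ := Real.exp (-(c * N) * s)
      set E₁ := Real.exp (-(c * (N - 1 : ℕ)) * s)
      set Ec := Real.exp (-c * s)
      have hE₀ : 0 < E₀ := Real.exp_pos _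
      have hE₁ : 0 < E₁ := Real.exp_pos _
      have hEc : 0 < Ec := Real.exp_pos _
      have hE : E₁ * Ec ≤ E₀ := hexp s hs
      have hEc1 : Ec ≤ 1 := hexpc s hs
      have hθ : 0 ≤ ‖q' - q‖ := norm_nonneg _
      have r1 : ‖v (β q' s) - v (β q s) - fderiv ℝ v (β q s) ζ‖ ≤
          2 * (Cv * C ^ (N - 1)) * C * (‖q' - q‖ * E₀) := by
        calc _ ≤ 2 * (Cv * C ^ (N - 1) * E₁) * ‖ζ‖ :=
              norm_remainder_le_of_fderiv_le_segment h.isOpen hv1 (hKU q' hq' s hs)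
                (hvd q' hq' s hs)
          _ ≤ 2 * (Cv * C ^ (N - 1) * E₁) * (C * ‖q' - q‖ * Ec) := by gcongr
          _ = 2 * (Cv * C ^ (N - 1)) * C * (‖q' - q‖ * (E₁ * Ec)) := by ring
          _ ≤ _ := by gcongr
      have r2 : ‖(A (β q' s) - A (β q s) - fderiv ℝ A (β q s) ζ) (u (β q s))‖ ≤
          2 * B * C * Ku * (‖q' - q‖ * E₀) := by
        calc _ ≤ ‖A (β q' s) - A (β q s) - fderiv ℝ A (β q s) ζ‖ * ‖u (β q s)‖ :=
              ContinuousLinearMap.le_opNorm _ _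
          _ ≤ (2 * B * ‖ζ‖) * (Ku * E₀) := by
              refine mul_le_mul ?_ (hKu s hs) (norm_nonneg _) (by positivity)
              exact norm_remainder_le_of_fderiv_le_segment h.isOpen hA1 (hKU q' hq' s hs)
                fun z hz => hB z ((hCW q' hq' s hs).1 hz)
          _ ≤ (2 * B * (C * ‖q' - q‖ * 1)) * (Ku * E₀) := by
              gcongr
              exact hz.trans (by gcongr)
          _ = _ := by ring
      have r3 : ‖(A (β q' s) - A (β q s)) (w (β q s) (e ζ))‖ ≤
          2 * B₀ * (Kw * ne * C) * (‖q' - q‖ * E₀) := by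
        calc _ ≤ ‖A (β q' s) - A (β q s)‖ * ‖w (β q s) (e ζ)‖ := ContinuousLinearMap.le_opNorm _ _
          _ ≤ (2 * B₀) * (Kw * E₁ * (ne * ‖ζ‖)) := by
              refine mul_le_mul ?_ (hwe s hs ζ) (norm_nonneg _) (by positivity)
              linarith [norm_sub_le (A (β q' s)) (A (β q s)), hB₀ _ (hmem q' hq' s hs).1,
                hB₀ _ (hmem q' hq' s hs).2]
          _ ≤ (2 * B₀) * (Kw * E₁ * (ne * (C * ‖q' - q‖ * Ec))) := by gcongr
          _ = 2 * B₀ * (Kw * ne * C) * (‖q' - q‖ * (E₁ * Ec)) := by ring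
          _ ≤ _ := by gcongr
      have r4 : ‖w (β q s) (e (X (β q' s) - X (β q s) - fderiv ℝ X (β q s) ζ))‖ ≤
          Kw * ne * (2 * B') * C * (‖q' - q‖ * E₀) := by
        calc _ ≤ Kw * E₁ * (ne * ‖X (β q' s) - X (β q s) - fderiv ℝ X (β q s) ζ‖) := hwe s hs _
          _ ≤ Kw * E₁ * (ne * (2 * B' * ‖ζ‖)) := by
              gcongr
              exact norm_remainder_le_of_fderiv_le_segment h.isOpen hX1 (hKU q' hq' s hs)
                fun z hz => hB' z ((hCW q' hq' s hs).1 hz)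
          _ ≤ Kw * E₁ * (ne * (2 * B' * (C * ‖q' - q‖ * Ec))) := by gcongr
          _ = Kw * ne * (2 * B') * C * (‖q' - q‖ * (E₁ * Ec)) := by ring
          _ ≤ _ := by gcongr
      refine (norm_sub_le _ _).trans ((add_le_add ((norm_sub_le _ _).trans
        (add_le_add ((norm_sub_le _ _).trans (add_le_add r1 r2)) r3)) r4).trans_eq ?_)
      ring
    · intro ε' hε'
      -- Q collects the coefficients of the four forcing terms; the summand 1 only keeps it
      -- positive.
      set Q : ℝ := C * (1 + Ku + 2 * (Kw * ne)) + 1 with hQ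
      have hQ0 : 0 < Q := by positivity
      set η : ℝ := ε' / Q with hη
      have hη0 : 0 < η := by positivity
      obtain ⟨δ₁, hδ₁, H₁⟩ := exists_remainder_le h.isOpen hv1 hK₀ hK₀U hη0
      obtain ⟨δ₂, hδ₂, H₂⟩ := exists_remainder_le h.isOpen hA1 hK₀ hK₀U hη0
      obtain ⟨δ₃, hδ₃, H₃⟩ := exists_remainder_le h.isOpen hX1 hK₀ hK₀U hη0
      obtain ⟨δ₄, hδ₄, H₄⟩ := exists_norm_sub_le_of_continuousOn hK₀
        (h.smoothA.continuousOn.mono hK₀U) hη0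
      have hnear : ∀ᶠ q' in 𝓝 q, C * ‖q' - q‖ < min (min δ₁ δ₂) (min δ₃ δ₄) := by
        have : Tendsto (fun q' => C * ‖q' - q‖) (𝓝 q) (𝓝 (C * ‖q - q‖)) :=
          Continuous.tendsto (by fun_prop) q
        rw [sub_self, norm_zero, mul_zero] at this
        exact this.eventually (gt_mem_nhds (lt_min (lt_min hδ₁ hδ₂) (lt_min hδ₃ hδ₄)))
      filter_upwards [hW, hnear] with q' hq' hn s hs
      have hz' : ‖β q' s - β q s‖ ≤ C * ‖q' - q‖ :=
        (hζ q' hq' s hs).trans (mul_le_of_le_one_right (by positivity) (hexpc s hs))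
      have hz := hz'.trans_lt hn
      obtain ⟨hz12, hz34⟩ := lt_min_iff.1 hz
      obtain ⟨hz1, hz2⟩ := lt_min_iff.1 hz12
      obtain ⟨hz3, hz4⟩ := lt_min_iff.1 hz34
      have hseg := (hCW q' hq' s hs).1
      obtain ⟨m1, m2⟩ := hmem q' hq' s hs
      have hwe' : ∀ y : E, ‖w (β q s) (e y)‖ ≤ Kw * ne * ‖y‖ := fun y =>
        (hwe s hs y).trans (by
          rw [mul_assoc Kw ne]
          exact mul_le_mul_of_nonneg_right (mul_le_of_le_one_right hKw0 (hexp1 s hs))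
            (by positivity))
      have hu' : ‖u (β q s)‖ ≤ Ku := (hKu s hs).trans (mul_le_of_le_one_right hKu0 (hexp0 s hs))
      set ζ := β q' s - β q s
      have r1 := H₁ _ _ hseg hz1
      have r2 : ‖(A (β q' s) - A (β q s) - fderiv ℝ A (β q s) ζ) (u (β q s))‖ ≤
          (η * ‖ζ‖) * Ku :=
        (ContinuousLinearMap.le_opNorm _ _).trans
          (mul_le_mul (H₂ _ _ hseg hz2) hu' (norm_nonneg _) (by positivity))
      have r3 : ‖(A (β q' s) - A (β q s)) (w (β q s) (e ζ))‖ ≤ η * (Kw * ne * ‖ζ‖) :=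
        (ContinuousLinearMap.le_opNorm _ _).trans
          (mul_le_mul (H₄ _ m1 _ m2 hz4) (hwe' ζ) (norm_nonneg _) hη0.le)
      have r4 : ‖w (β q s) (e (X (β q' s) - X (β q s) - fderiv ℝ X (β q s) ζ))‖ ≤
          Kw * ne * (η * ‖ζ‖) :=
        (hwe' _).trans (mul_le_mul_of_nonneg_left (H₃ _ _ hseg hz3) (by positivity))
      refine (norm_sub_le _ _).trans ((add_le_add ((norm_sub_le _ _).trans
        (add_le_add ((norm_sub_le _ _).trans (add_le_add r1 r2)) r3)) r4).trans ?_)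
      calc η * ‖ζ‖ + η * ‖ζ‖ * Ku + η * (Kw * ne * ‖ζ‖) + Kw * ne * (η * ‖ζ‖)
          = η * (1 + Ku + 2 * (Kw * ne)) * ‖ζ‖ := by ring
        _ ≤ η * (1 + Ku + 2 * (Kw * ne)) * (C * ‖q' - q‖) := by gcongr
        _ = η * (Q - 1) * ‖q' - q‖ := by rw [hQ]; ring
        _ ≤ η * Q * ‖q' - q‖ := by gcongr; linarith
        _ = ε' * ‖q' - q‖ := by rw [hη]; field_simp
    · filter_upwards [hW] with q' hq'
      obtain ⟨K', hK'⟩ := (hu q' (hWU hq')).2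
      refine ⟨K' + Ku + Kw * ne * (C * ‖q' - q‖), fun s hs => (norm_sub_le _ _).trans
        (norm_sub_add_decay ((norm_sub_le _ _).trans
          (norm_sub_add_decay (hK' s hs) (hKu s hs))) ?_)⟩
      refine (hwe s hs _).trans ?_
      calc _ ≤ Kw * Real.exp (-(c * (N - 1 : ℕ)) * s) *
            (ne * (C * ‖q' - q‖ * Real.exp (-c * s))) := by gcongr; exact hζ q' hq' s hs
        _ = Kw * ne * (C * ‖q' - q‖) *
            (Real.exp (-(c * (N - 1 : ℕ)) * s) * Real.exp (-c * s)) := by ring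
        _ ≤ _ := by gcongr; exact hexp s hs
  rw [hasFDerivAt_iff_isLittleO, Asymptotics.isLittleO_iff]
  intro ε hε
  filter_upwards [key ε hε, hW] with q' hq' hq'W
  rw [h.flow.init q hq, h.flow.init q' (hWU hq'W)] at hq'
  simpa using hq'

/-- Mild solutions are as regular and as flat as the right-hand side. -/
theorem flatOn_of_isMild (e : E ≃L[ℝ] E') (k : ℕ) :
    ∀ (V : Type u) [NormedAddCommGroup V] [NormedSpace ℝ V] [CompleteSpace V] (N : ℕ)
      (A : E → V →L[ℝ] V) (l a : ℝ), TransportSetup e U p X β A l a Λ c → 0 < a + c * N →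
      ∀ u v : E → V, FlatOn U p k N v → IsMild U β A c N v u → FlatOn U p k N u := by
  induction k with
  | zero =>
    intro V _ _ _ N A l a h haN u v hv hu
    exact ⟨contDiffOn_zero.2 (h.continuousOn_of_isMild haN hv hu),
      fun K hKU hK => h.weightedBound_of_isMild haN hv hu hKU hK⟩
  | succ k ih =>
    intro V _ _ _ N A l a h haN u v hv hu
    have hle : ∀ n : ℕ, ((n : ℕ∞) : WithTop ℕ∞) ≤ ∞ := fun n => by exact_mod_cast le_top
    have huk : FlatOn U p k N u := ih V N A l a h haN u v (hv.mono_order (by omega)) hu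
    have haN' : 0 < a + c + c * ((N - 1 : ℕ) : ℝ) := by
      rcases N with _ | N
      · simp at haN ⊢; linarith [h.pos]
      · rw [Nat.add_sub_cancel]
        push_cast at haN
        linarith
    have hv₁ : FlatOn U p k (N - 1)
        (fun x => coordDeriv e v x - flipPairing E' V (coordDeriv e A x) (u x)) :=
      (hv.coordDeriv h.isOpen e).sub h.isOpen (FlatOn.pred (FlatOn.bilinear h.isOpen
        (flipPairing E' V)
        ((contDiffOn_coordDeriv (n := ⊤) e h.isOpen (by simpa using h.smoothA)).of_le (hle k)) huk))
    -- The candidate for the derivative of u is constructed independently of u's differentiability,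
    -- and is C^k by the induction hypothesis.
    obtain ⟨w, hw⟩ := h.lift.exists_isMild haN' (hv₁.mono_order (Nat.zero_le _))
    have hwk : FlatOn U p k (N - 1) w := ih (E' →L[ℝ] V) (N - 1) _ _ _ h.lift haN' w _ hv₁ hw
    have hd : ∀ q ∈ U, HasFDerivAt u ((w q).comp (e : E →L[ℝ] E')) q := fun q hq =>
      h.hasFDerivAt_of_isMild haN (hv.mono_order (by omega)) hu hw hq
    have hcd : ∀ q ∈ U, coordDeriv e u q = w q := by
      intro q hq
      ext ξ
      rw [coordDeriv_apply, (hd q hq).fderiv]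
      simp
    have hcdk := flatOn_congr h.isOpen hcd hwk
    have hud : ContDiffOn ℝ (k + 1 : ℕ) u U := by
      rw [Nat.cast_add, Nat.cast_one, contDiffOn_succ_iff_fderiv_of_isOpen h.isOpen]
      refine ⟨fun q hq => (hd q hq).differentiableAt.differentiableWithinAt, by simp, ?_⟩
      rw [fderiv_eq_preCoord_coordDeriv e u]
      exact (preCoord e.symm V).contDiff.comp_contDiffOn hcdk.1
    refine ⟨hud, fun K hKU hK => ?_⟩
    obtain ⟨C₀, hC₀, hCK₀⟩ := huk.2 K hKU hK
    obtain ⟨C₁, -, hCK₁⟩ := hcdk.2 K hKU hK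
    exact ⟨_, le_max_of_le_left hC₀, WeightedBound.of_coordDeriv e h.isOpen hKU hud
      (hCK₀.mono_order (Nat.zero_le _)) hCK₁⟩

/-- Solvability for right-hand sides that vanish to high order at the source. -/
theorem TransportSetup.exists_solution [CompleteSpace V]
    (h : TransportSetup e U p X β A l a Λ c) (haN : 0 < a + c * N) {v : E → V}
    (hv : ContDiffOn ℝ ∞ v U) (hv0 : ∀ j < N, iteratedFDeriv ℝ j v p = 0) :
    ∃ u : E → V, ContDiffOn ℝ ∞ u U ∧ (∀ j < N, iteratedFDeriv ℝ j u p = 0) ∧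
      ∀ x ∈ U, fderiv ℝ u x (X x) + A x (u x) = v x := by
  have hflat : ∀ k, FlatOn U p k N v := fun k =>
    FlatOn.of_iteratedFDeriv_eq_zero h.isOpen h.mem hv hv0
  obtain ⟨u, hu⟩ := h.exists_isMild haN (hflat 0)
  have huk : ∀ k, FlatOn U p k N u := fun k =>
    flatOn_of_isMild e k V N A l a h haN u v (hflat k) hu
  refine ⟨u, contDiffOn_infty.2 fun k => (huk k).1, fun j hj => ?_, fun x hx => ?_⟩
  · obtain ⟨C, -, hC⟩ := (huk j).2 {p} (by simpa using h.mem) isCompact_singleton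
    have := hC j le_rfl p rfl
    rw [sub_self, norm_zero, zero_pow (by omega), mul_zero] at this
    exact norm_le_zero_iff.1 this
  have hd : DifferentiableAt ℝ u x :=
    ((huk 1).1.contDiffAt (h.isOpen.mem_nhds hx)).differentiableAt (by simp)
  have h0 := h.flow.init x hx
  -- The one-sided derivative at time 0 of u along the trajectory, computed from the mild equation
  -- and from the chain rule.
  have h1 := (hu x hx).1 0 le_rfl
  have h2 : HasDerivWithinAt (fun s => u (β x s)) (fderiv ℝ u (β x 0) (-X (β x 0))) (Ici 0) 0 :=
    HasFDerivAt.comp_hasDerivWithinAt (0 : ℝ) (by rw [h0]; exact hd.hasFDerivAt)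
      (h.flow.curve x hx 0 le_rfl)
  have hud := uniqueDiffOn_Ici (0 : ℝ) 0 self_mem_Ici
  have h3 := (h1.derivWithin hud).symm.trans (h2.derivWithin hud)
  rw [h0, map_neg] at h3
  rw [eq_comm, ← sub_eq_zero, ← neg_eq_zero]
  rw [← sub_eq_zero] at h3
  rw [← h3]
  abel

/-- Uniqueness of solutions that vanish to high order at the source. -/
theorem TransportSetup.eq_zero (h : TransportSetup e U p X β A l a Λ c) (haN : 0 < a + c * N)
    {u : E → V} (hu : ContDiffOn ℝ ∞ u U) (hu0 : ∀ j < N, iteratedFDeriv ℝ j u p = 0)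
    (huA : ∀ x ∈ U, fderiv ℝ u x (X x) + A x (u x) = 0) : ∀ x ∈ U, u x = 0 := by
  intro x hx
  have hflat : FlatOn U p 0 N u := FlatOn.of_iteratedFDeriv_eq_zero h.isOpen h.mem hu hu0
  obtain ⟨K₀, hK₀U, hK₀, C, hC, hCK⟩ :=
    h.flow.compact {x} (by simpa using hx) isCompact_singleton
  obtain ⟨D, hD, hDK⟩ := h.exists_damping hK₀U hK₀
  obtain ⟨Cu, hCu, huK⟩ := hflat.2 K₀ hK₀U hK₀
  have key := norm_le_of_decaying_solution (Am := fun s => A (β x s)) (z := fun s => u (β x s))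
    (g := fun _ => 0) (K := 0) (κ := c * N) (D := D * (C * ‖x - p‖)) h.pos haN h.le (by positivity)
    (fun s hs => hasDerivWithinAt_along (v := fun _ => 0) (h.flow.curve x hx) hs
      ((hu.contDiffAt (h.isOpen.mem_nhds (h.flow.mem x hx s hs))).differentiableAt (by simp))
      (huA _ (h.flow.mem x hx s hs)))
    (fun s hs => by
      obtain ⟨h1, h2⟩ := hCK x rfl s hs
      refine (hDK _ h1).trans ?_
      have : D * ‖β x s - p‖ ≤ D * (C * Real.exp (-c * s) * ‖x - p‖) := by gcongr
      linarith)
    (fun s _ => by simp)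
    ⟨Cu * (C ^ N * ‖x - p‖ ^ N), fun s hs => by
      obtain ⟨h1, h2⟩ := hCK x rfl s hs
      refine (huK.norm_le h1).trans ?_
      rw [mul_assoc]
      gcongr
      exact pow_decay_le N (norm_nonneg _) h2⟩ 0 le_rfl
  simp only [mul_zero, zero_div, zero_mul, h.flow.init x hx] at key
  exact norm_le_zero_iff.1 key

end Regularity

/-! ### The transport operator preserves the order of vanishing -/

section Vanishing

set_option maxSynthPendingDepth 5

universe u

variable {E : Type} [NormedAddCommGroup E] [NormedSpace ℝ E]

/-- The transport operator preserves the order of vanishing at a zero of the vector field. -/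
theorem iteratedFDeriv_transport_eq_zero {U : Set E} (hU : IsOpen U) {X : E → E} {p : E}
    (hp : p ∈ U) (hX : ContDiffOn ℝ ∞ X U) (hXp : X p = 0) (N : ℕ) :
    ∀ (V : Type u) [NormedAddCommGroup V] [NormedSpace ℝ V] (A : E → V →L[ℝ] V) (r : E → V),
      ContDiffOn ℝ ∞ A U → ContDiffOn ℝ ∞ r U → (∀ j < N, iteratedFDeriv ℝ j r p = 0) →
      ∀ j < N, iteratedFDeriv ℝ j (fun x => fderiv ℝ r x (X x) + A x (r x)) p = 0 := by
  induction N with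
  | zero => intro V _ _ A r _ _ _ j hj; omega
  | succ N ih =>
    intro V _ _ A r hA hr h0 j hj
    have hle : ∀ n : ℕ, ((n : ℕ∞) : WithTop ℕ∞) ≤ ∞ := fun n => by exact_mod_cast le_top
    have hrp : r p = 0 := by
      have := congrArg norm (h0 0 (by omega))
      simpa using this
    rw [← norm_le_zero_iff]
    rcases j with _ | i
    · simp [hXp, hrp]
    -- The derivative of the output is the lifted operator applied to Dr plus a term DA · r. The
    -- first vanishes to order N by induction, the second because r does.
    set e := ContinuousLinearEquiv.refl ℝ E with he
    set v : E → V := fun x => fderiv ℝ r x (X x) + A x (r x) with hv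
    have hvs : ContDiffOn ℝ ∞ v U :=
      ((hr.fderiv_of_isOpen hU (by simp)).clm_apply hX).add (hA.clm_apply hr)
    have hcr : ContDiffOn ℝ ∞ (coordDeriv e r) U :=
      contDiffOn_coordDeriv (n := ⊤) e hU (by simpa using hr)
    have hcA : ContDiffOn ℝ ∞ (coordDeriv e A) U :=
      contDiffOn_coordDeriv (n := ⊤) e hU (by simpa using hA)
    have hA₁ : ContDiffOn ℝ ∞ (liftCoeff e X A) U :=
      contDiffOn_liftCoeff (n := ⊤) e hU (by simpa using hX) hA
    have hcr0 : ∀ l < N, iteratedFDeriv ℝ l (coordDeriv e r) p = 0 := by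
      intro l hl
      rw [← norm_le_zero_iff]
      refine (norm_iteratedFDeriv_coordDeriv_le e hU hp (hr.of_le (hle _))).trans_eq ?_
      rw [h0 (l + 1) (by omega), norm_zero, mul_zero]
    have h1 := ih (E →L[ℝ] V) (liftCoeff e X A) (coordDeriv e r) hA₁ hcr hcr0 i (by omega)
    have h2 : iteratedFDeriv ℝ i (fun x => flipPairing E V (coordDeriv e A x) (r x)) p = 0 := by
      rw [← norm_le_zero_iff]
      refine (norm_iteratedFDeriv_bilinear_le (flipPairing E V) hU (hcA.of_le (hle i))
        (hr.of_le (hle i)) hp).trans_eq ?_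
      rw [Finset.sum_eq_zero, mul_zero]
      intro l _
      rw [h0 (i - l) (by omega), norm_zero, mul_zero]
    have hev : coordDeriv e v =ᶠ[𝓝 p] fun x =>
        (fderiv ℝ (coordDeriv e r) x (X x) + liftCoeff e X A x (coordDeriv e r x)) +
          flipPairing E V (coordDeriv e A x) (r x) :=
      eventually_of_mem (hU.mem_nhds hp) fun x hx => by
        simp only [lifted_equation e hU hX hA hr (fun _ _ => rfl) x hx]
        abel
    refine (norm_iteratedFDeriv_succ_le e hU hp (hvs.of_le (hle _))).trans_eq ?_
    rw [(hev.iteratedFDeriv ℝ i).eq_of_nhds]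
    have hs1 : ContDiffOn ℝ ∞ (fun x =>
        fderiv ℝ (coordDeriv e r) x (X x) + liftCoeff e X A x (coordDeriv e r x)) U :=
      ((hcr.fderiv_of_isOpen hU (by simp)).clm_apply hX).add (hA₁.clm_apply hcr)
    have hs2 : ContDiffOn ℝ ∞ (fun x => flipPairing E V (coordDeriv e A x) (r x)) U :=
      ((flipPairing E V).contDiff.comp_contDiffOn hcA).clm_apply hr
    have hadd := iteratedFDeriv_add_apply (i := i)
      ((hs1.contDiffAt (hU.mem_nhds hp)).of_le (hle i))
      ((hs2.contDiffAt (hU.mem_nhds hp)).of_le (hle i))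
    rw [h1, h2, add_zero] at hadd
    rw [show iteratedFDeriv ℝ i (fun x =>
        (fderiv ℝ (coordDeriv e r) x (X x) + liftCoeff e X A x (coordDeriv e r x)) +
          flipPairing E V (coordDeriv e A x) (r x)) p = 0 from hadd, norm_zero, mul_zero]

end Vanishing

/-! ### Jets at the source and the induced finite-dimensional operator -/

section Jets

universe u

variable {E : Type} [NormedAddCommGroup E] [NormedSpace ℝ E]
variable {V : Type u} [NormedAddCommGroup V] [NormedSpace ℝ V]
variable {M U : Opens E}

/-- The space of families of derivatives of order less than `N`. -/
abbrev JetSpace (E : Type) [NormedAddCommGroup E] [NormedSpace ℝ E] (V : Type u)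
    [NormedAddCommGroup V] [NormedSpace ℝ V] (N : ℕ) : Type u :=
  (j : Fin N) → E [×(j : ℕ)]→L[ℝ] V

instance [FiniteDimensional ℝ E] [FiniteDimensional ℝ V] (n : ℕ) :
    FiniteDimensional ℝ (E [×n]→L[ℝ] V) :=
  Module.Finite.of_injective
    (ContinuousMultilinearMap.toMultilinearMapLinear :
      (E [×n]→L[ℝ] V) →ₗ[ℝ] MultilinearMap ℝ (fun _ : Fin n => E) V)
    ContinuousMultilinearMap.toMultilinearMap_injective

/-- The jet of order less than `N` of a smooth function at a point. -/
def jet (N : ℕ) (p : U) : SmoothMap U V →ₗ[ℝ] JetSpace E V N where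
  toFun f j := SmoothMap.derivOn j f p
  map_add' f g := by
    funext j
    exact congrArg (fun h => h p) ((SmoothMap.derivOnₗ U V j).map_add f g)
  map_smul' r f := by
    funext j
    exact congrArg (fun h => h p) ((SmoothMap.derivOnₗ U V j).map_smul r f)

theorem jet_apply (N : ℕ) (p : U) (f : SmoothMap U V) (j : Fin N) :
    jet N p f j = iteratedFDeriv ℝ j f p := rfl

theorem jet_eq_zero_iff {N : ℕ} {p : U} {f : SmoothMap U V} :
    jet N p f = 0 ↔ ∀ j < N, iteratedFDeriv ℝ j f p = 0 :=
  ⟨fun h j hj => congrFun h ⟨j, hj⟩, fun h => funext fun j => h j j.2⟩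

/-- The jet at the origin. -/
def jetZero (E : Type) [NormedAddCommGroup E] [NormedSpace ℝ E] (V : Type u)
    [NormedAddCommGroup V] [NormedSpace ℝ V] (N : ℕ) :
    SmoothMap (⊤ : Opens E) V →ₗ[ℝ] JetSpace E V N :=
  jet N ⟨0, Opens.mem_top 0⟩

/-- The space of jets at the origin of smooth functions. -/
def jetRange (E : Type) [NormedAddCommGroup E] [NormedSpace ℝ E] (V : Type u)
    [NormedAddCommGroup V] [NormedSpace ℝ V] (N : ℕ) : Submodule ℝ (JetSpace E V N) :=
  LinearMap.range (jetZero E V N)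

instance [FiniteDimensional ℝ E] [FiniteDimensional ℝ V] (N : ℕ) :
    FiniteDimensional ℝ (JetSpace E V N) := Module.Finite.pi

/-- A cutoff near p and a translation give a globally defined function with the same jet at the
origin. Working in the range of the jet map avoids characterizing which families of multilinear maps
are jets, and gives one space for all base points. -/
theorem jet_mem_jetRange [FiniteDimensional ℝ E] (N : ℕ) (p : U) (f : SmoothMap U V) :
    jet N p f ∈ jetRange E V N := by
  obtain ⟨r, hr, hrU⟩ := Metric.nhds_basis_closedBall.mem_iff.1 (U.isOpen.mem_nhds p.2)
  let χ : ContDiffBump (p : E) := ⟨r / 2, r, half_pos hr, half_lt_self hr⟩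
  have hg : ContDiff ℝ ∞ (fun x => χ x • f x) := by
    rw [contDiff_iff_contDiffAt]
    intro x
    by_cases hx : x ∈ U
    · exact χ.contDiff.contDiffAt.smul (f.contDiffOn.contDiffAt (U.isOpen.mem_nhds hx))
    · have hx' : x ∉ tsupport χ := by
        rw [χ.tsupport_eq]
        exact fun h => hx (hrU h)
      refine (contDiffAt_const (c := (0 : V))).congr_of_eventuallyEq ?_
      filter_upwards [(isClosed_tsupport χ).isOpen_compl.mem_nhds hx'] with y hy
      rw [image_eq_zero_of_notMem_tsupport hy, zero_smul]
  have hh : ContDiff ℝ ∞ (fun x => χ (x + p) • f (x + p)) :=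
    hg.comp (contDiff_id.add contDiff_const)
  refine ⟨SmoothMap.ofContDiffOn ⊤ _ hh.contDiffOn, ?_⟩
  funext j
  rw [jetZero, jet_apply, jet_apply, SmoothMap.iteratedFDeriv_ofContDiffOn _ (Opens.mem_top _),
    iteratedFDeriv_comp_add_right (f := fun x => χ x • f x) (j : ℕ) (p : E) 0, zero_add]
  have hev : (fun x => χ x • f x) =ᶠ[𝓝 (p : E)] f := by
    filter_upwards [χ.eventuallyEq_one] with x hx
    rw [hx, Pi.one_apply, one_smul]
  exact (hev.iteratedFDeriv ℝ j).eq_of_nhds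

/-- The space of jets at the origin of smooth functions, as a normed space of its own. -/
def JetModel (E : Type) [NormedAddCommGroup E] [NormedSpace ℝ E] (V : Type u)
    [NormedAddCommGroup V] [NormedSpace ℝ V] (N : ℕ) : Type u := ↥(jetRange E V N)

instance (N : ℕ) : NormedAddCommGroup (JetModel E V N) :=
  inferInstanceAs (NormedAddCommGroup ↥(jetRange E V N))

instance (N : ℕ) : NormedSpace ℝ (JetModel E V N) :=
  inferInstanceAs (NormedSpace ℝ ↥(jetRange E V N))

instance [FiniteDimensional ℝ E] [FiniteDimensional ℝ V] (N : ℕ) :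
    FiniteDimensional ℝ (JetModel E V N) :=
  FiniteDimensional.finiteDimensional_submodule (jetRange E V N)

/-- The inclusion of the space of jets of smooth functions. -/
def JetModel.toJet (E : Type) [NormedAddCommGroup E] [NormedSpace ℝ E] (V : Type u)
    [NormedAddCommGroup V] [NormedSpace ℝ V] (N : ℕ) : JetModel E V N →ₗᵢ[ℝ] JetSpace E V N := (jetRange E V N).subtypeₗᵢ

/-- The jet of a smooth function, as an element of the space of jets of smooth functions. -/
def modelJet [FiniteDimensional ℝ E] (N : ℕ) (p : U) : SmoothMap U V →ₗ[ℝ] JetModel E V N :=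
  (jet N p).codRestrict (jetRange E V N) (jet_mem_jetRange N p)

theorem toJet_modelJet [FiniteDimensional ℝ E] (N : ℕ) (p : U) (f : SmoothMap U V) :
    JetModel.toJet E V N (modelJet N p f) = jet N p f := rfl

theorem norm_modelJet_le [FiniteDimensional ℝ E] {N : ℕ} {p : U} {f : SmoothMap U V} {B : ℝ}
    (hB : 0 ≤ B) (h : ∀ j < N, ‖iteratedFDeriv ℝ j f p‖ ≤ B) : ‖modelJet N p f‖ ≤ B := by
  rw [← (JetModel.toJet E V N).norm_map, toJet_modelJet]
  exact (pi_norm_le_iff_of_nonneg hB).2 fun j => h j j.2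

theorem exists_linear_section {F W : Type*} [AddCommGroup F] [Module ℝ F] [AddCommGroup W]
    [Module ℝ W] (f : F →ₗ[ℝ] W) : ∃ σ : LinearMap.range f →ₗ[ℝ] F, ∀ j, f (σ j) = (j : W) := by
  obtain ⟨σ, hσ⟩ := LinearMap.exists_rightInverse_of_surjective f.rangeRestrict
    (LinearMap.range_rangeRestrict _)
  exact ⟨σ, fun j => congrArg Subtype.val (LinearMap.congr_fun hσ j)⟩

theorem exists_jetSection (E : Type) [NormedAddCommGroup E] [NormedSpace ℝ E] (V : Type u)
    [NormedAddCommGroup V] [NormedSpace ℝ V] (N : ℕ) :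
    ∃ σ : JetModel E V N →ₗ[ℝ] SmoothMap (⊤ : Opens E) V,
      ∀ j, jetZero E V N (σ j) = JetModel.toJet E V N j :=
  exists_linear_section (jetZero E V N)

/-- A linear choice of smooth functions with prescribed jets at the origin. -/
def jetSection (E : Type) [NormedAddCommGroup E] [NormedSpace ℝ E] (V : Type u)
    [NormedAddCommGroup V] [NormedSpace ℝ V] (N : ℕ) :
    JetModel E V N →ₗ[ℝ] SmoothMap (⊤ : Opens E) V :=
  (exists_jetSection E V N).choose

/-- A smooth function on `U` with prescribed jet at `p`. -/
def jetRealization (U : Opens E) (N : ℕ) (p : E) : JetModel E V N →ₗ[ℝ] SmoothMap U V where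
  toFun j := SmoothMap.translate U p (jetSection E V N j)
  map_add' i j := by rw [map_add, SmoothMap.translate_add]
  map_smul' r j := by rw [map_smul, SmoothMap.translate_smul]; rfl

theorem iteratedFDeriv_jetRealization {N : ℕ} {p x : E} (hx : x ∈ U) (j : JetModel E V N) (m : ℕ) :
    iteratedFDeriv ℝ m (jetRealization U N p j) x =
      iteratedFDeriv ℝ m (jetSection E V N j) (x - p) :=
  SmoothMap.iteratedFDeriv_translate p _ m hx

theorem jet_jetRealization {N : ℕ} (p : U) (j : JetModel E V N) :
    jet N p (jetRealization U N p j) = JetModel.toJet E V N j := by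
  refine Eq.trans ?_ ((exists_jetSection E V N).choose_spec j)
  funext i
  rw [jet_apply, iteratedFDeriv_jetRealization p.2, sub_self]
  rfl

variable {𝕜 : Type*} [RCLike 𝕜] [NormedSpace 𝕜 V] [IsScalarTower ℝ 𝕜 V]

/-- The operator induced by `D_X + A` on jets at `p`. -/
def jetSymbol [FiniteDimensional ℝ E] [FiniteDimensional ℝ V] (hUM : U ≤ M) (N : ℕ)
    (c : SmoothMap M E × SmoothMap U (V →L[𝕜] V)) (p : U) :
    JetModel E V N →L[ℝ] JetModel E V N :=
  LinearMap.toContinuousLinearMap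
    (modelJet N p ∘ₗ transportₗ hUM c.1 c.2 ∘ₗ jetRealization U N (p : E))

theorem toJet_jetSymbol [FiniteDimensional ℝ E] [FiniteDimensional ℝ V] (hUM : U ≤ M) (N : ℕ)
    (c : SmoothMap M E × SmoothMap U (V →L[𝕜] V)) (p : U) (j : JetModel E V N) :
    JetModel.toJet E V N (jetSymbol hUM N c p j) =
      jet N p (transport hUM c.1 c.2 (jetRealization U N p j)) := rfl

/-- Joint continuity in the data and the base point is what makes injectivity of the jet operator an
open condition, even though the source moves. -/
theorem continuous_jetSymbol [FiniteDimensional ℝ E] [FiniteDimensional ℝ V] (hUM : U ≤ M)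
    (N : ℕ) : Continuous fun r : (SmoothMap M E × SmoothMap U (V →L[𝕜] V)) × U =>
      jetSymbol hUM N r.1 r.2 := by
  refine continuous_clm_apply.2 fun j => ?_
  rw [← (JetModel.toJet E V N).isometry.comp_continuous_iff]
  refine continuous_pi fun i => ?_
  have h1 : Continuous fun r : (SmoothMap M E × SmoothMap U (V →L[𝕜] V)) × U =>
      transport hUM r.1.1 r.1.2 (jetRealization U N r.2 j) :=
    (continuous_transport hUM).comp (f := fun r : (SmoothMap M E × SmoothMap U (V →L[𝕜] V)) × U =>
      (r.1, jetRealization U N r.2 j)) (continuous_fst.prodMk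
        ((SmoothMap.continuous_translate _).comp (continuous_subtype_val.comp continuous_snd)))
  exact SmoothMap.continuous_eval_derivOn.comp (h1.prodMk continuous_snd)

/-- The field of endomorphisms, regarded as real linear. -/
def realField (A : SmoothMap U (V →L[𝕜] V)) : E → V →L[ℝ] V := fun x => (A x).restrictScalars ℝ

theorem contDiffOn_realField (A : SmoothMap U (V →L[𝕜] V)) :
    ContDiffOn ℝ ∞ (realField A) (U : Set E) :=
  (ContinuousLinearMap.restrictScalarsL 𝕜 V V ℝ ℝ).contDiff.comp_contDiffOn A.contDiffOn

theorem jet_transport_eq_zero (hUM : U ≤ M) {N : ℕ} (X : SmoothMap M E)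
    (A : SmoothMap U (V →L[𝕜] V)) {p : U} (hXp : X p = 0) {r : SmoothMap U V}
    (hr : jet N p r = 0) : jet N p (transport hUM X A r) = 0 := by
  rw [jet_eq_zero_iff] at hr ⊢
  intro j hj
  have h := iteratedFDeriv_transport_eq_zero U.isOpen p.2 (X.contDiffOn.mono hUM) hXp N V
    (realField A) r (contDiffOn_realField A) r.contDiffOn hr j hj
  have hev : (transport hUM X A r : E → V) =ᶠ[𝓝 (p : E)]
      fun x => fderiv ℝ r x (X x) + realField A x (r x) :=
    eventually_of_mem (U.isOpen.mem_nhds p.2) fun x hx => transport_apply hUM X A r hx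
  rw [(hev.iteratedFDeriv ℝ j).eq_of_nhds, h]

/-- u and the realization of its jet differ by a function with vanishing jet, which the operator
maps to another such function. So the jet of the image depends only on the jet of u. -/
theorem jet_transport [FiniteDimensional ℝ E] [FiniteDimensional ℝ V] (hUM : U ≤ M) {N : ℕ}
    (c : SmoothMap M E × SmoothMap U (V →L[𝕜] V)) {p : U} (hXp : c.1 p = 0) (u : SmoothMap U V) :
    jetSymbol hUM N c p (modelJet N p u) = modelJet N p (transport hUM c.1 c.2 u) := by
  have h := jet_transport_eq_zero hUM (N := N) c.1 c.2 hXp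
    (r := u - jetRealization U N p (modelJet N p u))
    (by rw [map_sub, jet_jetRealization, toJet_modelJet, sub_self])
  rw [transport_sub, map_sub, sub_eq_zero] at h
  apply (JetModel.toJet E V N).injective
  rw [toJet_jetSymbol, toJet_modelJet, h]

end Jets

/-! ### Trivial kernel, injectivity on jets, and solvability -/

section Solvability

universe u

variable {E : Type} [NormedAddCommGroup E] [NormedSpace ℝ E]
variable {E' : Type} [NormedAddCommGroup E'] [NormedSpace ℝ E']
variable {𝕜 : Type*} [RCLike 𝕜]
variable {V : Type u} [NormedAddCommGroup V] [NormedSpace ℝ V] [NormedSpace 𝕜 V]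
  [IsScalarTower ℝ 𝕜 V]
variable {M U : Opens E} {e : E ≃L[ℝ] E'} {c : SmoothMap M E × SmoothMap U (V →L[𝕜] V)} {p : U}
  {β : E → ℝ → E} {l a Λ r : ℝ} {N : ℕ}

theorem transport_eq_of_forall (hUM : U ≤ M) {u : E → V} (hu : ContDiffOn ℝ ∞ u (U : Set E))
    {v : SmoothMap U V}
    (h : ∀ x ∈ (U : Set E), fderiv ℝ u x (c.1 x) + realField c.2 x (u x) = v x) :
    transport hUM c.1 c.2 (SmoothMap.ofContDiffOn U u hu) = v := by
  refine SmoothMap.ext_on fun x hx => ?_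
  rw [transport_apply hUM _ _ _ hx, SmoothMap.ofContDiffOn_apply hu hx,
    (SmoothMap.ofContDiffOn_eventuallyEq hu hx).fderiv_eq]
  exact h x hx

variable [FiniteDimensional ℝ E]

theorem eq_zero_of_jet_eq_zero (hUM : U ≤ M)
    (h : TransportSetup e U p c.1 β (realField c.2) l a Λ r) (haN : 0 < a + r * N)
    {u : SmoothMap U V} (hu : jet N p u = 0) (hTu : transport hUM c.1 c.2 u = 0) : u = 0 := by
  refine SmoothMap.ext_on fun x hx => ?_
  refine h.eq_zero haN u.contDiffOn (jet_eq_zero_iff.1 hu) (fun y hy => ?_) x hx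
  have := transport_apply hUM c.1 c.2 u hy
  rw [hTu] at this
  exact this.symm

variable [FiniteDimensional ℝ V]

/-- Solvability of the transport equation modulo jets at the source. -/
theorem exists_transport_eq_of_jet_eq_zero (hUM : U ≤ M)
    (h : TransportSetup e U p c.1 β (realField c.2) l a Λ r) (haN : 0 < a + r * N)
    {v : SmoothMap U V} (hv : jet N p v = 0) :
    ∃ u : SmoothMap U V, jet N p u = 0 ∧ transport hUM c.1 c.2 u = v := by
  have : CompleteSpace V := FiniteDimensional.complete ℝ V
  obtain ⟨u, hu, hu0, huv⟩ := h.exists_solution haN v.contDiffOn (jet_eq_zero_iff.1 hv)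
  refine ⟨SmoothMap.ofContDiffOn U u hu, ?_, transport_eq_of_forall hUM hu huv⟩
  rw [jet_eq_zero_iff]
  intro j hj
  rw [SmoothMap.iteratedFDeriv_ofContDiffOn hu p.2, hu0 j hj]

/-- The jet of a kernel element is annihilated by the jet operator, hence zero; flat kernel elements
vanish. -/
theorem eq_zero_of_injective_jetSymbol (hUM : U ≤ M)
    (h : TransportSetup e U p c.1 β (realField c.2) l a Λ r) (haN : 0 < a + r * N)
    (hXp : c.1 p = 0) (hJ : Function.Injective (jetSymbol hUM N c p)) {u : SmoothMap U V}
    (hu : transport hUM c.1 c.2 u = 0) : u = 0 := by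
  refine eq_zero_of_jet_eq_zero hUM h haN ?_ hu
  have h1 := jet_transport hUM (N := N) c hXp u
  rw [hu, map_zero] at h1
  rw [← toJet_modelJet, hJ (h1.trans (map_zero _).symm), map_zero]

/-- A jet annihilated by the jet operator is corrected by a flat solution to the jet of a genuine
kernel element. -/
theorem injective_jetSymbol (hUM : U ≤ M)
    (h : TransportSetup e U p c.1 β (realField c.2) l a Λ r) (haN : 0 < a + r * N)
    (hker : ∀ u : SmoothMap U V, transport hUM c.1 c.2 u = 0 → u = 0) :
    Function.Injective (jetSymbol hUM N c p) := by
  rw [injective_iff_map_eq_zero]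
  intro j hj
  have h1 : jet N p (transport hUM c.1 c.2 (jetRealization U N p j)) = 0 :=
    (toJet_jetSymbol hUM N c p j).symm.trans (by rw [hj, map_zero])
  obtain ⟨w, hw0, hw⟩ := exists_transport_eq_of_jet_eq_zero hUM h haN h1
  have h2 := hker (jetRealization U N p j - w) (by rw [transport_sub, hw, sub_self])
  have h3 := congrArg (jet N p) h2
  rw [map_sub, hw0, sub_zero, map_zero, jet_jetRealization] at h3
  exact (JetModel.toJet E V N).injective (h3.trans (map_zero _).symm)

/-- In finite dimension injectivity gives surjectivity, so the jet of v can be matched first; the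
flat remainder is solved by the trajectory method. -/
theorem exists_transport_eq (hUM : U ≤ M)
    (h : TransportSetup e U p c.1 β (realField c.2) l a Λ r) (haN : 0 < a + r * N)
    (hJ : Function.Injective (jetSymbol hUM N c p)) (v : SmoothMap U V) :
    ∃ u, transport hUM c.1 c.2 u = v := by
  obtain ⟨j, hj⟩ := (LinearMap.injective_iff_surjective
    (f := (jetSymbol hUM N c p : JetModel E V N →ₗ[ℝ] JetModel E V N))).1 hJ
    (modelJet N p v)
  have h1 : jet N p (transport hUM c.1 c.2 (jetRealization U N p j)) = jet N p v :=
    (toJet_jetSymbol hUM N c p j).symm.trans (congrArg (JetModel.toJet E V N) hj)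
  obtain ⟨w, -, hw⟩ := exists_transport_eq_of_jet_eq_zero hUM h haN
    (v := v - transport hUM c.1 c.2 (jetRealization U N p j)) (by rw [map_sub, h1, sub_self])
  exact ⟨jetRealization U N p j + w, by rw [transport_add, hw]; abel⟩

end Solvability

/-! ### Sources with adapted coordinates and their persistence -/

section Adapted

universe u

variable {E : Type} [NormedAddCommGroup E] [NormedSpace ℝ E]
variable {E' : Type} [NormedAddCommGroup E'] [NormedSpace ℝ E']
variable {M U : Opens E}

/-- A source of `X` around which `U` is star-shaped, with coordinates in which `X` is expanding on a
ball of radius `R` contained in `U`. -/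
structure AdaptedSource (U : Opens E) (e : E ≃L[ℝ] E') (Λ c R : ℝ) (X : SmoothMap M E) (p : E) :
    Prop where
  pos : 0 < c
  radius_pos : 0 < R
  subset : {x | ‖e (x - p)‖ ≤ R} ⊆ (U : Set E)
  expands : ExpandsOn e Λ c X {x | ‖e (x - p)‖ ≤ R}
  zero : X p = 0
  star : IsStarShaped X (U : Set E) p

theorem AdaptedSource.mem {e : E ≃L[ℝ] E'} {Λ c R : ℝ} {X : SmoothMap M E} {p : E}
    (h : AdaptedSource U e Λ c R X p) : p ∈ U := h.star.1

theorem exists_coordBall_subset {e : E ≃L[ℝ] E'} {p : E} {W : Set E} (hW : W ∈ 𝓝 p) :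
    ∃ ρ > 0, {x | ‖e (x - p)‖ ≤ ρ} ⊆ W := by
  have h2 : Tendsto (fun y : E' => p + e.symm y) (𝓝 0) (𝓝 p) := by
    have : Tendsto (fun y : E' => p + e.symm y) (𝓝 0) (𝓝 (p + e.symm 0)) :=
      Continuous.tendsto (by fun_prop) 0
    simpa using this
  obtain ⟨R, hR, hRs⟩ := Metric.nhds_basis_closedBall.mem_iff.1 (h2 hW)
  refine ⟨R, hR, fun x hx => ?_⟩
  have h3 : e (x - p) ∈ Metric.closedBall (0 : E') R := by simpa using hx
  simpa using hRs h3

variable [FiniteDimensional ℝ E]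

/-- The adapted norm of the linearization at p works on a small ball by continuity of DX, at the
cost of half the rate. -/
theorem exists_adaptedSource (hUM : U ≤ M) {X : SmoothMap M E} (hX : X ∈ sourceFields M U) :
    ∃ (m : ℕ) (E' : Submodule ℝ (Fin m → E)) (e : E ≃L[ℝ] E') (Λ c R : ℝ) (p : E),
      AdaptedSource U e Λ c R X p := by
  obtain ⟨p, hp, ⟨hXp, hroots⟩, hstar⟩ := hX
  obtain ⟨m, E', e, Λ, c, hc, hL⟩ := exists_adapted_equiv (fderiv ℝ X p) hroots
  have hcont : ContinuousAt (fun x =>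
      ‖Λ • ContinuousLinearMap.id ℝ E' - inCoords e (fderiv ℝ X x)‖) p := by
    have h1 : ContinuousAt (fderiv ℝ X) p :=
      ((X.contDiffOn.fderiv_of_isOpen M.isOpen (m := ∞) (by simp)).continuousOn).continuousAt
        (M.isOpen.mem_nhds (hUM hp))
    exact (continuousAt_const.sub ((inCoordsL e).continuous.continuousAt.comp h1)).norm
  have hev : ∀ᶠ x in 𝓝 p, x ∈ U ∧
      ‖Λ • ContinuousLinearMap.id ℝ E' - inCoords e (fderiv ℝ X x)‖ < Λ - c / 2 :=
    Filter.Eventually.and (U.isOpen.mem_nhds hp)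
      (hcont.eventually (gt_mem_nhds (lt_of_le_of_lt hL (by linarith))))
  obtain ⟨R, hR, hRs⟩ := exists_coordBall_subset (e := e) hev
  exact ⟨m, E', e, Λ, c / 2, R, p, half_pos hc, hR, fun x hx => (hRs hx).1,
    fun x hx => ⟨X.differentiableAt (hUM (hRs hx).1), (hRs hx).2.le⟩, hXp, hstar⟩

/-- The crude damping l = 0 with rate -a only uses a norm bound for A p; a large order of vanishing
compensates for the negative rate. -/
theorem AdaptedSource.exists_transportSetup (hUM : U ≤ M) {e : E ≃L[ℝ] E'} {Λ c c' R a : ℝ}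
    {X : SmoothMap M E} {p : E} (h : AdaptedSource U e Λ c R X p) (hc' : 0 < c') (hcc : c' < c)
    {V : Type*} [NormedAddCommGroup V] [NormedSpace ℝ V] {A : E → V →L[ℝ] V}
    (hA : ContDiffOn ℝ ∞ A (U : Set E)) (hAp : ‖A p‖ ≤ a) :
    ∃ β, TransportSetup e (U : Set E) p X β A 0 (-a) Λ c' := by
  obtain ⟨β, hβ⟩ := exists_isBackwardFlow hUM hc' hcc h.radius_pos h.subset h.expands h.zero h.star
  refine ⟨β, U.isOpen, h.mem, hc', X.contDiffOn.mono hUM, hA, hβ, by simpa using hAp, ?_⟩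
  refine ((h.expands p ?_).2).trans (by linarith)
  simpa using h.radius_pos.le

/-- Membership in the interior provides a source p' and star-shapedness for every nearby field. The
source moves by at most R/8, so the ball of radius 3R/4 around it stays in the old region of
expansion. -/
theorem eventually_adaptedSource (hUM : U ≤ M) {e : E ≃L[ℝ] E'} {Λ c c' R ρ : ℝ}
    {X : SmoothMap M E} {p : E} (h : AdaptedSource U e Λ c R X p)
    (hX : X ∈ interior (sourceFields M U)) (hc' : 0 < c') (hcc : c' < c) (hρ : 0 < ρ) :
    ∀ᶠ X' in 𝓝 X, ∃ p', AdaptedSource U e Λ c' (3 * R / 4) X' p' ∧ ‖e (p' - p)‖ ≤ ρ := by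
  have hR := h.radius_pos
  filter_upwards [isOpen_interior.mem_nhds hX,
    eventually_expandsOn hcc (isCompact_coordBall e p R) (h.subset.trans hUM) h.expands,
    eventually_starPoint_near hUM hc' hcc h.radius_pos h.subset h.expands h.zero
      (lt_min hρ (show 0 < R / 8 by positivity)) ((min_le_right _ _).trans_lt (by linarith))]
    with X' hX' hexp hnear
  obtain ⟨p', hp', hsrc, hstar⟩ := interior_subset hX'
  have hpp := hnear p' hstar
  have hsub : {x | ‖e (x - p')‖ ≤ 3 * R / 4} ⊆ {x | ‖e (x - p)‖ ≤ R} := by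
    intro x hx
    have h1 := norm_coords_triangle e x p' p
    have h2 := hpp.trans (min_le_right _ _)
    simp only [mem_ofPred_eq] at hx ⊢
    linarith
  exact ⟨p', ⟨hc', by positivity, hsub.trans h.subset, hexp.mono hsub, hsrc.1, hstar⟩,
    hpp.trans (min_le_left _ _)⟩

end Adapted

/-! ### Openness of the regular data and unique solvability -/

section Openness

universe u

variable {E : Type} [NormedAddCommGroup E] [NormedSpace ℝ E]
variable {E' : Type} [NormedAddCommGroup E'] [NormedSpace ℝ E']
variable {𝕜 : Type*} [RCLike 𝕜]
variable {V : Type u} [NormedAddCommGroup V] [NormedSpace ℝ V] [NormedSpace 𝕜 V]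
  [IsScalarTower ℝ 𝕜 V]
variable {M U : Opens E} {e : E ≃L[ℝ] E'}

/-- Linear maps near an injective one are bounded below with a uniform constant. -/
theorem eventually_norm_le_mul_of_injective {W : Type*} [NormedAddCommGroup W] [NormedSpace ℝ W]
    [FiniteDimensional ℝ W] {J : W →L[ℝ] W} (hJ : Function.Injective J) :
    ∃ κ : ℝ, 0 ≤ κ ∧ ∀ᶠ J' in 𝓝 J, ∀ j, ‖j‖ ≤ κ * ‖J' j‖ := by
  obtain ⟨K, hK, hKJ⟩ := LinearMap.exists_antilipschitzWith (J : W →ₗ[ℝ] W)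
    (LinearMap.ker_eq_bot.2 hJ)
  have hK' : (0 : ℝ) < K := hK
  refine ⟨2 * K, by positivity, ?_⟩
  have hev : ∀ᶠ J' in 𝓝 J, ‖J' - J‖ < 1 / (2 * K) := by
    have : Tendsto (fun J' => ‖J' - J‖) (𝓝 J) (𝓝 ‖J - J‖) :=
      Continuous.tendsto (by fun_prop) J
    rw [sub_self, norm_zero] at this
    exact this.eventually (gt_mem_nhds (by positivity))
  filter_upwards [hev] with J' hJ' j
  have h1 : ‖j‖ ≤ K * ‖J j‖ := by
    simpa using hKJ.le_mul_dist j 0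
  have h2 : ‖J j‖ ≤ ‖J' j‖ + 1 / (2 * K) * ‖j‖ := by
    have h3 : J j = J' j - (J' - J) j := by simp
    rw [h3]
    refine (norm_sub_le _ _).trans (add_le_add le_rfl ?_)
    exact ((J' - J).le_opNorm j).trans (by gcongr)
  have h4 : K * (1 / (2 * K) * ‖j‖) = ‖j‖ / 2 := by field_simp
  nlinarith [mul_le_mul_of_nonneg_left h2 hK'.le]

theorem norm_realField (A : SmoothMap U (V →L[𝕜] V)) (x : E) : ‖realField A x‖ = ‖A x‖ :=
  ContinuousLinearMap.norm_restrictScalars _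

theorem exists_norm_field_le {A₀ : SmoothMap U (V →L[𝕜] V)} {K : Set E} (hK : IsCompact K)
    (hKU : K ⊆ U) : ∃ a : ℝ, ∀ᶠ A in 𝓝 A₀, ∀ x ∈ K, ‖A x‖ ≤ a := by
  obtain ⟨a, ha⟩ := A₀.eventually_norm_le 0 hK hKU
  refine ⟨a, ha.mono fun A hA x hx => ?_⟩
  simpa using hA 0 le_rfl x hx

variable [FiniteDimensional ℝ E] [FiniteDimensional ℝ V]

/-- Near regular data, the operator on jets at the nearby source is uniformly injective. -/
theorem exists_uniform_jetSymbol_bound (hUM : U ≤ M)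
    {c₀ : SmoothMap M E × SmoothMap U (V →L[𝕜] V)} {p₀ : E} {Λ r r' R a : ℝ} {N : ℕ}
    (h : AdaptedSource U e Λ r R c₀.1 p₀) (hr' : 0 < r') (hrr : r' < r)
    (hA : ‖c₀.2 p₀‖ ≤ a) (haN : 0 < -a + r' * N)
    (hker : ∀ u : SmoothMap U V, transport hUM c₀.1 c₀.2 u = 0 → u = 0) :
    ∃ κ : ℝ, 0 ≤ κ ∧ ∃ ρ > 0, ∀ᶠ c in 𝓝 c₀, ∀ p : U, ‖e (p - p₀)‖ ≤ ρ →
      ∀ j, ‖j‖ ≤ κ * ‖jetSymbol (𝕜 := 𝕜) (V := V) hUM N c p j‖ := by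
  obtain ⟨β, hβ⟩ := h.exists_transportSetup hUM hr' hrr (contDiffOn_realField c₀.2)
    ((norm_realField c₀.2 p₀).trans_le hA)
  have hinj : Function.Injective (jetSymbol hUM N c₀ ⟨p₀, h.mem⟩) :=
    injective_jetSymbol (p := ⟨p₀, h.mem⟩) hUM hβ haN hker
  obtain ⟨κ, hκ, hev⟩ := eventually_norm_le_mul_of_injective hinj
  have hev' : ∀ᶠ s : (SmoothMap M E × SmoothMap U (V →L[𝕜] V)) × U in 𝓝 (c₀, ⟨p₀, h.mem⟩),
      ∀ j, ‖j‖ ≤ κ * ‖jetSymbol hUM N s.1 s.2 j‖ :=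
    ((continuous_jetSymbol hUM N).tendsto (c₀, ⟨p₀, h.mem⟩)).eventually hev
  rw [nhds_prod_eq] at hev'
  obtain ⟨P, hP, P', hP', hPP'⟩ := eventually_prod_iff.1 hev'
  rw [nhds_subtype_eq_comap] at hP'
  obtain ⟨W', hW', hW'W⟩ := mem_comap.1 hP'
  obtain ⟨ρ, hρ, hρW⟩ := exists_coordBall_subset (e := e) hW'
  refine ⟨κ, hκ, ρ, hρ, ?_⟩
  filter_upwards [hP] with c hc p hp
  exact hPP' hc (hW'W (hρW hp))

/-- All data near regular data have a nearby adapted source, at which the transport equation is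
uniformly controlled on jets. -/
theorem exists_uniform_source (hUM : U ≤ M) {c₀ : SmoothMap M E × SmoothMap U (V →L[𝕜] V)}
    (hc₀ : c₀ ∈ regularData 𝕜 V hUM) {p₀ : E} {Λ r R : ℝ}
    (h : AdaptedSource U e Λ r R c₀.1 p₀) :
    ∃ (a κ : ℝ) (N : ℕ), 0 ≤ κ ∧ 0 < -a + r / 3 * N ∧ ∀ ρ > 0, ∀ᶠ c in 𝓝 c₀, ∃ p : U,
      AdaptedSource U e Λ (2 * r / 3) (3 * R / 4) c.1 p ∧ ‖e (p - p₀)‖ ≤ ρ ∧ ‖c.2 p‖ ≤ a ∧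
      ∀ j, ‖j‖ ≤ κ * ‖jetSymbol (𝕜 := 𝕜) (V := V) hUM N c p j‖ := by
  have hr := h.pos
  have hR := h.radius_pos
  obtain ⟨a, ha⟩ := exists_norm_field_le (A₀ := c₀.2) (isCompact_coordBall e p₀ R) h.subset
  have hA₀ : ‖c₀.2 p₀‖ ≤ a := ha.self_of_nhds p₀ (by simpa using hR.le)
  -- N is chosen for the rate r/3. Nearby fields expand at rate 2r/3, which leaves room for the
  -- strict loss in constructing their backward flow.
  obtain ⟨N, hN⟩ := exists_nat_gt (a / (r / 3))
  have haN : 0 < -a + r / 3 * N := by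
    rw [div_lt_iff₀ (by positivity)] at hN
    linarith
  obtain ⟨κ, hκ, ρ₀, hρ₀, hκρ⟩ := exists_uniform_jetSymbol_bound hUM h
    (show 0 < r / 3 by positivity) (by linarith) hA₀ haN hc₀.2
  refine ⟨a, κ, N, hκ, haN, fun ρ hρ => ?_⟩
  have h1 := (continuous_fst.tendsto c₀).eventually (eventually_adaptedSource (c' := 2 * r / 3)
    hUM h hc₀.1 (by positivity) (by linarith) (lt_min (lt_min hρ hρ₀) hR))
  have h2 := (continuous_snd.tendsto c₀).eventually ha
  filter_upwards [h1, h2, hκρ] with c h1 h2 h3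
  obtain ⟨p, hp, hpρ⟩ := h1
  refine ⟨⟨p, hp.mem⟩, hp, hpρ.trans ((min_le_left _ _).trans (min_le_left _ _)), ?_, ?_⟩
  · exact h2 p (hpρ.trans (min_le_right _ _))
  · exact h3 ⟨p, hp.mem⟩ (hpρ.trans ((min_le_left _ _).trans (min_le_right _ _)))

theorem injective_of_norm_le_mul {W : Type*} [NormedAddCommGroup W] [NormedSpace ℝ W]
    {J : W →L[ℝ] W} {κ : ℝ} (h : ∀ j, ‖j‖ ≤ κ * ‖J j‖) : Function.Injective J := by
  rw [injective_iff_map_eq_zero]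
  intro j hj
  have := h j
  rw [hj, norm_zero, mul_zero] at this
  exact norm_le_zero_iff.1 this

/-- The jet operator stays bounded below at the nearby sources, with the same N, and injectivity on
jets forces a trivial kernel. -/
theorem isOpen_regularData (hUM : U ≤ M) : IsOpen (regularData 𝕜 V hUM) := by
  rw [isOpen_iff_mem_nhds]
  intro c₀ hc₀
  obtain ⟨m, E', e, Λ, r, R, p₀, h⟩ := exists_adaptedSource hUM (interior_subset hc₀.1)
  obtain ⟨a, κ, N, hκ, haN, hev⟩ := exists_uniform_source hUM hc₀ h
  have hr := h.pos
  filter_upwards [hev 1 one_pos,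
    (continuous_fst.tendsto c₀).eventually (isOpen_interior.mem_nhds hc₀.1)] with c hc hcint
  obtain ⟨p, hp, -, hA, hJ⟩ := hc
  obtain ⟨β, hβ⟩ := hp.exists_transportSetup hUM (show 0 < r / 3 by positivity) (by linarith)
    (contDiffOn_realField c.2) ((norm_realField c.2 p).trans_le hA)
  exact ⟨hcint, fun u hu => eq_zero_of_injective_jetSymbol hUM hβ haN hp.zero
    (injective_of_norm_le_mul hJ) hu⟩

theorem existsUnique_transport_eq (hUM : U ≤ M) {c : SmoothMap M E × SmoothMap U (V →L[𝕜] V)}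
    (hc : c ∈ regularData 𝕜 V hUM) (v : SmoothMap U V) :
    ∃! u : SmoothMap U V, transport hUM c.1 c.2 u = v := by
  obtain ⟨m, E', e, Λ, r, R, p₀, h⟩ := exists_adaptedSource hUM (interior_subset hc.1)
  obtain ⟨a, κ, N, hκ, haN, hev⟩ := exists_uniform_source hUM hc h
  have hr := h.pos
  obtain ⟨p, hp, -, hA, hJ⟩ := (hev 1 one_pos).self_of_nhds
  obtain ⟨β, hβ⟩ := hp.exists_transportSetup hUM (show 0 < r / 3 by positivity) (by linarith)
    (contDiffOn_realField c.2) ((norm_realField c.2 p).trans_le hA)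
  obtain ⟨u, hu⟩ := exists_transport_eq hUM hβ haN (injective_of_norm_le_mul hJ) v
  refine ⟨u, hu, fun w hw => ?_⟩
  have hw' : transport hUM c.1 c.2 w = v := hw
  exact sub_eq_zero.1 (hc.2 (w - u) (by rw [transport_sub, hw', hu, sub_self]))

end Openness

/-! ### Uniform bounds for coefficients, operator and jet realizations -/

section Apriori

set_option maxSynthPendingDepth 5

universe u

variable {E : Type} [NormedAddCommGroup E] [NormedSpace ℝ E]
variable {F : Type*} [NormedAddCommGroup F] [NormedSpace ℝ F]
variable {𝕜 : Type*} [RCLike 𝕜]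
variable {V : Type u} [NormedAddCommGroup V] [NormedSpace ℝ V] [NormedSpace 𝕜 V]
  [IsScalarTower ℝ 𝕜 V]
variable {M U : Opens E}

/-- The mean value inequality holds within the ball. Outside it the distance is at least ϱ, so 2B ≤
(2B/ϱ)‖x - p‖ and no convexity of Z is needed. -/
theorem norm_sub_le_mul_of_bounds {Z : Set E} {p : E} {f : E → F} {ϱ B : ℝ} (hϱ : 0 < ϱ)
    (hf : ∀ x ∈ Metric.ball p ϱ, DifferentiableAt ℝ f x)
    (hfd : ∀ x ∈ Metric.ball p ϱ, ‖fderiv ℝ f x‖ ≤ B) (hp : ‖f p‖ ≤ B)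
    (hZ : ∀ x ∈ Z, ‖f x‖ ≤ B) : ∀ x ∈ Z, ‖f x - f p‖ ≤ (B + 2 * B / ϱ) * ‖x - p‖ := by
  intro x hx
  have hB : 0 ≤ B := (norm_nonneg _).trans hp
  by_cases hxr : x ∈ Metric.ball p ϱ
  · have h1 := (convex_ball p ϱ).norm_image_sub_le_of_norm_fderiv_le hf hfd
      (Metric.mem_ball_self hϱ) hxr
    have h2 : 0 ≤ 2 * B / ϱ * ‖x - p‖ := by positivity
    linarith
  · have hxr' : ϱ ≤ ‖x - p‖ := by simpa [dist_eq_norm] using hxr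
    have h1 : 2 * B ≤ 2 * B / ϱ * ‖x - p‖ := by
      rw [div_mul_eq_mul_div, le_div_iff₀ hϱ]
      gcongr
    have h2 : 0 ≤ B * ‖x - p‖ := by positivity
    linarith [norm_sub_le (f x) (f p), hZ x hx]

theorem norm_iteratedFDeriv_realField_le (A : SmoothMap U (V →L[𝕜] V)) {x : E} (hx : x ∈ U)
    (j : ℕ) : ‖iteratedFDeriv ℝ j (realField A) x‖ ≤
      ‖ContinuousLinearMap.restrictScalarsL 𝕜 V V ℝ ℝ‖ * ‖iteratedFDeriv ℝ j A x‖ :=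
  norm_iteratedFDeriv_clm_comp_le (ContinuousLinearMap.restrictScalarsL 𝕜 V V ℝ ℝ)
    (A.contDiffAt hx)

theorem norm_iteratedFDeriv_bilinear_le_of_bounds {G H : Type*} [NormedAddCommGroup G]
    [NormedSpace ℝ G] [NormedAddCommGroup H] [NormedSpace ℝ H] (B : F →L[ℝ] G →L[ℝ] H) {f : E → F}
    {g : E → G} {m i : ℕ} {C D : ℝ} {S : Set E} (hS : IsOpen S) (hf : ContDiffOn ℝ ∞ f S)
    (hg : ContDiffOn ℝ ∞ g S) {x : E} (hx : x ∈ S) (him : i ≤ m)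
    (hC : ∀ l ≤ m, ‖iteratedFDeriv ℝ l f x‖ ≤ C) (hD : ∀ l ≤ m, ‖iteratedFDeriv ℝ l g x‖ ≤ D) :
    ‖iteratedFDeriv ℝ i (fun y => B (f y) (g y)) x‖ ≤ ‖B‖ * (2 ^ m * (C * D)) := by
  have hle : ((i : ℕ∞) : WithTop ℕ∞) ≤ ∞ := by exact_mod_cast le_top
  have hC0 : 0 ≤ C := (norm_nonneg _).trans (hC 0 (Nat.zero_le _))
  have hD0 : 0 ≤ D := (norm_nonneg _).trans (hD 0 (Nat.zero_le _))
  refine (norm_iteratedFDeriv_bilinear_le B hS (hf.of_le hle) (hg.of_le hle) hx).trans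
    (mul_le_mul_of_nonneg_left ?_ (norm_nonneg _))
  calc _ ≤ ∑ l ∈ Finset.range (i + 1), ((i.choose l : ℝ) * (C * D)) := by
        refine Finset.sum_le_sum fun l hl => ?_
        have hl' : l ≤ i := by simpa [Nat.lt_succ_iff] using hl
        rw [mul_assoc]
        gcongr
        · exact hC l (by omega)
        · exact hD (i - l) (by omega)
    _ = 2 ^ i * (C * D) := by
        rw [← Finset.sum_mul]
        congr 1
        exact_mod_cast Nat.sum_range_choose i
    _ ≤ _ := by
        gcongr
        norm_num

/-- Boundedness of the transport operator, with uniform constant. -/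
theorem norm_iteratedFDeriv_transport_le (hUM : U ≤ M) (X : SmoothMap M E)
    (A : SmoothMap U (V →L[𝕜] V)) {f : SmoothMap U V} {m i : ℕ} {C B : ℝ} {x : E} (hx : x ∈ U)
    (him : i ≤ m) (hX : ∀ l ≤ m, ‖iteratedFDeriv ℝ l X x‖ ≤ C)
    (hA : ∀ l ≤ m, ‖iteratedFDeriv ℝ l (realField A) x‖ ≤ C)
    (hf : ∀ l ≤ m + 1, ‖iteratedFDeriv ℝ l f x‖ ≤ B) :
    ‖iteratedFDeriv ℝ i (transport hUM X A f) x‖ ≤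
      (‖ContinuousLinearMap.id ℝ (E →L[ℝ] V)‖ + ‖ContinuousLinearMap.id ℝ (V →L[ℝ] V)‖) *
        (2 ^ m * C) * B := by
  have hle : ((i : ℕ∞) : WithTop ℕ∞) ≤ ∞ := by exact_mod_cast le_top
  have hXU := X.contDiffOn.mono hUM
  have hfd : ContDiffOn ℝ ∞ (fderiv ℝ f) (U : Set E) :=
    f.contDiffOn.fderiv_of_isOpen U.isOpen (by simp)
  have hev : (transport hUM X A f : E → V) =ᶠ[𝓝 x]
      fun y => (fun y => ContinuousLinearMap.id ℝ (E →L[ℝ] V) (fderiv ℝ f y) (X y)) y +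
        (fun y => ContinuousLinearMap.id ℝ (V →L[ℝ] V) (realField A y) (f y)) y :=
    eventually_of_mem (U.isOpen.mem_nhds hx) fun y hy => transport_apply hUM X A f hy
  rw [(hev.iteratedFDeriv ℝ i).eq_of_nhds]
  have h1 := norm_iteratedFDeriv_bilinear_le_of_bounds (ContinuousLinearMap.id ℝ (E →L[ℝ] V))
    U.isOpen hfd hXU hx him (C := B) (D := C)
    (fun l hl => by rw [norm_iteratedFDeriv_fderiv]; exact hf (l + 1) (by omega)) hX
  have h2 := norm_iteratedFDeriv_bilinear_le_of_bounds (ContinuousLinearMap.id ℝ (V →L[ℝ] V))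
    U.isOpen (contDiffOn_realField A) f.contDiffOn hx him (C := C) (D := B) hA
    (fun l hl => hf l (by omega))
  have hadd := iteratedFDeriv_add_apply (i := i) (𝕜 := ℝ)
    (f := fun y => ContinuousLinearMap.id ℝ (E →L[ℝ] V) (fderiv ℝ f y) (X y))
    (g := fun y => ContinuousLinearMap.id ℝ (V →L[ℝ] V) (realField A y) (f y))
    (((hfd.clm_apply hXU).contDiffAt (U.isOpen.mem_nhds hx)).of_le hle)
    ((((contDiffOn_realField A).clm_apply f.contDiffOn).contDiffAt (U.isOpen.mem_nhds hx)).of_le hle)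
  refine (congrArg norm hadd).trans_le ((norm_add_le _ _).trans ((add_le_add h1 h2).trans_eq ?_))
  ring

/-- A linear map on a finite-dimensional space is continuous, so the derivatives are bounded for
small j; scaling j gives the linear bound. -/
theorem exists_jetSection_bound [FiniteDimensional ℝ E] [FiniteDimensional ℝ V] (N m : ℕ)
    {K : Set E} (hK : IsCompact K) : ∃ Q : ℝ, 0 ≤ Q ∧ ∀ (j : JetModel E V N), ∀ i ≤ m, ∀ y ∈ K,
      ‖iteratedFDeriv ℝ i (jetSection E V N j) y‖ ≤ Q * ‖j‖ := by
  have hcont : Continuous (jetSection E V N) := LinearMap.continuous_of_finiteDimensional _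
  obtain ⟨C, hC⟩ := (0 : SmoothMap (⊤ : Opens E) V).eventually_norm_le m hK (subset_univ _)
  have ht : Tendsto (jetSection E V N) (𝓝 0) (𝓝 0) := by
    have := hcont.tendsto 0
    rwa [map_zero] at this
  obtain ⟨δ, hδ, hδC⟩ := Metric.eventually_nhds_iff.1 (ht.eventually hC)
  refine ⟨|C| * (2 / δ), by positivity, fun j i hi y hy => ?_⟩
  rcases eq_or_ne j 0 with rfl | hj
  · have h0 : iteratedFDeriv ℝ i (jetSection E V N 0) y = 0 := by
      rw [map_zero]
      have := iteratedFDeriv_fun_zero (𝕜 := ℝ) (E := E) (F := V) (n := i)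
      exact congrFun this y
    rw [h0, norm_zero, norm_zero, mul_zero]
  have hj0 : 0 < ‖j‖ := norm_pos_iff.2 hj
  set t : ℝ := δ / 2 / ‖j‖ with ht'
  have ht0 : 0 < t := by positivity
  have h1 := hδC (y := t • j) (by
    rw [dist_zero_right, norm_smul, Real.norm_of_nonneg ht0.le, ht', div_mul_cancel₀ _ hj0.ne']
    linarith) i hi y hy
  have h2 : iteratedFDeriv ℝ i (jetSection E V N (t • j)) y =
      t • iteratedFDeriv ℝ i (jetSection E V N j) y := by
    rw [map_smul]
    exact iteratedFDeriv_const_smul_apply ((jetSection E V N j).contDiffAt (Opens.mem_top y))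
  rw [h2, norm_smul, Real.norm_of_nonneg ht0.le] at h1
  have h3 : ‖iteratedFDeriv ℝ i (jetSection E V N j) y‖ ≤ |C| / t := by
    rw [le_div_iff₀ ht0, mul_comm]
    exact h1.trans (le_abs_self _)
  refine h3.trans_eq ?_
  rw [ht']
  field_simp

end Apriori

/-! ### The locally uniform a priori estimate -/

section Uniform

set_option maxSynthPendingDepth 5

universe u

variable {E : Type} [NormedAddCommGroup E] [NormedSpace ℝ E]
variable {E' : Type} [NormedAddCommGroup E'] [NormedSpace ℝ E']
variable {𝕜 : Type*} [RCLike 𝕜]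
variable {V : Type u} [NormedAddCommGroup V] [NormedSpace ℝ V] [NormedSpace 𝕜 V]
  [IsScalarTower ℝ 𝕜 V]
variable {M U : Opens E} {e : E ≃L[ℝ] E'}

/-- The points of `K₀` whose backward trajectory stays in `K₀` and is close to `p` after time `T`. -/
def attractedSet (e : E ≃L[ℝ] E') (X : E → E) (K₀ : Set E) (p : E) (T R : ℝ) : Set E :=
  {x | ∃ β : ℝ → E, β 0 = x ∧ IsBackwardCurve X β ∧
    ∀ s, 0 ≤ s → β s ∈ K₀ ∧ (T ≤ s → ‖e (β s - p)‖ ≤ R / 2)}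

theorem attractedSet_subset {X : E → E} {K₀ : Set E} {p : E} {T R : ℝ} :
    attractedSet e X K₀ p T R ⊆ K₀ := by
  rintro x ⟨β, rfl, -, h⟩
  exact (h 0 le_rfl).1

/-- The attracted set is invariant under the backward flow by construction, which K₀ itself need not
be. This is what the weighted estimate requires of Z. -/
theorem exists_attracted {X : E → E} {K₀ : Set E} {p : E} {T R Λ r D : ℝ} (hr : 0 ≤ r) (hR : 0 < R)
    (hT : 0 ≤ T) (hD : 0 ≤ D) (hexp : ExpandsOn e Λ r X {x | ‖e (x - p)‖ ≤ 3 * R / 4})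
    (hXp : X p = 0) (hK₀D : ∀ x ∈ K₀, ‖x - p‖ ≤ D) :
    ∀ x ∈ attractedSet e X K₀ p T R, ∃ β : ℝ → E, β 0 = x ∧ IsBackwardCurve X β ∧ ∀ s, 0 ≤ s →
      β s ∈ attractedSet e X K₀ p T R ∧
        ‖β s - p‖ ≤ decayConst e r R T D * Real.exp (-r * s) * ‖x - p‖ := by
  rintro x ⟨β, rfl, hβ, h⟩
  refine ⟨β, rfl, hβ, fun s hs => ⟨⟨fun t => β (s + t), by simp, hβ.shift hs, fun t ht => ?_⟩, ?_⟩⟩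
  · exact ⟨(h (s + t) (by positivity)).1, fun hTt => (h (s + t) (by positivity)).2 (by linarith)⟩
  · exact norm_sub_le_exp_of_tail hr hR hT hD hexp hXp hβ
      (fun s hs => hK₀D _ (h s hs).1) (fun s hs => (h s (hT.trans hs)).2 hs) s hs

/-- Uniform control of the coefficients of the transport equation in terms of bounds on their
derivatives. -/
theorem transportControl_of_bounds (hUM : U ≤ M)
    {c : SmoothMap M E × SmoothMap U (V →L[𝕜] V)} {p : E} {Λ r R T D B ϱ a Q : ℝ}
    {k : ℕ} {K₀ K₁ : Set E} (hr : 0 < r) (hR : 0 < R) (hT : 0 ≤ T) (hD : 0 ≤ D) (hϱ : 0 < ϱ)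
    (h : AdaptedSource U e Λ r (3 * R / 4) c.1 p) (hK₀ : K₀ ⊆ K₁) (hK₁ : K₁ ⊆ U)
    (hball : Metric.ball p ϱ ⊆ K₁) (hK₁D : ∀ x ∈ K₁, ‖x - p‖ ≤ D)
    (hX : ∀ j ≤ k + 2, ∀ x ∈ K₁, ‖iteratedFDeriv ℝ j c.1 x‖ ≤ B)
    (hA : ∀ j ≤ k + 2, ∀ x ∈ K₁, ‖iteratedFDeriv ℝ j (realField c.2) x‖ ≤ B)
    (hAp : ‖c.2 p‖ ≤ a) (hDQ : D ≤ Q) (hBQ : B + 2 * B / ϱ ≤ Q) :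
    TransportControl e (U : Set E) (attractedSet e c.1 K₀ p T R) p c.1 (realField c.2) k Q
      (decayConst e r R T D) 0 (-a) Λ r := by
  have hZ : attractedSet e c.1 K₀ p T R ⊆ K₁ := attractedSet_subset.trans hK₀
  have hpK : p ∈ K₁ := hball (Metric.mem_ball_self hϱ)
  have hB0 : 0 ≤ B := (norm_nonneg _).trans (hX 0 (Nat.zero_le _) p hpK)
  have hBQ' : B ≤ Q := by
    have : 0 ≤ 2 * B / ϱ := by positivity
    linarith
  have hfX : ∀ x ∈ K₁, ‖fderiv ℝ c.1 x‖ ≤ B := fun x hx => by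
    have := hX 1 (by omega) x hx
    rwa [← norm_iteratedFDeriv_fderiv, norm_iteratedFDeriv_zero] at this
  have hffX : ∀ x ∈ K₁, ‖fderiv ℝ (fderiv ℝ c.1) x‖ ≤ B := fun x hx => by
    have := hX 2 (by omega) x hx
    rwa [← norm_iteratedFDeriv_fderiv, ← norm_iteratedFDeriv_fderiv,
      norm_iteratedFDeriv_zero] at this
  have hfA : ∀ x ∈ K₁, ‖fderiv ℝ (realField c.2) x‖ ≤ B := fun x hx => by
    have := hA 1 (by omega) x hx
    rwa [← norm_iteratedFDeriv_fderiv, norm_iteratedFDeriv_zero] at this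
  have hA0 : ∀ x ∈ K₁, ‖realField c.2 x‖ ≤ B := fun x hx => by
    simpa using hA 0 (by omega) x hx
  have hXs : ContDiffOn ℝ ∞ c.1 (U : Set E) := c.1.contDiffOn.mono hUM
  have hXfs : ContDiffOn ℝ ∞ (fderiv ℝ c.1) (U : Set E) :=
    hXs.fderiv_of_isOpen U.isOpen (by simp)
  refine ⟨U.isOpen, hZ.trans hK₁, hXs, contDiffOn_realField c.2,
    exists_attracted hr.le hR hT hD h.expands h.zero (fun x hx => hK₁D x (hK₀ hx)),
    fun x hx => (hK₁D x (hZ hx)).trans hDQ, fun j hj x hx => (hA j (by omega) x (hZ hx)).trans hBQ',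
    fun x hx => ?_, fun x hx => ?_, fun j hj x hx => (hX j (by omega) x (hZ hx)).trans hBQ', ?_, ?_⟩
  · refine (norm_sub_le_mul_of_bounds (Z := K₁) hϱ (fun y hy =>
      ((contDiffOn_realField c.2).contDiffAt
        (U.isOpen.mem_nhds (hK₁ (hball hy)))).differentiableAt (by simp))
      (fun y hy => hfA y (hball hy)) (hA0 p hpK) hA0 x (hZ hx)).trans (by gcongr)
  · refine (norm_sub_le_mul_of_bounds (Z := K₁) hϱ (fun y hy =>
      (hXfs.contDiffAt (U.isOpen.mem_nhds (hK₁ (hball hy)))).differentiableAt (by simp))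
      (fun y hy => hffX y (hball hy)) (hfX p hpK) hfX x (hZ hx)).trans (by gcongr)
  · simpa [norm_realField] using hAp
  · refine (h.expands p ?_).2
    simpa using h.radius_pos.le

variable [FiniteDimensional ℝ E] [FiniteDimensional ℝ V]

/-- The a priori estimate: near regular data, solutions are controlled by the right-hand side on
compact sets, with locally uniform constants. -/
theorem exists_apriori_estimate (hUM : U ≤ M) {c₀ : SmoothMap M E × SmoothMap U (V →L[𝕜] V)}
    (hc₀ : c₀ ∈ regularData 𝕜 V hUM) {K : Set E} (hK : IsCompact K) (hKU : K ⊆ U) (k : ℕ) :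
    ∃ K₁, IsCompact K₁ ∧ K₁ ⊆ (U : Set E) ∧ ∃ (m : ℕ) (Q : ℝ), 0 ≤ Q ∧ ∀ᶠ c in 𝓝 c₀,
      ∀ (u : SmoothMap U V) (B : ℝ), 0 ≤ B →
        (∀ j ≤ m, ∀ x ∈ K₁, ‖iteratedFDeriv ℝ j (transport hUM c.1 c.2 u) x‖ ≤ B) →
        ∀ j ≤ k, ∀ x ∈ K, ‖iteratedFDeriv ℝ j u x‖ ≤ Q * B := by
  obtain ⟨m₀, E', e, Λ, r, R, p₀, h⟩ := exists_adaptedSource hUM (interior_subset hc₀.1)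
  obtain ⟨a, κ, N, hκ, haN, hev⟩ := exists_uniform_source hUM hc₀ h
  have hr := h.pos
  have hR := h.radius_pos
  have hr3 : 0 < r / 3 := by positivity
  obtain ⟨K₀, hK₀, hK₀U, T, hT, htraj⟩ := exists_compact_trajectory_bound (c := r / 3) hUM hr3
    (by linarith) hR h.subset h.expands h.star hK hKU
  set S : Set E := {x | ‖e (x - p₀)‖ ≤ R} with hS
  have hSc : IsCompact S := isCompact_coordBall e p₀ R
  set K₁ : Set E := K₀ ∪ S with hK₁
  have hK₁c : IsCompact K₁ := hK₀.union hSc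
  have hK₁U : K₁ ⊆ U := union_subset hK₀U h.subset
  obtain ⟨D₀, hD₀1, hD₀⟩ := exists_norm_sub_le_of_isCompact hK₁c p₀
  -- The source p of a nearby field also lies in K₁, so distances to p are at most twice the bound
  -- for distances to p₀.
  set D : ℝ := 2 * D₀ with hD
  have hD1 : 1 ≤ D := by linarith
  set ne : ℝ := ‖(e : E →L[ℝ] E')‖ with hne
  have hne0 : 0 ≤ ne := norm_nonneg _
  -- The ball of this radius around any p within R/8 of p₀ stays in S; the bound 1 is required by
  -- the weighted Taylor estimate.
  set ϱ : ℝ := min 1 (R / 2 / (ne + 1)) with hϱ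
  have hϱ0 : 0 < ϱ := lt_min one_pos (by positivity)
  -- Order k is needed on Z, and order N for the jet and the Taylor expansion at p.
  set m : ℕ := max k N with hm
  obtain ⟨CX, hCX⟩ := c₀.1.eventually_norm_le (m + 2) hK₁c (hK₁U.trans hUM)
  obtain ⟨CA, hCA⟩ := c₀.2.eventually_norm_le (m + 2) hK₁c hK₁U
  set B₁ : ℝ := |CX| + ‖ContinuousLinearMap.restrictScalarsL 𝕜 V V ℝ ℝ‖ * |CA| with hB₁
  have hL0 := norm_nonneg (ContinuousLinearMap.restrictScalarsL 𝕜 V V ℝ ℝ)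
  have hB₁0 : 0 ≤ B₁ := by positivity
  set Q₀ : ℝ := D + (B₁ + 2 * B₁ / ϱ) with hQ₀
  have hQ₀B : 0 ≤ B₁ + 2 * B₁ / ϱ := by positivity
  have hCdec := decayConst_nonneg e (r / 3) T hR.le (show 0 ≤ D by linarith)
  obtain ⟨Q₁, hQ₁0, hQ₁⟩ := exists_weighted_estimate e k V N Q₀ (decayConst e (r / 3) R T D) 0 (-a)
    Λ (r / 3) (by linarith) hCdec hr3 haN
  obtain ⟨Q₂, hQ₂0, hQ₂⟩ := exists_jetSection_bound (V := V) N (m + 1)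
    (isCompact_closedBall (0 : E) D)
  set Q₃ : ℝ := (‖ContinuousLinearMap.id ℝ (E →L[ℝ] V)‖ + ‖ContinuousLinearMap.id ℝ (V →L[ℝ] V)‖) *
    (2 ^ m * B₁) with hQ₃
  have hQ₃0 : 0 ≤ Q₃ := by
    have h1 := norm_nonneg (ContinuousLinearMap.id ℝ (E →L[ℝ] V))
    have h2 := norm_nonneg (ContinuousLinearMap.id ℝ (V →L[ℝ] V))
    positivity
  set Q₄ : ℝ := 1 + Q₃ * (Q₂ * κ) with hQ₄
  have hQ₄0 : 0 ≤ Q₄ := by positivity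
  refine ⟨K₁, hK₁c, hK₁U, m, Q₁ * (Q₄ / ϱ ^ N) * D ^ N + Q₂ * κ, by positivity, ?_⟩
  filter_upwards [hev (R / 8) (by positivity), (continuous_fst.tendsto c₀).eventually htraj,
    (continuous_fst.tendsto c₀).eventually hCX, (continuous_snd.tendsto c₀).eventually hCA]
    with c hsrc htraj hCX hCA u B hB hv
  obtain ⟨p, hp, hpp, hAp, hJ⟩ := hsrc
  have hXB : ∀ j ≤ m + 2, ∀ x ∈ K₁, ‖iteratedFDeriv ℝ j c.1 x‖ ≤ B₁ := fun j hj x hx => by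
    have h1 := (hCX j hj x hx).trans (le_abs_self _)
    have h2 : 0 ≤ ‖ContinuousLinearMap.restrictScalarsL 𝕜 V V ℝ ℝ‖ * |CA| := by positivity
    linarith
  have hAB : ∀ j ≤ m + 2, ∀ x ∈ K₁, ‖iteratedFDeriv ℝ j (realField c.2) x‖ ≤ B₁ :=
    fun j hj x hx => by
      have h1 := (hCA j hj x hx).trans (le_abs_self _)
      have h2 := norm_iteratedFDeriv_realField_le c.2 (hK₁U hx) j
      have h3 := h2.trans (mul_le_mul_of_nonneg_left h1 hL0)
      have h4 := abs_nonneg CX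
      linarith
  have hpS : (p : E) ∈ S := by
    simp only [hS, mem_ofPred_eq]
    linarith
  have hpK : (p : E) ∈ K₁ := Or.inr hpS
  have hball : Metric.ball (p : E) ϱ ⊆ K₁ := by
    intro x hx
    refine Or.inr ?_
    have h1 : ‖x - p‖ < R / 2 / (ne + 1) := by
      have := (mem_ball_iff_norm.1 hx)
      exact this.trans_le (min_le_right _ _)
    have h2 : ‖e (x - p)‖ ≤ ne * ‖x - p‖ := (e : E →L[ℝ] E').le_opNorm _
    have h3 : (ne + 1) * ‖x - p‖ ≤ R / 2 := by
      rw [lt_div_iff₀ (by positivity)] at h1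
      linarith
    have h4 := norm_coords_triangle e x p p₀
    have h5 := norm_nonneg (x - (p : E))
    simp only [hS, mem_ofPred_eq]
    linarith
  have hK₁D : ∀ x ∈ K₁, ‖x - p‖ ≤ D := fun x hx => by
    have h1 := hD₀ x hx
    have h2 := hD₀ p hpK
    have h3 : ‖x - p‖ ≤ ‖x - p₀‖ + ‖(p : E) - p₀‖ := by
      rw [show x - (p : E) = (x - p₀) - (p - p₀) by abel]
      exact norm_sub_le _ _
    linarith
  have hp3 : AdaptedSource U e Λ (r / 3) (3 * R / 4) c.1 p :=
    { hp with
      pos := hr3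
      expands := fun x hx => ⟨(hp.expands x hx).1, (hp.expands x hx).2.trans (by linarith)⟩ }
  set Z : Set E := attractedSet e c.1 K₀ p T R with hZ
  have hZK : Z ⊆ K₁ := attractedSet_subset.trans subset_union_left
  have hcontrol : TransportControl e (U : Set E) Z p c.1 (realField c.2) k Q₀
      (decayConst e (r / 3) R T D) 0 (-a) Λ (r / 3) :=
    transportControl_of_bounds hUM hr3 hR hT (by linarith) hϱ0 hp3 subset_union_left hK₁U hball hK₁D
      (fun j hj => hXB j (by omega)) (fun j hj => hAB j (by omega)) hAp (by linarith) (by linarith)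
  have hKZ : K ⊆ Z := by
    intro x hx
    obtain ⟨β, h0, hβ, -, -⟩ := hp.star.exists_backwardCurve (hKU hx)
    obtain ⟨h1, h2⟩ := htraj p hp.zero hpp β (h0 ▸ hx) hβ
    exact ⟨β, h0, hβ, fun s hs => ⟨h1 s hs, h2 s⟩⟩
  -- the jet of the solution
  set j₀ : JetModel E V N := modelJet N p u with hj₀
  have hj₀B : ‖j₀‖ ≤ κ * B := by
    refine (hJ j₀).trans (mul_le_mul_of_nonneg_left ?_ hκ)
    rw [hj₀, jet_transport hUM c hp.zero u]
    exact norm_modelJet_le hB fun j hj => hv j (by omega) p hpK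
  -- The solution is split into P, controlled through the uniform lower bound for the jet operator,
  -- and u - P, whose jet vanishes and to which the weighted estimate applies.
  set P : SmoothMap U V := jetRealization U N p j₀ with hP
  have hPB : ∀ i ≤ m + 1, ∀ x ∈ K₁, ‖iteratedFDeriv ℝ i P x‖ ≤ Q₂ * κ * B := fun i hi x hx => by
    rw [hP, iteratedFDeriv_jetRealization (hK₁U hx)]
    refine (hQ₂ j₀ i hi (x - p) (by simpa using hK₁D x hx)).trans ?_
    rw [mul_assoc]
    gcongr
  have hjet : jet N p (u - P) = 0 := by
    rw [map_sub, hP, jet_jetRealization, toJet_modelJet, sub_self]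
  set w : SmoothMap U V := transport hUM c.1 c.2 (u - P) with hw
  have hwB : ∀ i ≤ m, ∀ x ∈ K₁, ‖iteratedFDeriv ℝ i w x‖ ≤ Q₄ * B := by
    intro i hi x hx
    have h1 : iteratedFDeriv ℝ i w x = iteratedFDeriv ℝ i (transport hUM c.1 c.2 u) x -
        iteratedFDeriv ℝ i (transport hUM c.1 c.2 P) x := by
      rw [hw, transport_sub]
      exact iteratedFDeriv_sub_apply (SmoothMap.contDiffAt _ (hK₁U hx))
        (SmoothMap.contDiffAt _ (hK₁U hx))
    have h2 := norm_iteratedFDeriv_transport_le hUM c.1 c.2 (f := P) (m := m) (hK₁U hx) hi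
      (fun l hl => hXB l (by omega) x hx) (fun l hl => hAB l (by omega) x hx)
      (fun l hl => hPB l hl x hx)
    rw [h1]
    refine (norm_sub_le _ _).trans ((add_le_add (hv i hi x hx) h2).trans_eq ?_)
    rw [hQ₄, hQ₃]
    ring
  have hjw : jet N p w = 0 := jet_transport_eq_zero hUM c.1 c.2 hp.zero hjet
  have hwW : WeightedBound Z (p : E) k N (Q₄ * B / ϱ ^ N) w :=
    weightedBound_of_iteratedFDeriv_eq_zero U.isOpen w.contDiffOn hϱ0 (min_le_left _ _)
      (hball.trans hK₁U) (jet_eq_zero_iff.1 hjw)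
      (fun j hj x hx => hwB j (hj.trans (le_max_right _ _)) x (hball hx))
      (fun j hj x hx => hwB j (hj.trans (le_max_left _ _)) x (hZK hx))
  -- Only the existence of this constant matters; it does not enter the final bound.
  have huW : ∃ K₀, WeightedBound Z (p : E) k N K₀ (u - P : SmoothMap U V) := by
    obtain ⟨C, -, hC⟩ := (FlatOn.of_iteratedFDeriv_eq_zero (k := k) U.isOpen p.2
      (u - P).contDiffOn (jet_eq_zero_iff.1 hjet)).2 K₁ hK₁U hK₁c
    exact ⟨C, hC.mono_set hZK⟩
  have hfin := hQ₁ U Z p c.1 (realField c.2) hcontrol (Q₄ * B / ϱ ^ N) (u - P : SmoothMap U V) w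
    (by positivity) (u - P).contDiffOn w.contDiffOn
    (fun x hx => (transport_apply hUM c.1 c.2 (u - P) hx).symm) huW hwW
  intro j hj x hx
  have hxU := hKU hx
  have h1 : iteratedFDeriv ℝ j u x =
      iteratedFDeriv ℝ j (u - P : SmoothMap U V) x + iteratedFDeriv ℝ j P x := by
    have : iteratedFDeriv ℝ j (u - P : SmoothMap U V) x =
        iteratedFDeriv ℝ j u x - iteratedFDeriv ℝ j P x :=
      iteratedFDeriv_sub_apply (SmoothMap.contDiffAt _ hxU) (SmoothMap.contDiffAt _ hxU)
    rw [this, sub_add_cancel]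
  have h2 := hfin j hj x (hKZ hx)
  have h3 : ‖x - p‖ ^ (N - j) ≤ D ^ N :=
    (pow_le_pow_left₀ (norm_nonneg _) (hK₁D x (hZK (hKZ hx))) _).trans
      (pow_le_pow_right₀ hD1 (Nat.sub_le _ _))
  have h4 := hPB j (by omega) x (hZK (hKZ hx))
  rw [h1]
  calc _ ≤ Q₁ * (Q₄ * B / ϱ ^ N) * ‖x - p‖ ^ (N - j) + Q₂ * κ * B :=
        (norm_add_le _ _).trans (add_le_add h2 h4)
    _ ≤ Q₁ * (Q₄ * B / ϱ ^ N) * D ^ N + Q₂ * κ * B := by gcongr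
    _ = _ := by ring

end Uniform

/-! ### Continuity and smoothness of the solution operator -/

section SolutionOperator

universe u

variable {E : Type} [NormedAddCommGroup E] [NormedSpace ℝ E]
variable {𝕜 : Type*} [RCLike 𝕜]
variable {V : Type u} [NormedAddCommGroup V] [NormedSpace ℝ V] [NormedSpace 𝕜 V]
  [IsScalarTower ℝ 𝕜 V]
variable {M U : Opens E}

theorem SmoothMap.eventually_forall_norm_lt {F : Type*} [NormedAddCommGroup F] [NormedSpace ℝ F]
    (m : ℕ) {K : Set E} (hK : IsCompact K) (hKU : K ⊆ U) {ε : ℝ} (hε : 0 < ε) :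
    ∀ᶠ f : SmoothMap U F in 𝓝 0, ∀ j ≤ m, ∀ x ∈ K, ‖iteratedFDeriv ℝ j f x‖ < ε := by
  have h : ∀ᶠ f : SmoothMap U F in 𝓝 0, ∀ j ∈ Finset.range (m + 1), ∀ x ∈ K,
      ‖iteratedFDeriv ℝ j f x - iteratedFDeriv ℝ j (0 : SmoothMap U F) x‖ < ε :=
    (Filter.eventually_all_finset _).2 fun j _ => SmoothMap.eventually_norm_sub_lt 0 j hK hKU hε
  filter_upwards [h] with f hf j hj x hx
  have h0 : iteratedFDeriv ℝ j (0 : SmoothMap U F) x = 0 :=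
    congrFun (iteratedFDeriv_fun_zero (𝕜 := ℝ) (E := E) (F := F) (n := j)) x
  simpa [h0] using hf j (Finset.mem_range.2 (by omega)) x hx

variable [FiniteDimensional ℝ E] [FiniteDimensional ℝ V]

/-- Solutions of the transport equation depend continuously on all data. -/
theorem tendsto_solution (hUM : U ≤ M) {ι : Type*} {l : Filter ι}
    {c : ι → SmoothMap M E × SmoothMap U (V →L[𝕜] V)} {u v : ι → SmoothMap U V}
    {c₀ : SmoothMap M E × SmoothMap U (V →L[𝕜] V)} {u₀ v₀ : SmoothMap U V}
    (hc₀ : c₀ ∈ regularData 𝕜 V hUM) (hc : Tendsto c l (𝓝 c₀)) (hv : Tendsto v l (𝓝 v₀))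
    (hu : ∀ᶠ i in l, transport hUM (c i).1 (c i).2 (u i) = v i)
    (hu₀ : transport hUM c₀.1 c₀.2 u₀ = v₀) : Tendsto u l (𝓝 u₀) := by
  -- This is the image of u i - u₀ under the i-th operator. The fixed u₀ absorbs the change of
  -- coefficients, so the uniform estimate applies despite the loss of derivatives.
  have hw : Tendsto (fun i => v i - transport hUM (c i).1 (c i).2 u₀) l (𝓝 0) := by
    have h1 : Tendsto (fun i => transport hUM (c i).1 (c i).2 u₀) l
        (𝓝 (transport hUM c₀.1 c₀.2 u₀)) :=
      ((continuous_transport hUM).tendsto (c₀, u₀)).comp (hc.prodMk_nhds tendsto_const_nhds)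
    have h2 := hv.sub h1
    rwa [hu₀, sub_self] at h2
  have hdiff : Tendsto (fun i => u i - u₀) l (𝓝 0) := by
    refine SmoothMap.tendsto_zero fun k K hK hKU ε hε => ?_
    obtain ⟨K₁, hK₁, hK₁U, m, Q, hQ, hest⟩ := exists_apriori_estimate hUM hc₀ hK hKU k
    have hδ : 0 < ε / (Q + 1) := by positivity
    filter_upwards [hc.eventually hest, hu,
      hw.eventually (SmoothMap.eventually_forall_norm_lt m hK₁ hK₁U hδ)] with i hi hui hwi x hx
    have h1 := hi (u i - u₀) (ε / (Q + 1)) hδ.le (by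
      rw [transport_sub, hui]
      exact fun j hj x hx => (hwi j hj x hx).le) k le_rfl x hx
    refine h1.trans_lt ?_
    rw [mul_div_assoc', div_lt_iff₀ (by positivity)]
    nlinarith
  have := hdiff.add_const u₀
  simpa using this

variable (𝕜 V) in
/-- The space of data `((X, A), v)` of the transport equation. -/
abbrev TransportData (M U : Opens E) : Type _ :=
  (SmoothMap M E × SmoothMap U (V →L[𝕜] V)) × SmoothMap U V

/-- The right-hand side of the equation for the `(k + 1)`-st derivative of the solution operator, in
terms of the `k`-th derivative. -/
def derivativeRhs (hUM : U ≤ M) (k : ℕ) (d : (Fin k → TransportData 𝕜 V M U) → SmoothMap U V)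
    (h : Fin (k + 1) → TransportData 𝕜 V M U) : SmoothMap U V :=
  (if k = 0 then (h 0).2 else 0) -
    ∑ i, transport hUM (h i).1.1 (h i).1.2 (d fun j => h (i.succAbove j))

/-- The iterated directional derivatives of the solution operator. -/
def solutionDeriv (hUM : U ≤ M) (S : TransportData 𝕜 V M U → SmoothMap U V) :
    (k : ℕ) → TransportData 𝕜 V M U → (Fin k → TransportData 𝕜 V M U) → SmoothMap U V
  | 0, x, _ => S x
  | k + 1, x, h => S (x.1, derivativeRhs hUM k (solutionDeriv hUM S k x) h)

variable {S : TransportData 𝕜 V M U → SmoothMap U V}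

theorem continuousOn_solution (hUM : U ≤ M)
    (hS : ∀ c ∈ regularData 𝕜 V hUM, ∀ v, transport hUM c.1 c.2 (S (c, v)) = v) :
    ContinuousOn S (regularData 𝕜 V hUM ×ˢ univ) := by
  intro x hx
  have hx1 : x.1 ∈ regularData 𝕜 V hUM := hx.1
  refine tendsto_solution hUM (l := 𝓝[regularData 𝕜 V hUM ×ˢ univ] x) (c := fun y => y.1)
    (v := fun y => y.2) (u := S) hx1 ((continuous_fst.tendsto x).mono_left nhdsWithin_le_nhds)
    ((continuous_snd.tendsto x).mono_left nhdsWithin_le_nhds) ?_ (hS x.1 hx1 x.2)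
  filter_upwards [self_mem_nhdsWithin] with y hy
  exact hS y.1 hy.1 y.2

/-- The (k + 1)-st derivative is S composed with a continuous expression in the k-th derivative and
the directions. -/
theorem continuousOn_solutionDeriv (hUM : U ≤ M)
    (hS : ∀ c ∈ regularData 𝕜 V hUM, ∀ v, transport hUM c.1 c.2 (S (c, v)) = v) (k : ℕ) :
    ContinuousOn (fun q : TransportData 𝕜 V M U × (Fin k → TransportData 𝕜 V M U) =>
      solutionDeriv hUM S k q.1 q.2) ((regularData 𝕜 V hUM ×ˢ univ) ×ˢ univ) := by
  induction k with
  | zero =>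
    exact (continuousOn_solution hUM hS).comp continuousOn_fst fun q hq => hq.1
  | succ k ih =>
    refine (continuousOn_solution hUM hS).comp
      (f := fun q : TransportData 𝕜 V M U × (Fin (k + 1) → TransportData 𝕜 V M U) =>
        (q.1.1, derivativeRhs hUM k (solutionDeriv hUM S k q.1) q.2)) ?_
      (fun q hq => ⟨hq.1.1, trivial⟩)
    refine ContinuousOn.prodMk (continuous_fst.comp continuous_fst).continuousOn ?_
    refine ContinuousOn.sub ?_ (continuousOn_finsetSum _ fun i _ => ?_)
    · split_ifs
      · exact (continuous_snd.comp ((continuous_apply 0).comp continuous_snd)).continuousOn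
      · exact continuousOn_const
    · have h1 : ContinuousOn
          (fun q : TransportData 𝕜 V M U × (Fin (k + 1) → TransportData 𝕜 V M U) =>
            solutionDeriv hUM S k q.1 fun j => q.2 (i.succAbove j))
          ((regularData 𝕜 V hUM ×ˢ univ) ×ˢ univ) :=
        ih.comp (f := fun q : TransportData 𝕜 V M U × (Fin (k + 1) → TransportData 𝕜 V M U) =>
          (q.1, fun j => q.2 (i.succAbove j))) (Continuous.continuousOn (by fun_prop))
          (fun q hq => ⟨hq.1, trivial⟩)
      have h2 : Continuous
          (fun q : TransportData 𝕜 V M U × (Fin (k + 1) → TransportData 𝕜 V M U) => (q.2 i).1) := by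
        fun_prop
      exact (continuous_transport hUM).comp_continuousOn (h2.continuousOn.prodMk h1)

/-- Separates the newest direction h' from the earlier ones. The contribution of v is absent because
it enters the equation linearly and is used up by the first derivative. -/
theorem derivativeRhs_snoc (hUM : U ≤ M) (k : ℕ)
    (d : (Fin (k + 1) → TransportData 𝕜 V M U) → SmoothMap U V)
    (h : Fin (k + 1) → TransportData 𝕜 V M U) (h' : TransportData 𝕜 V M U) :
    derivativeRhs hUM (k + 1) d (Fin.snoc (α := fun _ => TransportData 𝕜 V M U) h h') =
      -(∑ i, transport hUM (h i).1.1 (h i).1.2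
        (d (Fin.snoc (α := fun _ => TransportData 𝕜 V M U) (fun j => h (i.succAbove j)) h'))) -
        transport hUM h'.1.1 h'.1.2 (d h) := by
  rw [derivativeRhs, if_neg (Nat.succ_ne_zero k), zero_sub, Fin.sum_univ_castSucc, neg_add,
    ← sub_eq_add_neg]
  congr 1
  · congr 1
    refine Finset.sum_congr rfl fun i _ => ?_
    rw [Fin.snoc_castSucc]
    congr 2
    funext j
    refine Fin.lastCases ?_ (fun j => ?_) j
    · have hlast : i.castSucc.succAbove (Fin.last k) = Fin.last (k + 1) := by
        rw [Fin.succAbove_of_le_castSucc _ _ (Fin.castSucc_le_castSucc_iff.2 (Fin.le_last i)),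
          Fin.succ_last]
      rw [hlast, Fin.snoc_last, Fin.snoc_last]
    · rw [Fin.castSucc_succAbove_castSucc, Fin.snoc_castSucc, Fin.snoc_castSucc]
  · rw [Fin.snoc_last]
    congr 2
    funext j
    rw [Fin.succAbove_last, Fin.snoc_castSucc]

/-- Write T_c u for the transport operator, which is bilinear in the data c and in u. The difference
quotient in direction h' then solves an equation with coefficients x + t h'. Its right-hand side is
the quotient of the right-hand sides minus T_{h'} applied to the unperturbed derivative, and it
converges by induction. `tendsto_solution` passes to the limit. -/
theorem tendsto_solutionDeriv_quotient (hUM : U ≤ M)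
    (hS : ∀ c ∈ regularData 𝕜 V hUM, ∀ v, transport hUM c.1 c.2 (S (c, v)) = v) (k : ℕ) :
    ∀ x ∈ regularData 𝕜 V hUM ×ˢ (univ : Set (SmoothMap U V)),
      ∀ (h : Fin k → TransportData 𝕜 V M U) (h' : TransportData 𝕜 V M U),
      Tendsto (fun t : ℝ => t⁻¹ • (solutionDeriv hUM S k (x + t • h') h - solutionDeriv hUM S k x h))
        (𝓝[≠] 0) (𝓝 (solutionDeriv hUM S (k + 1) x
          (Fin.snoc (α := fun _ => TransportData 𝕜 V M U) h h'))) := by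
  have hline : ∀ x h' : TransportData 𝕜 V M U,
      Tendsto (fun t : ℝ => (x + t • h').1) (𝓝[≠] 0) (𝓝 x.1) := by
    intro x h'
    have h1 : Tendsto (fun t : ℝ => x.1 + t • h'.1) (𝓝 0) (𝓝 (x.1 + (0 : ℝ) • h'.1)) :=
      Continuous.tendsto (by fun_prop) 0
    rw [zero_smul, add_zero] at h1
    exact h1.mono_left nhdsWithin_le_nhds
  have hreg : ∀ x ∈ regularData 𝕜 V hUM ×ˢ (univ : Set (SmoothMap U V)),
      ∀ h' : TransportData 𝕜 V M U, ∀ᶠ t : ℝ in 𝓝[≠] 0, (x + t • h').1 ∈ regularData 𝕜 V hUM :=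
    fun x hx h' => (hline x h').eventually ((isOpen_regularData hUM).mem_nhds hx.1)
  have hquot : ∀ (x h' : TransportData 𝕜 V M U) (t : ℝ) (w w' : SmoothMap U V), t ≠ 0 →
      transport hUM (x + t • h').1.1 (x + t • h').1.2 (t⁻¹ • (w' - w)) =
        t⁻¹ • (transport hUM (x + t • h').1.1 (x + t • h').1.2 w' - transport hUM x.1.1 x.1.2 w) -
          transport hUM h'.1.1 h'.1.2 w := by
    intro x h' t w w' ht
    have h1 : transport hUM (x + t • h').1.1 (x + t • h').1.2 w =
        transport hUM x.1.1 x.1.2 w + t • transport hUM h'.1.1 h'.1.2 w :=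
      (transport_data_add hUM x.1 (t • h'.1) w).trans (by rw [transport_data_smul])
    rw [transport_smul, transport_sub, h1, ← sub_sub, smul_sub, smul_smul, inv_mul_cancel₀ ht,
      one_smul]
  induction k with
  | zero =>
    intro x hx h h'
    refine tendsto_solution hUM (c := fun t : ℝ => (x + t • h').1) (v := fun _ => _) hx.1
      (hline x h') tendsto_const_nhds ?_ (hS x.1 hx.1 _)
    filter_upwards [hreg x hx h', self_mem_nhdsWithin] with t ht ht0
    have ht0' : t ≠ 0 := ht0
    rw [hquot x h' t _ _ ht0']
    have h1 : transport hUM (x + t • h').1.1 (x + t • h').1.2 (S (x + t • h')) = (x + t • h').2 :=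
      hS _ ht _
    have h2 : transport hUM x.1.1 x.1.2 (S x) = x.2 := hS _ hx.1 _
    simp only [solutionDeriv]
    rw [h1, h2, Prod.snd_add, Prod.smul_snd, add_sub_cancel_left, smul_smul, inv_mul_cancel₀ ht0',
      one_smul, derivativeRhs, if_pos rfl]
    simp [Fin.snoc]
  | succ k ih =>
    intro x hx h h'
    refine tendsto_solution hUM (c := fun t : ℝ => (x + t • h').1) (v := fun t : ℝ =>
      -(∑ i, transport hUM (h i).1.1 (h i).1.2
        (t⁻¹ • (solutionDeriv hUM S k (x + t • h') (fun j => h (i.succAbove j)) -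
          solutionDeriv hUM S k x (fun j => h (i.succAbove j))))) -
        transport hUM h'.1.1 h'.1.2 (solutionDeriv hUM S (k + 1) x h)) hx.1
      (hline x h') ?_ ?_ (hS x.1 hx.1 _)
    · rw [derivativeRhs_snoc]
      refine Tendsto.sub_const (Tendsto.neg (tendsto_finsetSum _ fun i _ => ?_)) _
      have hcont : Continuous (transport hUM (h i).1.1 (h i).1.2 : SmoothMap U V → SmoothMap U V) :=
        (continuous_transport hUM).comp (f := fun w => ((h i).1, w))
          (continuous_const.prodMk continuous_id)
      exact (hcont.tendsto _).comp (ih x hx (fun j => h (i.succAbove j)) h')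
    · filter_upwards [hreg x hx h', self_mem_nhdsWithin] with t ht ht0
      have ht0' : t ≠ 0 := ht0
      rw [hquot x h' t _ _ ht0']
      have h1 : transport hUM (x + t • h').1.1 (x + t • h').1.2
          (solutionDeriv hUM S (k + 1) (x + t • h') h) =
          derivativeRhs hUM k (solutionDeriv hUM S k (x + t • h')) h := hS _ ht _
      have h2 : transport hUM x.1.1 x.1.2 (solutionDeriv hUM S (k + 1) x h) =
          derivativeRhs hUM k (solutionDeriv hUM S k x) h := hS _ hx.1 _
      rw [h1, h2, derivativeRhs, derivativeRhs, sub_sub_sub_cancel_left, ← Finset.sum_sub_distrib,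
        Finset.smul_sum, ← Finset.sum_neg_distrib]
      congr 1
      refine Finset.sum_congr rfl fun i _ => ?_
      rw [transport_smul, transport_sub, ← smul_neg, neg_sub]

theorem frechetSmoothOn_solution (hUM : U ≤ M)
    (hS : ∀ c ∈ regularData 𝕜 V hUM, ∀ v, transport hUM c.1 c.2 (S (c, v)) = v) :
    FrechetSmoothOn S (regularData 𝕜 V hUM ×ˢ univ) :=
  ⟨solutionDeriv hUM S, fun _ _ _ => rfl, tendsto_solutionDeriv_quotient hUM hS,
    continuousOn_solutionDeriv hUM hS⟩

end SolutionOperator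

end SingularTransport

end

/-- The solution operator appears as an arbitrary S solving the equation over the regular data. By
the uniqueness part it is determined there, and its values elsewhere play no role. -/
theorem mainTheorem3 (n : ℕ) {𝕜 : Type*} [RCLike 𝕜]
    {V : Type*} [NormedAddCommGroup V] [NormedSpace ℝ V] [NormedSpace 𝕜 V]
    [IsScalarTower ℝ 𝕜 V] [FiniteDimensional 𝕜 V]
    (M U : TopologicalSpace.Opens (EuclideanSpace ℝ (Fin n))) (hUM : U ≤ M) :
    IsOpen (SingularTransport.regularData 𝕜 V hUM) ∧
    (∀ c ∈ SingularTransport.regularData 𝕜 V hUM, ∀ v : SingularTransport.SmoothMap U V,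
      ∃! u : SingularTransport.SmoothMap U V, SingularTransport.transport hUM c.1 c.2 u = v) ∧
    ∀ S : (SingularTransport.SmoothMap M (EuclideanSpace ℝ (Fin n)) ×
          SingularTransport.SmoothMap U (V →L[𝕜] V)) × SingularTransport.SmoothMap U V →
        SingularTransport.SmoothMap U V,
      (∀ c ∈ SingularTransport.regularData 𝕜 V hUM, ∀ v : SingularTransport.SmoothMap U V,
        SingularTransport.transport hUM c.1 c.2 (S (c, v)) = v) →
      SingularTransport.FrechetSmoothOn S
        (SingularTransport.regularData 𝕜 V hUM ×ˢ (Set.univ : Set (SingularTransport.SmoothMap U V))) := by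
  have : FiniteDimensional ℝ V := Module.Finite.trans 𝕜 V
  exact ⟨SingularTransport.isOpen_regularData hUM,
    fun c hc v => SingularTransport.existsUnique_transport_eq hUM hc v,
    fun S hS => SingularTransport.frechetSmoothOn_solution hUM hS⟩
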